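/- Let $L,\rho,\mu,\alpha_1,\beta,c,\kappa,l_1,l_2,\eta>0$, $0<a<1$ and $\gamma,\delta\in\mathbb R$. Put $\alpha=\alpha_1+\gamma^2\beta$ and $\mu(\xi)=|\xi|^{(2a-1)/2}$ for $\xi\in\mathbb R$. All function spaces are complex. Let $H^1_*(0,L)=\{v\in H^1(0,L): v(0)=0\}$ and $$\mathcal H_1=H^1_*(0,L)\times L^2(0,L)\times L^2(\mathbb R)\times H^1_*(0,L)\times L^2(0,L)\times L^2(\mathbb R)\times L^2(0,L),$$ with elements $U=(V,f,\phi_1,P,g,\phi_2,\theta)$ and the inner product $$\langle U_1,U_2\rangle=\int_0^L\Big[\rho f_1\overline{f_2}+\mu g_1\overline{g_2}+\alpha_1V_{1,x}\overline{V_{2,x}}+\beta(\gamma V_{1,x}-P_{1,x})\overline{(\gamma V_{2,x}-P_{2,x})}+c\,\theta_1\overline{\theta_2}\Big]dx+\frac{\sin(a\pi)}{\pi}\int_{\mathbb R}\big(l_1\phi_{1,1}\overline{\phi_{1,2}}+l_2\phi_{2,1}\overline{\phi_{2,2}}\big)d\xi ,$$ where $U_i=(V_i,f_i,\phi_{1,i},P_i,g_i,\phi_{2,i},\theta_i)$.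 Let $\mathcal A_1:\mathcal D(\mathcal A_1)\subset\mathcal H_1\to\mathcal H_1$ be the operator $$\mathcal A_1U=\Big(f,\ \tfrac{\alpha}{\rho}V_{xx}-\tfrac{\gamma\beta}{\rho}P_{xx}-\tfrac{\delta}{\rho}\theta_x,\ -(\xi^2+\eta)\phi_1+f(L)\mu(\xi),\ g,\ -\tfrac{\gamma\beta}{\mu}V_{xx}+\tfrac{\beta}{\mu}P_{xx},\ -(\xi^2+\eta)\phi_2+g(L)\mu(\xi),\ \tfrac{\kappa}{c}\theta_{xx}-\tfrac{\delta}{c}f_x\Big),$$ whose domain $\mathcal D(\mathcal A_1)$ consists of all $U\in\mathcal H_1$ such that $V,P\in H^2(0,L)\cap H^1_*(0,L)$; $f,g\in H^1_*(0,L)$; $\theta\in H^2(0,L)$ with $\theta_x(0)=\theta(L)=0$; $|\xi|\phi_1,|\xi|\phi_2\in L^2(\mathbb R)$; $-(\xi^2+\eta)\phi_1+f(L)\mu(\xi)\in L^2(\mathbb R)$ and $-(\xi^2+\eta)\phi_2+g(L)\mu(\xi)\in L^2(\mathbb R)$; and $$\alpha V_x(L)-\gamma\beta P_x(L)=-l_1\frac{\sin(a\pi)}{\pi}\int_{\mathbb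 R}\mu(\xi)\phi_1(\xi)\,d\xi,\qquad \beta P_x(L)-\gamma\beta V_x(L)=-l_2\frac{\sin(a\pi)}{\pi}\int_{\mathbb R}\mu(\xi)\phi_2(\xi)\,d\xi .$$ Then $\mathcal A_1$ is the infinitesimal generator of a $C_0$-semigroup of contractions $\{\mathcal S_{\mathcal A_1}(t)\}_{t\ge0}$ on $\mathcal H_1$, and for every $U_0\in\mathcal D(\mathcal A_1)$ the Cauchy problem $$U_t=\mathcal A_1U\quad (t\ge 0),\qquad U(0)=U_0,$$ has a unique solution $U\in C([0,\infty);\mathcal D(\mathcal A_1))\cap C^1([0,\infty);\mathcal H_1)$, where $\mathcal D(\mathcal A_1)$ carries the graph norm; it is given by $U(t)=\mathcal S_{\mathcal A_1}(t)U_0$. -/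

import Mathlib

open MeasureTheory Set Filter Topology
open scoped ContDiff

namespace PiezoBeam

/-! ### Sobolev spaces on the interval `(0, L)` -/

/-- The complex Lebesgue space `L²(0, L)`. -/
abbrev L2Beam (L : ℝ) : Type := Lp ℂ 2 (volume.restrict (Ioo 0 L))

/-- The complex Lebesgue space `L²(-∞, ∞)`. -/
abbrev L2Line : Type := Lp ℂ 2 (volume : Measure ℝ)

/-- `w ∈ L²(0, L)` is the weak derivative of `v ∈ L²(0, L)`. -/
def HasWeakDeriv (L : ℝ) (v w : L2Beam L) : Prop :=
  ∀ φ : ℝ → ℝ, ContDiff ℝ ∞ φ → HasCompactSupport φ → tsupport φ ⊆ Ioo 0 L →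
    ∫ x in Ioo 0 L, deriv φ x • v x = - ∫ x in Ioo 0 L, φ x • w x

theorem integrable_smul_of_continuous {L : ℝ} (v : L2Beam L) {φ : ℝ → ℝ}
    (hφ : Continuous φ) : Integrable (fun x => φ x • v x) (volume.restrict (Ioo 0 L)) := by
  have hv : Integrable (v : ℝ → ℂ) (volume.restrict (Ioo 0 L)) :=
    (Lp.memLp v).integrable (by norm_num)
  obtain ⟨C, hC⟩ := isCompact_Icc.exists_bound_of_continuousOn
    (hφ.continuousOn (s := Icc 0 L))
  refine hv.bdd_smul C hφ.aestronglyMeasurable ?_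
  filter_upwards [ae_restrict_mem measurableSet_Ioo] with x hx
  exact hC x (Ioo_subset_Icc_self hx)

theorem HasWeakDeriv.add {L : ℝ} {v w v' w' : L2Beam L} (h : HasWeakDeriv L v w)
    (h' : HasWeakDeriv L v' w') : HasWeakDeriv L (v + v') (w + w') := by
  intro φ h1 h2 h3
  have hd : Continuous (deriv φ) := h1.continuous_deriv (by simp)
  have e1 : ∫ x in Ioo 0 L, deriv φ x • (v + v' : L2Beam L) x
      = ∫ x in Ioo 0 L, (deriv φ x • v x + deriv φ x • v' x) := by
    refine integral_congr_ae ?_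
    filter_upwards [Lp.coeFn_add v v'] with x hx
    rw [hx, Pi.add_apply, smul_add]
  have e2 : ∫ x in Ioo 0 L, φ x • (w + w' : L2Beam L) x
      = ∫ x in Ioo 0 L, (φ x • w x + φ x • w' x) := by
    refine integral_congr_ae ?_
    filter_upwards [Lp.coeFn_add w w'] with x hx
    rw [hx, Pi.add_apply, smul_add]
  rw [e1, e2, integral_add (integrable_smul_of_continuous v hd)
    (integrable_smul_of_continuous v' hd), integral_add
    (integrable_smul_of_continuous w h1.continuous)
    (integrable_smul_of_continuous w' h1.continuous), h φ h1 h2 h3, h' φ h1 h2 h3]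
  ring

theorem HasWeakDeriv.smul {L : ℝ} {v w : L2Beam L} (r : ℂ) (h : HasWeakDeriv L v w) :
    HasWeakDeriv L (r • v) (r • w) := by
  intro φ h1 h2 h3
  have e1 : ∫ x in Ioo 0 L, deriv φ x • (r • v : L2Beam L) x
      = ∫ x in Ioo 0 L, r * (deriv φ x • v x) := by
    refine integral_congr_ae ?_
    filter_upwards [Lp.coeFn_smul r v] with x hx
    rw [hx, Pi.smul_apply, smul_eq_mul, mul_smul_comm]
  have e2 : ∫ x in Ioo 0 L, φ x • (r • w : L2Beam L) x
      = ∫ x in Ioo 0 L, r * (φ x • w x) := by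
    refine integral_congr_ae ?_
    filter_upwards [Lp.coeFn_smul r w] with x hx
    rw [hx, Pi.smul_apply, smul_eq_mul, mul_smul_comm]
  rw [e1, e2, integral_const_mul, integral_const_mul, h φ h1 h2 h3]
  ring

theorem hasWeakDeriv_zero (L : ℝ) : HasWeakDeriv L 0 0 := by
  intro φ h1 h2 h3
  have e : ∀ ψ : ℝ → ℝ, ∫ x in Ioo 0 L, ψ x • (0 : L2Beam L) x = 0 := by
    intro ψ
    refine integral_eq_zero_of_ae ?_
    filter_upwards [Lp.coeFn_zero ℂ 2 (volume.restrict (Ioo 0 L))] with x hx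
    simp only [hx, Pi.zero_apply, smul_zero]
  rw [e, e, neg_zero]

theorem HasWeakDeriv.unique {L : ℝ} {v w w' : L2Beam L} (h : HasWeakDeriv L v w)
    (h' : HasWeakDeriv L v w') : w = w' := by
  have hw : ∀ u : L2Beam L, IntegrableOn (u : ℝ → ℂ) (Ioo 0 L) := fun u =>
    (Lp.memLp u).integrable (by norm_num)
  have key := isOpen_Ioo.ae_eq_zero_of_integral_contDiff_smul_eq_zero (μ := volume)
    (U := Ioo 0 L) (f := fun x => w x - w' x)
    ((hw w).sub (hw w')).locallyIntegrableOn ?_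
  · refine Lp.ext ?_
    have := (ae_restrict_iff' (μ := volume) measurableSet_Ioo).2 key
    filter_upwards [this] with x hx
    exact sub_eq_zero.1 hx
  · intro g h1 h2 h3
    have e : ∫ x, g x • (w x - w' x) = ∫ x in Ioo 0 L, (g x • w x - g x • w' x) := by
      rw [← setIntegral_eq_integral_of_forall_compl_eq_zero (s := Ioo 0 L)]
      · simp only [smul_sub]
      · intro x hx
        rw [image_eq_zero_of_notMem_tsupport fun hx' => hx (h3 hx'), zero_smul]
    rw [e, integral_sub (integrable_smul_of_continuous w h1.continuous)
      (integrable_smul_of_continuous w' h1.continuous), sub_eq_zero, ← neg_inj,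
      ← h g h1 h2 h3, h' g h1 h2 h3]

/-- The Sobolev space `H¹(0, L)`. -/
def H1 (L : ℝ) : Submodule ℂ (L2Beam L) where
  carrier := {v | ∃ w, HasWeakDeriv L v w}
  zero_mem' := ⟨0, hasWeakDeriv_zero L⟩
  add_mem' := fun ⟨_, h⟩ ⟨_, h'⟩ => ⟨_, h.add h'⟩
  smul_mem' := fun r _ ⟨_, h⟩ => ⟨_, h.smul r⟩

open Classical in
/-- The weak derivative `v_x` of `v ∈ H¹(0, L)` (with value `0` if `v ∉ H¹(0, L)`). -/
noncomputable def weakDeriv (L : ℝ) (v : L2Beam L) : L2Beam L :=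
  if h : ∃ w, HasWeakDeriv L v w then h.choose else 0

theorem weakDeriv_spec {L : ℝ} {v : L2Beam L} (h : v ∈ H1 L) :
    HasWeakDeriv L v (weakDeriv L v) := by
  have h' : ∃ w, HasWeakDeriv L v w := h
  rw [weakDeriv, dif_pos h']
  exact h'.choose_spec

theorem HasWeakDeriv.weakDeriv_eq {L : ℝ} {v w : L2Beam L} (h : HasWeakDeriv L v w) :
    weakDeriv L v = w :=
  (weakDeriv_spec ⟨w, h⟩).unique h

theorem weakDeriv_add {L : ℝ} {v w : L2Beam L} (hv : v ∈ H1 L) (hw : w ∈ H1 L) :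
    weakDeriv L (v + w) = weakDeriv L v + weakDeriv L w :=
  ((weakDeriv_spec hv).add (weakDeriv_spec hw)).weakDeriv_eq

theorem weakDeriv_smul {L : ℝ} {v : L2Beam L} (r : ℂ) (hv : v ∈ H1 L) :
    weakDeriv L (r • v) = r • weakDeriv L v :=
  ((weakDeriv_spec hv).smul r).weakDeriv_eq

theorem weakDeriv_zero (L : ℝ) : weakDeriv L 0 = 0 :=
  (hasWeakDeriv_zero L).weakDeriv_eq

/-- The Sobolev space `H²(0, L)`. -/
def H2 (L : ℝ) : Submodule ℂ (L2Beam L) where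
  carrier := {v | v ∈ H1 L ∧ weakDeriv L v ∈ H1 L}
  zero_mem' := ⟨zero_mem _, by rw [weakDeriv_zero]; exact zero_mem _⟩
  add_mem' := fun ⟨h1, h2⟩ ⟨h3, h4⟩ =>
    ⟨add_mem h1 h3, by rw [weakDeriv_add h1 h3]; exact add_mem h2 h4⟩
  smul_mem' := fun r _ ⟨h1, h2⟩ =>
    ⟨Submodule.smul_mem _ r h1, by rw [weakDeriv_smul r h1]; exact Submodule.smul_mem _ r h2⟩

/-- `g` is a representative of `v` that is continuous on `[0, L]`. -/
def IsContRep (L : ℝ) (v : L2Beam L) (g : ℝ → ℂ) : Prop :=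
  ContinuousOn g (Icc 0 L) ∧ v =ᵐ[volume.restrict (Ioo 0 L)] g

open Classical in
/-- The value at `x ∈ [0, L]` of the continuous representative of `v`
(with value `0` if there is no such representative). -/
noncomputable def pointValue (L : ℝ) (v : L2Beam L) (x : ℝ) : ℂ :=
  if h : ∃ g, IsContRep L v g then h.choose x else 0

theorem IsContRep.eqOn {L : ℝ} (hL : 0 < L) {v : L2Beam L} {g g' : ℝ → ℂ}
    (h : IsContRep L v g) (h' : IsContRep L v g') : EqOn g g' (Icc 0 L) := by
  refine Measure.eqOn_Icc_of_ae_eq volume hL.ne ?_ h.1 h'.1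
  rw [← restrict_Ioo_eq_restrict_Icc]
  exact h.2.symm.trans h'.2

theorem IsContRep.pointValue_eq {L : ℝ} (hL : 0 < L) {v : L2Beam L} {g : ℝ → ℂ}
    (h : IsContRep L v g) {x : ℝ} (hx : x ∈ Icc 0 L) : pointValue L v x = g x := by
  have h' : ∃ g, IsContRep L v g := ⟨g, h⟩
  rw [pointValue, dif_pos h']
  exact h'.choose_spec.eqOn hL h hx

/-- Integration by parts for a primitive. -/
theorem integral_deriv_smul_primitive {L : ℝ} (w : L2Beam L) {φ : ℝ → ℝ}
    (h1 : ContDiff ℝ ∞ φ) (h3 : tsupport φ ⊆ Ioo 0 L) :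
    ∫ x in Ioo 0 L, deriv φ x • (∫ y in (0 : ℝ)..x, w y) = - ∫ x in Ioo 0 L, φ x • w x := by
  have hd : Continuous (deriv φ) := h1.continuous_deriv (by simp)
  have hw : Integrable (w : ℝ → ℂ) (volume.restrict (Ioo 0 L)) :=
    (Lp.memLp w).integrable (by norm_num)
  have hdi : Integrable (deriv φ) (volume.restrict (Ioo 0 L)) :=
    (hd.integrableOn_Icc (a := 0) (b := L)).mono_set Ioo_subset_Icc_self
  have hm : MeasurableSet {z : ℝ × ℝ | z.2 ≤ z.1} := measurableSet_le measurable_snd measurable_fst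
  have hF : Integrable (Function.uncurry fun x y : ℝ =>
      {z : ℝ × ℝ | z.2 ≤ z.1}.indicator (fun z => deriv φ z.1 • w z.2) (x, y))
      ((volume.restrict (Ioo 0 L)).prod (volume.restrict (Ioo 0 L))) := by
    have := (hdi.smul_prod hw).indicator hm
    exact this
  have hswap := integral_integral_swap hF
  have el : ∀ x ∈ Ioo 0 L, (∫ y in Ioo 0 L, {z : ℝ × ℝ | z.2 ≤ z.1}.indicator
      (fun z => deriv φ z.1 • w z.2) (x, y)) = deriv φ x • (∫ y in (0 : ℝ)..x, w y) := by
    intro x hx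
    rw [intervalIntegral.integral_of_le hx.1.le, ← integral_smul]
    have : (fun y => {z : ℝ × ℝ | z.2 ≤ z.1}.indicator (fun z => deriv φ z.1 • w z.2) (x, y))
        = (Iic x).indicator (fun y => deriv φ x • w y) := by
      ext y
      simp [indicator, mem_Iic]
    rw [this, setIntegral_indicator measurableSet_Iic]
    congr 2
    ext y
    simp only [mem_inter_iff, mem_Ioo, mem_Iic, mem_Ioc]
    exact ⟨fun h => ⟨h.1.1, h.2⟩, fun h => ⟨⟨h.1, h.2.trans_lt hx.2⟩, h.2⟩⟩
  have er : ∀ y ∈ Ioo 0 L, (∫ x in Ioo 0 L, {z : ℝ × ℝ | z.2 ≤ z.1}.indicator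
      (fun z => deriv φ z.1 • w z.2) (x, y)) = -(φ y • w y) := by
    intro y hy
    have : (fun x => {z : ℝ × ℝ | z.2 ≤ z.1}.indicator (fun z => deriv φ z.1 • w z.2) (x, y))
        = (Ici y).indicator (fun x => deriv φ x • w y) := by
      ext x
      simp [indicator, mem_Ici]
    rw [this, setIntegral_indicator measurableSet_Ici, integral_smul_const]
    have hs : Ioo 0 L ∩ Ici y = Ico y L := by
      ext x
      simp only [mem_inter_iff, mem_Ioo, mem_Ici, mem_Ico]
      exact ⟨fun h => ⟨h.2, h.1.2⟩, fun h => ⟨⟨hy.1.trans_le h.1, h.2⟩, h.1⟩⟩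
    rw [hs, ← restrict_Ioo_eq_restrict_Ico, restrict_Ioo_eq_restrict_Ioc,
      ← intervalIntegral.integral_of_le hy.2.le,
      intervalIntegral.integral_deriv_eq_sub
        (fun x _ => (h1.differentiable (by simp)).differentiableAt)
        (hd.intervalIntegrable _ _),
      image_eq_zero_of_notMem_tsupport (f := φ) (x := L) fun h => lt_irrefl _ (h3 h).2]
    simp
  rw [← setIntegral_congr_fun measurableSet_Ioo el, hswap,
    setIntegral_congr_fun measurableSet_Ioo er, integral_neg]

/-- The du Bois-Reymond lemma. -/
theorem ae_eq_const_of_integral_deriv_smul_eq_zero {L : ℝ} (hL : 0 < L) {u : ℝ → ℂ}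
    (hu : IntegrableOn u (Ioo 0 L))
    (h : ∀ φ : ℝ → ℝ, ContDiff ℝ ∞ φ → HasCompactSupport φ → tsupport φ ⊆ Ioo 0 L →
      ∫ x in Ioo 0 L, deriv φ x • u x = 0) :
    ∃ c : ℂ, u =ᵐ[volume.restrict (Ioo 0 L)] fun _ => c := by
  have bdd : ∀ ψ : ℝ → ℝ, Continuous ψ →
      IntegrableOn (fun x => ψ x • u x) (Ioo 0 L) := by
    intro ψ hψ
    obtain ⟨C, hC⟩ := isCompact_Icc.exists_bound_of_continuousOn
      (hψ.continuousOn (s := Icc 0 L))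
    refine Integrable.bdd_smul hu C hψ.aestronglyMeasurable ?_
    filter_upwards [ae_restrict_mem measurableSet_Ioo] with x hx
    exact hC x (Ioo_subset_Icc_self hx)
  let B : ContDiffBump (L / 2) := ⟨L / 8, L / 4, by positivity, by linarith⟩
  let ψ₀ : ℝ → ℝ := B.normed volume
  have p1 : ContDiff ℝ ∞ ψ₀ := B.contDiff_normed
  have p2 : HasCompactSupport ψ₀ := B.hasCompactSupport_normed
  have p3 : tsupport ψ₀ ⊆ Ioo 0 L := by
    rw [B.tsupport_normed_eq, Real.closedBall_eq_Icc]
    intro x hx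
    have h1 : L / 2 - L / 4 ≤ x := hx.1
    have h2 : x ≤ L / 2 + L / 4 := hx.2
    exact ⟨by linarith, by linarith⟩
  have p4 : ∫ x, ψ₀ x = 1 := B.integral_normed
  let c : ℂ := ∫ x in Ioo 0 L, ψ₀ x • u x
  refine ⟨c, ?_⟩
  have key := isOpen_Ioo.ae_eq_zero_of_integral_contDiff_smul_eq_zero (μ := volume)
    (U := Ioo 0 L) (f := fun x => u x - c)
    (hu.sub (integrableOn_const (by simp))).locallyIntegrableOn ?_
  · have := (ae_restrict_iff' (μ := volume) measurableSet_Ioo).2 key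
    filter_upwards [this] with x hx
    exact sub_eq_zero.1 hx
  intro ψ q1 q2 q3
  let m : ℝ := ∫ x, ψ x
  let η : ℝ → ℝ := fun x => ψ x - m * ψ₀ x
  have r1 : ContDiff ℝ ∞ η := q1.sub (contDiff_const.mul p1)
  have r2 : ∫ x, η x = 0 := by
    have : ∫ x, η x = (∫ x, ψ x) - ∫ x, m * ψ₀ x :=
      integral_sub (q1.continuous.integrable_of_hasCompactSupport q2)
        ((p1.continuous.integrable_of_hasCompactSupport p2).const_mul m)
    rw [this, integral_const_mul, p4, mul_one, sub_self]
  obtain ⟨a, b, ha, hab, hb, hz⟩ : ∃ a b : ℝ, 0 < a ∧ a < b ∧ b < L ∧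
      ∀ x, x ∉ Ioo a b → η x = 0 := by
    let K : Set ℝ := tsupport ψ ∪ tsupport ψ₀ ∪ {L / 2}
    have hK : IsCompact K := (q2.isCompact.union p2.isCompact).union isCompact_singleton
    have hne : K.Nonempty := ⟨L / 2, Or.inr rfl⟩
    have hKs : K ⊆ Ioo 0 L := by
      rintro x ((hx | hx) | hx)
      · exact q3 hx
      · exact p3 hx
      · rw [mem_singleton_iff.1 hx]
        exact ⟨by linarith, by linarith⟩
    have i1 := hKs (hK.sInf_mem hne)
    have i2 := hKs (hK.sSup_mem hne)
    have i3 : sInf K ≤ L / 2 := csInf_le hK.bddBelow (Or.inr rfl)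
    have i4 : L / 2 ≤ sSup K := le_csSup hK.bddAbove (Or.inr rfl)
    refine ⟨sInf K / 2, (sSup K + L) / 2, by linarith [i1.1], by linarith [i1.1, i2.2],
      by linarith [i2.2], fun x hx => ?_⟩
    have hxK : x ∉ K := fun hxK => hx ⟨by linarith [csInf_le hK.bddBelow hxK, i1.1],
      by linarith [le_csSup hK.bddAbove hxK, i2.2]⟩
    have j1 : ψ x = 0 := image_eq_zero_of_notMem_tsupport fun h' => hxK (Or.inl (Or.inl h'))
    have j2 : ψ₀ x = 0 := image_eq_zero_of_notMem_tsupport fun h' => hxK (Or.inl (Or.inr h'))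
    simp [η, j1, j2]
  let φ : ℝ → ℝ := fun x => ∫ t in a..x, η t
  have s0 : ∀ x, HasDerivAt φ (η x) x := fun x =>
    intervalIntegral.integral_hasDerivAt_right (r1.continuous.intervalIntegrable _ _)
      (r1.continuous.stronglyMeasurableAtFilter _ _) r1.continuous.continuousAt
  have s1 : deriv φ = η := funext fun x => (s0 x).deriv
  have s2 : ContDiff ℝ ∞ φ :=
    contDiff_infty_iff_deriv.2 ⟨fun x => (s0 x).differentiableAt, by rw [s1]; exact r1⟩
  have s3 : ∀ x, x ∉ Icc a b → φ x = 0 := by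
    intro x hx
    by_cases hxa : x < a
    · have : ∀ t ∈ uIcc a x, η t = 0 := fun t ht => by
        rw [uIcc_of_ge hxa.le] at ht
        exact hz t fun ht' => absurd ht'.1 (not_lt.2 ht.2)
      change ∫ t in a..x, η t = 0
      rw [intervalIntegral.integral_congr this]
      simp
    · have hxb : b < x := by
        by_contra hxb
        exact hx ⟨not_lt.1 hxa, not_lt.1 hxb⟩
      change ∫ t in a..x, η t = 0
      rw [intervalIntegral.integral_eq_integral_of_support_subset, r2]
      intro t ht
      by_contra htn
      exact ht (hz t fun h' => htn ⟨h'.1, h'.2.le.trans hxb.le⟩)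
  have s4 : tsupport φ ⊆ Icc a b := closure_minimal (fun x hx => by
    by_contra hxn
    exact hx (s3 x hxn)) isClosed_Icc
  have s5 : HasCompactSupport φ := HasCompactSupport.of_support_subset_isCompact isCompact_Icc
    ((subset_tsupport φ).trans s4)
  have fin := h φ s2 s5 (s4.trans fun x hx => ⟨ha.trans_le hx.1, hx.2.trans_lt hb⟩)
  have ze : ∀ f : ℝ → ℂ, ∫ x, ψ x • f x = ∫ x in Ioo 0 L, ψ x • f x := fun f =>
    (setIntegral_eq_integral_of_forall_compl_eq_zero fun x hx => by
      rw [image_eq_zero_of_notMem_tsupport fun hx' => hx (q3 hx'), zero_smul]).symm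
  have m_eq : ∫ x in Ioo 0 L, ψ x • c = (m : ℂ) * c := by
    rw [← ze fun _ => c, integral_smul_const]
    simp [m]
  have fin' : ∫ x in Ioo 0 L, deriv φ x • u x
      = (∫ x in Ioo 0 L, ψ x • u x) - (m : ℂ) * c := by
    have e : ∀ x, deriv φ x • u x = ψ x • u x - (m : ℂ) * (ψ₀ x • u x) := by
      intro x
      rw [s1]
      simp only [η, Complex.real_smul]
      push_cast
      ring
    simp only [e]
    rw [integral_sub (bdd ψ q1.continuous) ((bdd ψ₀ p1.continuous).const_mul _),
      integral_const_mul]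
  rw [ze fun x => u x - c]
  simp only [smul_sub]
  have hψc : IntegrableOn (fun x => ψ x • c) (Ioo 0 L) :=
    ((q1.continuous.smul (continuous_const (y := c))).integrableOn_Icc
      (a := 0) (b := L)).mono_set Ioo_subset_Icc_self
  rw [integral_sub (bdd ψ q1.continuous) hψc, m_eq, ← fin', fin]

/-- Elements of `H¹(0, L)` are primitives of their weak derivatives. -/
theorem HasWeakDeriv.exists_ae_eq_primitive {L : ℝ} (hL : 0 < L) {v w : L2Beam L}
    (h : HasWeakDeriv L v w) :
    ∃ c : ℂ, IsContRep L v fun x => c + ∫ y in (0 : ℝ)..x, w y := by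
  have hw : IntegrableOn (w : ℝ → ℂ) (Ioo 0 L) := (Lp.memLp w).integrable (by norm_num)
  have hv : IntegrableOn (v : ℝ → ℂ) (Ioo 0 L) := (Lp.memLp v).integrable (by norm_num)
  have hc : ContinuousOn (fun x => ∫ y in (0 : ℝ)..x, w y) (Icc 0 L) := by
    rw [← uIcc_of_le hL.le]
    refine intervalIntegral.continuousOn_primitive_interval ?_
    rw [uIcc_of_le hL.le]
    exact (integrableOn_Icc_iff_integrableOn_Ioo).2 hw
  have hci : IntegrableOn (fun x => ∫ y in (0 : ℝ)..x, w y) (Ioo 0 L) :=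
    hc.integrableOn_Icc.mono_set Ioo_subset_Icc_self
  obtain ⟨c, hcc⟩ := ae_eq_const_of_integral_deriv_smul_eq_zero hL (hv.sub hci) (by
    intro φ h1 h2 h3
    have hd : Continuous (deriv φ) := h1.continuous_deriv (by simp)
    have i2 : IntegrableOn (fun x => deriv φ x • ∫ y in (0 : ℝ)..x, w y) (Ioo 0 L) :=
      (hd.continuousOn.smul hc).integrableOn_Icc.mono_set Ioo_subset_Icc_self
    simp only [Pi.sub_apply, smul_sub]
    rw [integral_sub (integrable_smul_of_continuous v hd) i2, h φ h1 h2 h3,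
      integral_deriv_smul_primitive w h1 h3, sub_self])
  refine ⟨c, continuousOn_const.add hc, ?_⟩
  filter_upwards [hcc] with x hx
  rw [← hx]
  simp

theorem exists_isContRep {L : ℝ} (hL : 0 < L) {v : L2Beam L} (hv : v ∈ H1 L) :
    ∃ g, IsContRep L v g :=
  let ⟨_, h⟩ := (weakDeriv_spec hv).exists_ae_eq_primitive hL
  ⟨_, h⟩

theorem pointValue_add {L : ℝ} (hL : 0 < L) {v w : L2Beam L} (hv : v ∈ H1 L) (hw : w ∈ H1 L)
    {x : ℝ} (hx : x ∈ Icc 0 L) :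
    pointValue L (v + w) x = pointValue L v x + pointValue L w x := by
  obtain ⟨g, hg⟩ := exists_isContRep hL hv
  obtain ⟨k, hk⟩ := exists_isContRep hL hw
  have : IsContRep L (v + w) (g + k) :=
    ⟨hg.1.add hk.1, (Lp.coeFn_add v w).trans (hg.2.add hk.2)⟩
  rw [this.pointValue_eq hL hx, hg.pointValue_eq hL hx, hk.pointValue_eq hL hx, Pi.add_apply]

theorem pointValue_smul {L : ℝ} (hL : 0 < L) {v : L2Beam L} (r : ℂ) (hv : v ∈ H1 L)
    {x : ℝ} (hx : x ∈ Icc 0 L) : pointValue L (r • v) x = r * pointValue L v x := by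
  obtain ⟨g, hg⟩ := exists_isContRep hL hv
  have : IsContRep L (r • v) (r • g) :=
    ⟨hg.1.const_smul r, (Lp.coeFn_smul r v).trans (hg.2.const_smul r)⟩
  rw [this.pointValue_eq hL hx, hg.pointValue_eq hL hx, Pi.smul_apply, smul_eq_mul]

theorem pointValue_zero {L : ℝ} (hL : 0 < L) {x : ℝ} (hx : x ∈ Icc 0 L) :
    pointValue L 0 x = 0 := by
  have : IsContRep L 0 0 := ⟨continuousOn_const, Lp.coeFn_zero ℂ 2 _⟩
  rw [this.pointValue_eq hL hx, Pi.zero_apply]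

theorem eq_zero_of_weakDeriv_eq_zero {L : ℝ} (hL : 0 < L) {v : L2Beam L} (hv : v ∈ H1 L)
    (h : weakDeriv L v = 0) (h0 : pointValue L v 0 = 0) : v = 0 := by
  obtain ⟨c, hc⟩ := (weakDeriv_spec hv).exists_ae_eq_primitive hL
  have hc0 := hc.pointValue_eq hL (left_mem_Icc.2 hL.le)
  rw [h0, intervalIntegral.integral_same, add_zero] at hc0
  refine Lp.ext ?_
  refine EventuallyEq.trans ?_ (Lp.coeFn_zero ℂ 2 _).symm
  filter_upwards [hc.2, ae_restrict_mem measurableSet_Ioo] with x hx hx'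
  rw [hx, ← hc0, zero_add, h, intervalIntegral.integral_of_le hx'.1.le, Pi.zero_apply]
  refine integral_eq_zero_of_ae ?_
  have hs : Ioc 0 x ⊆ Ioo 0 L := fun y hy => ⟨hy.1, hy.2.trans_lt hx'.2⟩
  exact ae_restrict_of_ae_restrict_of_subset hs
    (Lp.coeFn_zero ℂ 2 (volume.restrict (Ioo 0 L)))

/-! ### The parameters of the beam -/

/-- The physical constants of the thermo-piezoelectric beam: the length `L`, the mass density `ρ`,
the magnetic permeability `μ`, the elastic stiffness `α₁`, the impermeability `β`, the
piezoelectric coefficient `γ`, the thermal coupling `δ`, the specific heat `c`, the thermal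
conductivity `κ`, the feedback gains `l₁, l₂`, and the order `a` and the weight `η` of the
fractional derivative. -/
structure BeamParameters where
  L : ℝ
  ρ : ℝ
  μ : ℝ
  α₁ : ℝ
  β : ℝ
  γ : ℝ
  δ : ℝ
  c : ℝ
  κ : ℝ
  l₁ : ℝ
  l₂ : ℝ
  a : ℝ
  η : ℝ
  L_pos : 0 < L
  ρ_pos : 0 < ρ
  μ_pos : 0 < μ
  α₁_pos : 0 < α₁
  β_pos : 0 < β
  c_pos : 0 < c
  κ_pos : 0 < κ
  l₁_pos : 0 < l₁
  l₂_pos : 0 < l₂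
  a_pos : 0 < a
  a_lt_one : a < 1
  η_pos : 0 < η

namespace BeamParameters

/-- The stiffness `α = α₁ + γ² β`. -/
def α (p : BeamParameters) : ℝ := p.α₁ + p.γ ^ 2 * p.β

/-- The function `μ(ξ) = |ξ| ^ ((2 a - 1) / 2)`. -/
noncomputable def kernel (p : BeamParameters) (ξ : ℝ) : ℝ := |ξ| ^ ((2 * p.a - 1) / 2)

/-- The factor `sin (a π) / π`. -/
noncomputable def sineFactor (p : BeamParameters) : ℝ := Real.sin (p.a * Real.pi) / Real.pi

theorem sineFactor_pos (p : BeamParameters) : 0 < p.sineFactor :=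
  div_pos (Real.sin_pos_of_pos_of_lt_pi (mul_pos p.a_pos Real.pi_pos)
    (by nlinarith [Real.pi_pos, p.a_lt_one])) Real.pi_pos

theorem L_mem (p : BeamParameters) : p.L ∈ Icc 0 p.L := right_mem_Icc.2 p.L_pos.le

theorem zero_mem (p : BeamParameters) : (0 : ℝ) ∈ Icc 0 p.L := left_mem_Icc.2 p.L_pos.le

theorem measurable_kernel (p : BeamParameters) : Measurable p.kernel := by
  unfold kernel
  fun_prop

theorem memLp_kernel_div (p : BeamParameters) :
    MemLp (fun ξ => p.kernel ξ / (1 + |ξ|)) 2 volume := by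
  have hmeas : Measurable fun ξ => p.kernel ξ / (1 + |ξ|) := by
    have := p.measurable_kernel
    fun_prop
  rw [memLp_two_iff_integrable_sq hmeas.aestronglyMeasurable]
  set F : ℝ → ℝ := fun ξ => (p.kernel ξ / (1 + |ξ|)) ^ 2 with hF
  have hFm : Measurable F := hmeas.pow_const 2
  have hval : ∀ ξ : ℝ, 0 < ξ → F ξ = ξ ^ (2 * p.a - 1) / (1 + ξ) ^ 2 := by
    intro ξ hξ
    simp only [hF, kernel, abs_of_pos hξ, div_pow]
    rw [← Real.rpow_natCast (ξ ^ _) 2, ← Real.rpow_mul hξ.le]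
    congr 2
    push_cast
    ring
  have h1 : IntegrableOn F (Ioc 0 1) := by
    have hi : IntegrableOn (fun ξ : ℝ => ξ ^ (2 * p.a - 1)) (Ioc 0 1) :=
      (intervalIntegrable_iff_integrableOn_Ioc_of_le zero_le_one).1
        (intervalIntegral.intervalIntegrable_rpow' (by linarith [p.a_pos]))
    refine Integrable.mono' hi hFm.aestronglyMeasurable ?_
    filter_upwards [ae_restrict_mem measurableSet_Ioc] with ξ hξ
    rw [hval ξ hξ.1, Real.norm_of_nonneg (by have := hξ.1; positivity)]
    refine div_le_self (Real.rpow_nonneg hξ.1.le _) ?_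
    nlinarith [hξ.1]
  have h2 : IntegrableOn F (Ioi 1) := by
    have hi : IntegrableOn (fun ξ : ℝ => ξ ^ (2 * p.a - 3)) (Ioi 1) :=
      integrableOn_Ioi_rpow_of_lt (by linarith [p.a_lt_one]) one_pos
    refine Integrable.mono' hi hFm.aestronglyMeasurable ?_
    filter_upwards [ae_restrict_mem measurableSet_Ioi] with ξ hξ
    have h0 : 0 < ξ := one_pos.trans hξ
    rw [hval ξ h0, Real.norm_of_nonneg (by positivity),
      show (2 * p.a - 3 : ℝ) = (2 * p.a - 1) - (2 : ℕ) by push_cast; ring,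
      Real.rpow_sub_natCast h0.ne']
    gcongr
    linarith
  have h3 : IntegrableOn F (Ioi 0) := by
    rw [← Ioc_union_Ioi_eq_Ioi zero_le_one]
    exact h1.union h2
  have h4 : IntegrableOn F (Iio 0) := by
    have h3' : IntegrableOn F (Ioi (-0)) := by rwa [neg_zero]
    have := h3'.comp_neg_Iio
    simpa [hF, kernel] using this
  rw [← integrableOn_univ, ← Iic_union_Ioi (a := (0 : ℝ))]
  exact ((integrableOn_Iic_iff_integrableOn_Iio).2 h4).union h3

/-- The integral `∫ μ(ξ) φ(ξ) dξ` converges when `φ` and `|ξ| φ` are square integrable. -/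
theorem integrable_kernel_mul (p : BeamParameters) (φ : L2Line)
    (h : MemLp (fun ξ => ((|ξ| : ℝ) : ℂ) * φ ξ) 2 volume) :
    Integrable (fun ξ => (p.kernel ξ : ℂ) * φ ξ) volume := by
  have h1 := (Lp.memLp φ).add h
  have h2 : MemLp (fun ξ => ((p.kernel ξ / (1 + |ξ|) : ℝ) : ℂ)) 2 volume :=
    p.memLp_kernel_div.ofReal
  refine (h2.integrable_mul h1).congr (Eventually.of_forall fun ξ => ?_)
  have h0 : (1 + ((|ξ| : ℝ) : ℂ)) ≠ 0 := by
    have : (0 : ℝ) < 1 + |ξ| := by positivity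
    exact_mod_cast this.ne'
  simp only [Pi.mul_apply, Pi.add_apply]
  push_cast
  field_simp

/-- The boundary term `sin (a π) / π * ∫ μ(ξ) φ(ξ) dξ`. -/
noncomputable def output (p : BeamParameters) (φ : L2Line) : ℂ :=
  p.sineFactor * ∫ ξ, (p.kernel ξ : ℂ) * φ ξ

/-- The function `ξ ↦ -(ξ² + η) φ(ξ) + z μ(ξ)`. -/
noncomputable def diffusive (p : BeamParameters) (φ : L2Line) (z : ℂ) (ξ : ℝ) : ℂ :=
  -((ξ : ℂ) ^ 2 + p.η) * φ ξ + z * p.kernel ξ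

end BeamParameters

/-! ### The phase space -/

/-- The space `H¹_*(0, L)` of all `v ∈ H¹(0, L)` with `v(0) = 0`. -/
noncomputable def H1star (p : BeamParameters) : Submodule ℂ (L2Beam p.L) where
  carrier := {v | v ∈ H1 p.L ∧ pointValue p.L v 0 = 0}
  zero_mem' := ⟨zero_mem _, pointValue_zero p.L_pos p.zero_mem⟩
  add_mem' := fun ⟨h1, h2⟩ ⟨h3, h4⟩ =>
    ⟨add_mem h1 h3, by rw [pointValue_add p.L_pos h1 h3 p.zero_mem, h2, h4, add_zero]⟩
  smul_mem' := fun r _ ⟨h1, h2⟩ =>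
    ⟨Submodule.smul_mem _ r h1, by rw [pointValue_smul p.L_pos r h1 p.zero_mem, h2, mul_zero]⟩

/-- The phase space, whose elements are the tuples `(V, f, φ₁, P, g, φ₂, θ)` in
`H¹_*(0, L) × L²(0, L) × L²(ℝ) × H¹_*(0, L) × L²(0, L) × L²(ℝ) × L²(0, L)`. -/
@[ext]
structure PhaseSpace (p : BeamParameters) where
  V : L2Beam p.L
  f : L2Beam p.L
  φ₁ : L2Line
  P : L2Beam p.L
  g : L2Beam p.L
  φ₂ : L2Line
  θ : L2Beam p.L
  V_star : V ∈ H1star p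
  P_star : P ∈ H1star p

namespace PhaseSpace

variable {p : BeamParameters}

noncomputable instance : Zero (PhaseSpace p) :=
  ⟨⟨0, 0, 0, 0, 0, 0, 0, zero_mem _, zero_mem _⟩⟩

noncomputable instance : Add (PhaseSpace p) :=
  ⟨fun U W => ⟨U.V + W.V, U.f + W.f, U.φ₁ + W.φ₁, U.P + W.P, U.g + W.g, U.φ₂ + W.φ₂, U.θ + W.θ,
    add_mem U.V_star W.V_star, add_mem U.P_star W.P_star⟩⟩

noncomputable instance : SMul ℂ (PhaseSpace p) :=
  ⟨fun r U => ⟨r • U.V, r • U.f, r • U.φ₁, r • U.P, r • U.g, r • U.φ₂, r • U.θ,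
    Submodule.smul_mem _ r U.V_star, Submodule.smul_mem _ r U.P_star⟩⟩

noncomputable instance : Neg (PhaseSpace p) := ⟨fun U => (-1 : ℂ) • U⟩

theorem V_zero : (0 : PhaseSpace p).V = 0 := rfl
theorem f_zero : (0 : PhaseSpace p).f = 0 := rfl
theorem φ₁_zero : (0 : PhaseSpace p).φ₁ = 0 := rfl
theorem P_zero : (0 : PhaseSpace p).P = 0 := rfl
theorem g_zero : (0 : PhaseSpace p).g = 0 := rfl
theorem φ₂_zero : (0 : PhaseSpace p).φ₂ = 0 := rfl
theorem θ_zero : (0 : PhaseSpace p).θ = 0 := rfl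
theorem V_add (U W : PhaseSpace p) : (U + W).V = U.V + W.V := rfl
theorem f_add (U W : PhaseSpace p) : (U + W).f = U.f + W.f := rfl
theorem φ₁_add (U W : PhaseSpace p) : (U + W).φ₁ = U.φ₁ + W.φ₁ := rfl
theorem P_add (U W : PhaseSpace p) : (U + W).P = U.P + W.P := rfl
theorem g_add (U W : PhaseSpace p) : (U + W).g = U.g + W.g := rfl
theorem φ₂_add (U W : PhaseSpace p) : (U + W).φ₂ = U.φ₂ + W.φ₂ := rfl
theorem θ_add (U W : PhaseSpace p) : (U + W).θ = U.θ + W.θ := rfl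
theorem V_smul (r : ℂ) (U : PhaseSpace p) : (r • U).V = r • U.V := rfl
theorem f_smul (r : ℂ) (U : PhaseSpace p) : (r • U).f = r • U.f := rfl
theorem φ₁_smul (r : ℂ) (U : PhaseSpace p) : (r • U).φ₁ = r • U.φ₁ := rfl
theorem P_smul (r : ℂ) (U : PhaseSpace p) : (r • U).P = r • U.P := rfl
theorem g_smul (r : ℂ) (U : PhaseSpace p) : (r • U).g = r • U.g := rfl
theorem φ₂_smul (r : ℂ) (U : PhaseSpace p) : (r • U).φ₂ = r • U.φ₂ := rfl
theorem θ_smul (r : ℂ) (U : PhaseSpace p) : (r • U).θ = r • U.θ := rfl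

theorem V_mem (U : PhaseSpace p) : U.V ∈ H1 p.L := U.V_star.1
theorem P_mem (U : PhaseSpace p) : U.P ∈ H1 p.L := U.P_star.1

noncomputable instance : AddCommGroup (PhaseSpace p) where
  add_assoc _ _ _ := PhaseSpace.ext (add_assoc _ _ _) (add_assoc _ _ _) (add_assoc _ _ _)
    (add_assoc _ _ _) (add_assoc _ _ _) (add_assoc _ _ _) (add_assoc _ _ _)
  zero_add _ := PhaseSpace.ext (zero_add _) (zero_add _) (zero_add _) (zero_add _) (zero_add _)
    (zero_add _) (zero_add _)
  add_zero _ := PhaseSpace.ext (add_zero _) (add_zero _) (add_zero _) (add_zero _) (add_zero _)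
    (add_zero _) (add_zero _)
  add_comm _ _ := PhaseSpace.ext (add_comm _ _) (add_comm _ _) (add_comm _ _) (add_comm _ _)
    (add_comm _ _) (add_comm _ _) (add_comm _ _)
  neg_add_cancel _ := by
    have h : ∀ {E : Type} [AddCommGroup E] [Module ℂ E] (x : E), (-1 : ℂ) • x + x = 0 := by
      intro E _ _ x
      rw [neg_one_smul, neg_add_cancel]
    exact PhaseSpace.ext (h _) (h _) (h _) (h _) (h _) (h _) (h _)
  nsmul := nsmulRec
  zsmul := zsmulRec

noncomputable instance : Module ℂ (PhaseSpace p) where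
  one_smul _ := PhaseSpace.ext (one_smul _ _) (one_smul _ _) (one_smul _ _) (one_smul _ _)
    (one_smul _ _) (one_smul _ _) (one_smul _ _)
  mul_smul _ _ _ := PhaseSpace.ext (mul_smul _ _ _) (mul_smul _ _ _) (mul_smul _ _ _)
    (mul_smul _ _ _) (mul_smul _ _ _) (mul_smul _ _ _) (mul_smul _ _ _)
  smul_zero _ := PhaseSpace.ext (smul_zero _) (smul_zero _) (smul_zero _) (smul_zero _)
    (smul_zero _) (smul_zero _) (smul_zero _)
  smul_add _ _ _ := PhaseSpace.ext (smul_add _ _ _) (smul_add _ _ _) (smul_add _ _ _)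
    (smul_add _ _ _) (smul_add _ _ _) (smul_add _ _ _) (smul_add _ _ _)
  add_smul _ _ _ := PhaseSpace.ext (add_smul _ _ _) (add_smul _ _ _) (add_smul _ _ _)
    (add_smul _ _ _) (add_smul _ _ _) (add_smul _ _ _) (add_smul _ _ _)
  zero_smul _ := PhaseSpace.ext (zero_smul _ _) (zero_smul _ _) (zero_smul _ _) (zero_smul _ _)
    (zero_smul _ _) (zero_smul _ _) (zero_smul _ _)

/-- The energy inner product, linear in the first and conjugate linear in the second argument
(recall that `inner ℂ u v` on `L²` is `∫ conj u * v`). -/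
noncomputable def energyInner (U₁ U₂ : PhaseSpace p) : ℂ :=
  p.ρ * inner ℂ U₂.f U₁.f + p.μ * inner ℂ U₂.g U₁.g
    + p.α₁ * inner ℂ (weakDeriv p.L U₂.V) (weakDeriv p.L U₁.V)
    + p.β * inner ℂ ((p.γ : ℂ) • weakDeriv p.L U₂.V - weakDeriv p.L U₂.P)
        ((p.γ : ℂ) • weakDeriv p.L U₁.V - weakDeriv p.L U₁.P)
    + p.c * inner ℂ U₂.θ U₁.θ
    + p.sineFactor * (p.l₁ * inner ℂ U₂.φ₁ U₁.φ₁ + p.l₂ * inner ℂ U₂.φ₂ U₁.φ₂)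

theorem energyInner_self (U : PhaseSpace p) : energyInner U U =
    ((p.ρ * ‖U.f‖ ^ 2 + p.μ * ‖U.g‖ ^ 2 + p.α₁ * ‖weakDeriv p.L U.V‖ ^ 2
      + p.β * ‖(p.γ : ℂ) • weakDeriv p.L U.V - weakDeriv p.L U.P‖ ^ 2 + p.c * ‖U.θ‖ ^ 2
      + p.sineFactor * (p.l₁ * ‖U.φ₁‖ ^ 2 + p.l₂ * ‖U.φ₂‖ ^ 2) : ℝ) : ℂ) := by
  simp only [energyInner, inner_self_eq_norm_sq_to_K]
  push_cast
  rfl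

/-- `energyInner` is an inner product; Mathlib's inner products are conjugate linear in the first
argument, whence the exchange of the arguments. -/
@[reducible]
noncomputable def innerCore (p : BeamParameters) : InnerProductSpace.Core ℂ (PhaseSpace p) where
  inner U W := energyInner W U
  conj_inner_symm U W := by
    simp only [energyInner, map_add, map_mul, inner_conj_symm, Complex.conj_ofReal]
  re_inner_nonneg U := by
    have := p.ρ_pos
    have := p.μ_pos
    have := p.α₁_pos
    have := p.β_pos
    have := p.c_pos
    have := p.l₁_pos
    have := p.l₂_pos
    have := p.sineFactor_pos
    rw [energyInner_self]
    simp only [RCLike.re_to_complex, Complex.ofReal_re]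
    positivity
  add_left U W Z := by
    have h : (p.γ : ℂ) • (weakDeriv p.L U.V + weakDeriv p.L W.V)
        - (weakDeriv p.L U.P + weakDeriv p.L W.P)
        = ((p.γ : ℂ) • weakDeriv p.L U.V - weakDeriv p.L U.P)
          + ((p.γ : ℂ) • weakDeriv p.L W.V - weakDeriv p.L W.P) := by module
    simp only [energyInner, V_add, f_add, φ₁_add, P_add, g_add, φ₂_add, θ_add,
      weakDeriv_add U.V_mem W.V_mem, weakDeriv_add U.P_mem W.P_mem, h, inner_add_left]
    ring
  smul_left U W r := by
    have h : (p.γ : ℂ) • (r • weakDeriv p.L U.V) - r • weakDeriv p.L U.P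
        = r • ((p.γ : ℂ) • weakDeriv p.L U.V - weakDeriv p.L U.P) := by module
    simp only [energyInner, V_smul, f_smul, φ₁_smul, P_smul, g_smul, φ₂_smul, θ_smul,
      weakDeriv_smul r U.V_mem, weakDeriv_smul r U.P_mem, h, inner_smul_left]
    ring
  definite U h := by
    have h1 := p.ρ_pos
    have h2 := p.μ_pos
    have h3 := p.α₁_pos
    have h4 := p.β_pos
    have h5 := p.c_pos
    have h6 := mul_pos p.sineFactor_pos p.l₁_pos
    have h7 := mul_pos p.sineFactor_pos p.l₂_pos
    rw [energyInner_self, Complex.ofReal_eq_zero, mul_add, ← mul_assoc, ← mul_assoc] at h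
    have n1 : 0 ≤ p.ρ * ‖U.f‖ ^ 2 := by positivity
    have n2 : 0 ≤ p.μ * ‖U.g‖ ^ 2 := by positivity
    have n3 : 0 ≤ p.α₁ * ‖weakDeriv p.L U.V‖ ^ 2 := by positivity
    have n4 : 0 ≤ p.β * ‖(p.γ : ℂ) • weakDeriv p.L U.V - weakDeriv p.L U.P‖ ^ 2 := by positivity
    have n5 : 0 ≤ p.c * ‖U.θ‖ ^ 2 := by positivity
    have n6 : 0 ≤ p.sineFactor * p.l₁ * ‖U.φ₁‖ ^ 2 := by positivity
    have n7 : 0 ≤ p.sineFactor * p.l₂ * ‖U.φ₂‖ ^ 2 := by positivity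
    have key : ∀ {E : Type} [NormedAddCommGroup E] {x : E} {r : ℝ}, 0 < r →
        r * ‖x‖ ^ 2 = 0 → x = 0 := by
      intro E _ x r hr hx
      simpa [hr.ne'] using hx
    have z3 : weakDeriv p.L U.V = 0 := key h3 (by linarith)
    have z4 : (p.γ : ℂ) • weakDeriv p.L U.V - weakDeriv p.L U.P = 0 := key h4 (by linarith)
    rw [z3, smul_zero, zero_sub, neg_eq_zero] at z4
    exact PhaseSpace.ext (eq_zero_of_weakDeriv_eq_zero p.L_pos U.V_mem z3 U.V_star.2)
      (key h1 (by linarith)) (key h6 (by linarith))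
      (eq_zero_of_weakDeriv_eq_zero p.L_pos U.P_mem z4 U.P_star.2)
      (key h2 (by linarith)) (key h7 (by linarith)) (key h5 (by linarith))

noncomputable instance : NormedAddCommGroup (PhaseSpace p) :=
  (innerCore p).toNormedAddCommGroup

noncomputable instance : InnerProductSpace ℂ (PhaseSpace p) :=
  InnerProductSpace.ofCore (innerCore p).toCore

end PhaseSpace

/-! ### The operator -/

open PhaseSpace BeamParameters

/-- Membership in the domain of the operator. -/
structure InDomain {p : BeamParameters} (U : PhaseSpace p) : Prop where
  V_mem : U.V ∈ H2 p.L
  P_mem : U.P ∈ H2 p.L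
  f_mem : U.f ∈ H1star p
  g_mem : U.g ∈ H1star p
  θ_mem : U.θ ∈ H2 p.L
  θ_deriv_left : pointValue p.L (weakDeriv p.L U.θ) 0 = 0
  θ_right : pointValue p.L U.θ p.L = 0
  φ₁_weight : MemLp (fun ξ => ((|ξ| : ℝ) : ℂ) * U.φ₁ ξ) 2 volume
  φ₂_weight : MemLp (fun ξ => ((|ξ| : ℝ) : ℂ) * U.φ₂ ξ) 2 volume
  φ₁_mem : MemLp (p.diffusive U.φ₁ (pointValue p.L U.f p.L)) 2 volume
  φ₂_mem : MemLp (p.diffusive U.φ₂ (pointValue p.L U.g p.L)) 2 volume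
  V_boundary : p.α * pointValue p.L (weakDeriv p.L U.V) p.L
    - p.γ * p.β * pointValue p.L (weakDeriv p.L U.P) p.L = - p.l₁ * p.output U.φ₁
  P_boundary : p.β * pointValue p.L (weakDeriv p.L U.P) p.L
    - p.γ * p.β * pointValue p.L (weakDeriv p.L U.V) p.L = - p.l₂ * p.output U.φ₂

section Auxiliary

variable {p : BeamParameters}

theorem weight_add (φ ψ : L2Line) : (fun ξ : ℝ => ((|ξ| : ℝ) : ℂ) * (φ + ψ : L2Line) ξ)
    =ᵐ[volume] fun ξ => ((|ξ| : ℝ) : ℂ) * φ ξ + ((|ξ| : ℝ) : ℂ) * ψ ξ := by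
  filter_upwards [Lp.coeFn_add φ ψ] with ξ h
  rw [h, Pi.add_apply, mul_add]

theorem weight_smul (r : ℂ) (φ : L2Line) : (fun ξ : ℝ => ((|ξ| : ℝ) : ℂ) * (r • φ : L2Line) ξ)
    =ᵐ[volume] fun ξ => r * (((|ξ| : ℝ) : ℂ) * φ ξ) := by
  filter_upwards [Lp.coeFn_smul r φ] with ξ h
  rw [h, Pi.smul_apply, smul_eq_mul]
  ring

theorem diffusive_add (φ ψ : L2Line) (z w : ℂ) : p.diffusive (φ + ψ) (z + w)
    =ᵐ[volume] p.diffusive φ z + p.diffusive ψ w := by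
  filter_upwards [Lp.coeFn_add φ ψ] with ξ h
  simp only [diffusive, h, Pi.add_apply]
  ring

theorem diffusive_smul (r : ℂ) (φ : L2Line) (z : ℂ) : p.diffusive (r • φ) (r * z)
    =ᵐ[volume] r • p.diffusive φ z := by
  filter_upwards [Lp.coeFn_smul r φ] with ξ h
  simp only [diffusive, h, Pi.smul_apply, smul_eq_mul]
  ring

theorem output_add {φ ψ : L2Line} (hφ : MemLp (fun ξ => ((|ξ| : ℝ) : ℂ) * φ ξ) 2 volume)
    (hψ : MemLp (fun ξ => ((|ξ| : ℝ) : ℂ) * ψ ξ) 2 volume) :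
    p.output (φ + ψ) = p.output φ + p.output ψ := by
  rw [output, output, output, ← mul_add, ← integral_add (p.integrable_kernel_mul φ hφ)
    (p.integrable_kernel_mul ψ hψ)]
  congr 1
  refine integral_congr_ae ?_
  filter_upwards [Lp.coeFn_add φ ψ] with ξ h
  rw [h, Pi.add_apply, mul_add]

theorem output_smul (p : BeamParameters) (r : ℂ) (φ : L2Line) :
    p.output (r • φ) = r * p.output φ := by
  rw [output, output, mul_left_comm, ← integral_const_mul (r := r)]
  congr 1
  refine integral_congr_ae ?_
  filter_upwards [Lp.coeFn_smul r φ] with ξ h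
  rw [h, Pi.smul_apply, smul_eq_mul]
  ring

theorem InDomain.add {U W : PhaseSpace p} (hU : InDomain U) (hW : InDomain W) :
    InDomain (U + W) := by
  have dV : weakDeriv p.L (U + W).V = weakDeriv p.L U.V + weakDeriv p.L W.V :=
       weakDeriv_add hU.V_mem.1 hW.V_mem.1
  have dP : weakDeriv p.L (U + W).P = weakDeriv p.L U.P + weakDeriv p.L W.P :=
       weakDeriv_add hU.P_mem.1 hW.P_mem.1
  have dθ : weakDeriv p.L (U + W).θ = weakDeriv p.L U.θ + weakDeriv p.L W.θ :=
       weakDeriv_add hU.θ_mem.1 hW.θ_mem.1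
  have fL : pointValue p.L (U + W).f p.L = _ :=
    pointValue_add p.L_pos hU.f_mem.1 hW.f_mem.1 p.L_mem
  have gL : pointValue p.L (U + W).g p.L = _ :=
    pointValue_add p.L_pos hU.g_mem.1 hW.g_mem.1 p.L_mem
  refine ⟨add_mem hU.V_mem hW.V_mem, add_mem hU.P_mem hW.P_mem, add_mem hU.f_mem hW.f_mem,
    add_mem hU.g_mem hW.g_mem, add_mem hU.θ_mem hW.θ_mem, ?_, ?_, ?_, ?_, ?_, ?_, ?_, ?_⟩
  · rw [dθ, pointValue_add p.L_pos hU.θ_mem.2 hW.θ_mem.2 p.zero_mem, hU.θ_deriv_left,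
      hW.θ_deriv_left, add_zero]
  · rw [θ_add, pointValue_add p.L_pos hU.θ_mem.1 hW.θ_mem.1 p.L_mem, hU.θ_right, hW.θ_right,
      add_zero]
  · exact (hU.φ₁_weight.add hW.φ₁_weight).ae_eq (weight_add _ _).symm
  · exact (hU.φ₂_weight.add hW.φ₂_weight).ae_eq (weight_add _ _).symm
  · rw [fL]
    exact (hU.φ₁_mem.add hW.φ₁_mem).ae_eq (diffusive_add _ _ _ _).symm
  · rw [gL]
    exact (hU.φ₂_mem.add hW.φ₂_mem).ae_eq (diffusive_add _ _ _ _).symm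
  · rw [dV, dP, pointValue_add p.L_pos hU.V_mem.2 hW.V_mem.2 p.L_mem,
      pointValue_add p.L_pos hU.P_mem.2 hW.P_mem.2 p.L_mem, φ₁_add,
      output_add hU.φ₁_weight hW.φ₁_weight]
    linear_combination hU.V_boundary + hW.V_boundary
  · rw [dV, dP, pointValue_add p.L_pos hU.V_mem.2 hW.V_mem.2 p.L_mem,
      pointValue_add p.L_pos hU.P_mem.2 hW.P_mem.2 p.L_mem, φ₂_add,
      output_add hU.φ₂_weight hW.φ₂_weight]
    linear_combination hU.P_boundary + hW.P_boundary

theorem InDomain.smul (r : ℂ) {U : PhaseSpace p} (hU : InDomain U) : InDomain (r • U) := by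
  have dV : weakDeriv p.L (r • U).V = r • weakDeriv p.L U.V := weakDeriv_smul r hU.V_mem.1
  have dP : weakDeriv p.L (r • U).P = r • weakDeriv p.L U.P := weakDeriv_smul r hU.P_mem.1
  have dθ : weakDeriv p.L (r • U).θ = r • weakDeriv p.L U.θ := weakDeriv_smul r hU.θ_mem.1
  have fL : pointValue p.L (r • U).f p.L = _ := pointValue_smul p.L_pos r hU.f_mem.1 p.L_mem
  have gL : pointValue p.L (r • U).g p.L = _ := pointValue_smul p.L_pos r hU.g_mem.1 p.L_mem
  refine ⟨Submodule.smul_mem _ r hU.V_mem, Submodule.smul_mem _ r hU.P_mem,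
    Submodule.smul_mem _ r hU.f_mem, Submodule.smul_mem _ r hU.g_mem,
    Submodule.smul_mem _ r hU.θ_mem, ?_, ?_, ?_, ?_, ?_, ?_, ?_, ?_⟩
  · rw [dθ, pointValue_smul p.L_pos r hU.θ_mem.2 p.zero_mem, hU.θ_deriv_left, mul_zero]
  · rw [θ_smul, pointValue_smul p.L_pos r hU.θ_mem.1 p.L_mem, hU.θ_right, mul_zero]
  · exact (hU.φ₁_weight.const_mul r).ae_eq (weight_smul _ _).symm
  · exact (hU.φ₂_weight.const_mul r).ae_eq (weight_smul _ _).symm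
  · rw [fL]
    exact (hU.φ₁_mem.const_smul r).ae_eq (diffusive_smul _ _ _).symm
  · rw [gL]
    exact (hU.φ₂_mem.const_smul r).ae_eq (diffusive_smul _ _ _).symm
  · rw [dV, dP, pointValue_smul p.L_pos r hU.V_mem.2 p.L_mem,
      pointValue_smul p.L_pos r hU.P_mem.2 p.L_mem, φ₁_smul, output_smul]
    linear_combination r * hU.V_boundary
  · rw [dV, dP, pointValue_smul p.L_pos r hU.V_mem.2 p.L_mem,
      pointValue_smul p.L_pos r hU.P_mem.2 p.L_mem, φ₂_smul, output_smul]
    linear_combination r * hU.P_boundary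

theorem InDomain.zero : InDomain (0 : PhaseSpace p) := by
  have h0 : p.diffusive 0 0 =ᵐ[volume] 0 := by
    filter_upwards [Lp.coeFn_zero ℂ 2 (volume : Measure ℝ)] with ξ h
    simp only [diffusive, h, Pi.zero_apply, mul_zero, zero_mul, add_zero]
  have h1 : (fun ξ : ℝ => ((|ξ| : ℝ) : ℂ) * (0 : L2Line) ξ) =ᵐ[volume] 0 := by
    filter_upwards [Lp.coeFn_zero ℂ 2 (volume : Measure ℝ)] with ξ h
    simp only [h, Pi.zero_apply, mul_zero]
  have h2 : p.output 0 = 0 := by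
    have := output_smul p 0 0
    simpa using this
  have pL := pointValue_zero p.L_pos p.L_mem
  have p0 := pointValue_zero p.L_pos p.zero_mem
  refine ⟨zero_mem _, zero_mem _, zero_mem _, zero_mem _, zero_mem _, ?_, pL, ?_, ?_, ?_, ?_,
    ?_, ?_⟩
  · change pointValue p.L (weakDeriv p.L 0) 0 = 0
    rw [weakDeriv_zero, p0]
  · exact MemLp.zero.ae_eq h1.symm
  · exact MemLp.zero.ae_eq h1.symm
  · change MemLp (p.diffusive 0 (pointValue p.L 0 p.L)) 2 volume
    rw [pL]
    exact MemLp.zero.ae_eq h0.symm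
  · change MemLp (p.diffusive 0 (pointValue p.L 0 p.L)) 2 volume
    rw [pL]
    exact MemLp.zero.ae_eq h0.symm
  · change p.α * pointValue p.L (weakDeriv p.L 0) p.L
      - p.γ * p.β * pointValue p.L (weakDeriv p.L 0) p.L = - p.l₁ * p.output 0
    simp [weakDeriv_zero, pL, h2]
  · change p.β * pointValue p.L (weakDeriv p.L 0) p.L
      - p.γ * p.β * pointValue p.L (weakDeriv p.L 0) p.L = - p.l₂ * p.output 0
    simp [weakDeriv_zero, pL, h2]

end Auxiliary

/-- The domain of the operator. -/
def domainA₁ (p : BeamParameters) : Submodule ℂ (PhaseSpace p) where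
  carrier := {U | InDomain U}
  zero_mem' := InDomain.zero
  add_mem' := InDomain.add
  smul_mem' := fun r _ h => h.smul r

/-- The value of the operator at an element of its domain. -/
noncomputable def applyA₁ {p : BeamParameters} (U : PhaseSpace p) (hU : InDomain U) :
    PhaseSpace p where
  V := U.f
  f := ((p.α / p.ρ : ℝ) : ℂ) • weakDeriv p.L (weakDeriv p.L U.V)
    - ((p.γ * p.β / p.ρ : ℝ) : ℂ) • weakDeriv p.L (weakDeriv p.L U.P)
    - ((p.δ / p.ρ : ℝ) : ℂ) • weakDeriv p.L U.θ
  φ₁ := hU.φ₁_mem.toLp (p.diffusive U.φ₁ (pointValue p.L U.f p.L))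
  P := U.g
  g := -((p.γ * p.β / p.μ : ℝ) : ℂ) • weakDeriv p.L (weakDeriv p.L U.V)
    + ((p.β / p.μ : ℝ) : ℂ) • weakDeriv p.L (weakDeriv p.L U.P)
  φ₂ := hU.φ₂_mem.toLp (p.diffusive U.φ₂ (pointValue p.L U.g p.L))
  θ := ((p.κ / p.c : ℝ) : ℂ) • weakDeriv p.L (weakDeriv p.L U.θ)
    - ((p.δ / p.c : ℝ) : ℂ) • weakDeriv p.L U.f
  V_star := hU.f_mem
  P_star := hU.g_mem

section Auxiliary

variable {p : BeamParameters}

theorem toLp_diffusive_add {φ ψ χ : L2Line} {z w x : ℂ} (hχ : χ = φ + ψ) (hx : x = z + w)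
    (h : MemLp (p.diffusive χ x) 2 volume)
    (h1 : MemLp (p.diffusive φ z) 2 volume) (h2 : MemLp (p.diffusive ψ w) 2 volume) :
    h.toLp _ = h1.toLp _ + h2.toLp _ := by
  subst hχ hx
  rw [← MemLp.toLp_add]
  exact MemLp.toLp_congr _ _ (diffusive_add _ _ _ _)

theorem toLp_diffusive_smul {r : ℂ} {φ χ : L2Line} {z x : ℂ} (hχ : χ = r • φ) (hx : x = r * z)
    (h : MemLp (p.diffusive χ x) 2 volume) (h1 : MemLp (p.diffusive φ z) 2 volume) :
    h.toLp _ = r • h1.toLp _ := by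
  subst hχ hx
  rw [← MemLp.toLp_const_smul]
  exact MemLp.toLp_congr _ _ (diffusive_smul _ _ _)

theorem applyA₁_add {U W : PhaseSpace p} (hU : InDomain U) (hW : InDomain W)
    (h : InDomain (U + W)) : applyA₁ (U + W) h = applyA₁ U hU + applyA₁ W hW := by
  refine PhaseSpace.ext rfl ?_ ?_ rfl ?_ ?_ ?_
  · simp only [applyA₁, V_add, P_add, θ_add, f_add, weakDeriv_add hU.V_mem.1 hW.V_mem.1,
      weakDeriv_add hU.P_mem.1 hW.P_mem.1, weakDeriv_add hU.θ_mem.1 hW.θ_mem.1,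
      weakDeriv_add hU.V_mem.2 hW.V_mem.2, weakDeriv_add hU.P_mem.2 hW.P_mem.2]
    module
  · exact toLp_diffusive_add rfl (pointValue_add p.L_pos hU.f_mem.1 hW.f_mem.1 p.L_mem) h.φ₁_mem
      hU.φ₁_mem hW.φ₁_mem
  · simp only [applyA₁, V_add, P_add, g_add, weakDeriv_add hU.V_mem.1 hW.V_mem.1,
      weakDeriv_add hU.P_mem.1 hW.P_mem.1,
      weakDeriv_add hU.V_mem.2 hW.V_mem.2, weakDeriv_add hU.P_mem.2 hW.P_mem.2]
    module
  · exact toLp_diffusive_add rfl (pointValue_add p.L_pos hU.g_mem.1 hW.g_mem.1 p.L_mem) h.φ₂_mem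
      hU.φ₂_mem hW.φ₂_mem
  · simp only [applyA₁, θ_add, f_add, weakDeriv_add hU.θ_mem.1 hW.θ_mem.1,
      weakDeriv_add hU.θ_mem.2 hW.θ_mem.2, weakDeriv_add hU.f_mem.1 hW.f_mem.1]
    module

theorem applyA₁_smul (r : ℂ) {U : PhaseSpace p} (hU : InDomain U) (h : InDomain (r • U)) :
    applyA₁ (r • U) h = r • applyA₁ U hU := by
  refine PhaseSpace.ext rfl ?_ ?_ rfl ?_ ?_ ?_
  · simp only [applyA₁, V_smul, P_smul, θ_smul, f_smul, weakDeriv_smul r hU.V_mem.1,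
      weakDeriv_smul r hU.P_mem.1, weakDeriv_smul r hU.θ_mem.1, weakDeriv_smul r hU.V_mem.2,
      weakDeriv_smul r hU.P_mem.2]
    module
  · exact toLp_diffusive_smul rfl (pointValue_smul p.L_pos r hU.f_mem.1 p.L_mem) h.φ₁_mem
      hU.φ₁_mem
  · simp only [applyA₁, V_smul, P_smul, g_smul, weakDeriv_smul r hU.V_mem.1,
      weakDeriv_smul r hU.P_mem.1, weakDeriv_smul r hU.V_mem.2, weakDeriv_smul r hU.P_mem.2]
    module
  · exact toLp_diffusive_smul rfl (pointValue_smul p.L_pos r hU.g_mem.1 p.L_mem) h.φ₂_mem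
      hU.φ₂_mem
  · simp only [applyA₁, θ_smul, f_smul, weakDeriv_smul r hU.θ_mem.1,
      weakDeriv_smul r hU.θ_mem.2, weakDeriv_smul r hU.f_mem.1]
    module

end Auxiliary

/-- The operator of the thermo-piezoelectric beam, as an unbounded operator. -/
noncomputable def A₁ (p : BeamParameters) : PhaseSpace p →ₗ.[ℂ] PhaseSpace p where
  domain := domainA₁ p
  toFun :=
    { toFun := fun U => applyA₁ U.1 U.2
      map_add' := fun U W => applyA₁_add U.2 W.2 (U + W).2
      map_smul' := fun r U => applyA₁_smul r U.2 (r • U).2 }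

/-! ### Semigroups and solutions of the Cauchy problem -/

section Semigroup

variable {H : Type*} [NormedAddCommGroup H] [InnerProductSpace ℂ H]

/-- `S` (restricted to `[0, ∞)`) is a strongly continuous semigroup of contractions. -/
structure IsContractionSemigroup (S : ℝ → H →L[ℂ] H) : Prop where
  zero : S 0 = ContinuousLinearMap.id ℂ H
  add : ∀ s t : ℝ, 0 ≤ s → 0 ≤ t → S (s + t) = (S s).comp (S t)
  continuousOn : ∀ x : H, ContinuousOn (fun t => S t x) (Ici 0)
  norm_le_one : ∀ t : ℝ, 0 ≤ t → ‖S t‖ ≤ 1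

/-- The unbounded operator `A` is the infinitesimal generator of `S`: the domain of `A` consists
of all `x` for which `(S h x - x) / h` converges as `h ↓ 0`, and `A x` is the limit. -/
def IsGenerator (A : H →ₗ.[ℂ] H) (S : ℝ → H →L[ℂ] H) : Prop :=
  ∀ x y : H, (∃ hx : x ∈ A.domain, A ⟨x, hx⟩ = y) ↔
    Tendsto (fun h : ℝ => h⁻¹ • (S h x - x)) (𝓝[>] 0) (𝓝 y)

/-- `U` (restricted to `[0, ∞)`) is a solution of `U_t = A U`, `U(0) = U₀` in the class
`C([0, ∞); D(A)) ∩ C¹([0, ∞); H)`, where `D(A)` carries the graph norm. -/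
structure IsSolution (A : H →ₗ.[ℂ] H) (U₀ : H) (U : ℝ → H) : Prop where
  mem_domain : ∀ t : ℝ, 0 ≤ t → U t ∈ A.domain
  continuous_graph : Continuous fun t : Ici (0 : ℝ) =>
    (U t, A ⟨U t, mem_domain t t.2⟩)
  contDiffOn : ContDiffOn ℝ 1 U (Ici 0)
  equation : ∀ (t : ℝ) (ht : 0 ≤ t), HasDerivWithinAt U (A ⟨U t, mem_domain t ht⟩) (Ici 0) t
  initial : U 0 = U₀

end Semigroup

end PiezoBeam

/-! The theorem is an instance of the Lumer-Phillips theorem in a Hilbert space: a dissipative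
operator `A` with `1 - A` onto generates a contraction semigroup, and the energy identity gives
uniqueness.

The abstract half goes through Yosida approximation. Dissipativity gives `lam * ‖x‖ ≤ ‖(lam - A)
x‖`, so Neumann series spread the resolvent from `lam = 1` to every `lam > 0`. The bounded operators
`lam A (lam - A)⁻¹` are dissipative, commute with each other and converge to `A` on its domain,
which is dense. Their exponentials are contractions whose differences are controlled by the
differences of the generators; they therefore converge strongly to a semigroup
(`exists_semigroup_of_tendsto`). Its generator extends `A`, and a maximal dissipative operator has
no proper extension of this kind (`isGenerator_of_extends`).

For the beam, dissipativity (`re_inner_applyA₁_nonpos`) is integration by parts. The boundary power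
at `L` is absorbed by the diffusive variables, the thermal coupling cancels, and the heat equation
leaves `-κ ‖θ_x‖²`.

For the range condition (`exists_sub_applyA₁_eq`) the unknowns are the derivatives `u = f_x`, `w =
g_x`, `q = -θ_x` in `L²`. With `J` the primitive from `0`, one has `f = J u`, `g = J w`, `θ = J* q`,
so the conditions at `0` for `f`, `g` and at `L` for `θ` hold automatically. The diffusive equations
are solved pointwise in `ξ`; their outputs are affine in `f(L)` and `g(L)` with gains `K₁, K₂ ≥ 0`.
Integrating the remaining equations once leaves a bounded coercive system on the cube of `L²(0, L)`,
solved by Lax-Milgram. Regularity and the boundary conditions are then read off from the integrated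
equations. -/

namespace OperatorSemigroup

open PiezoBeam

variable {H : Type*} [NormedAddCommGroup H] [InnerProductSpace ℂ H]

/-! ### Bounded dissipative operators -/

/-- The uniformly continuous group generated by a bounded operator. -/
noncomputable def expGroup (B : H →L[ℂ] H) (t : ℝ) : H →L[ℂ] H := NormedSpace.exp (t • B)

/-- The bounded operator `B` is dissipative. -/
def IsDissipativeBounded (B : H →L[ℂ] H) : Prop := ∀ x, (inner ℂ (B x) x).re ≤ 0

theorem expGroup_zero (B : H →L[ℂ] H) : expGroup B 0 = 1 := by
  rw [expGroup, zero_smul, NormedSpace.exp_zero]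

section Complete

variable [CompleteSpace H]

theorem exp_add_of_commute {B C : H →L[ℂ] H} (h : Commute B C) :
    NormedSpace.exp (B + C) = NormedSpace.exp B * NormedSpace.exp C := by
  let _ : NormedAlgebra ℚ (H →L[ℂ] H) := NormedAlgebra.restrictScalars ℚ ℝ _
  exact NormedSpace.exp_add_of_commute h

theorem expGroup_add (B : H →L[ℂ] H) (s t : ℝ) :
    expGroup B (s + t) = expGroup B s * expGroup B t := by
  rw [expGroup, add_smul]
  exact exp_add_of_commute (((Commute.refl B).smul_left s).smul_right t)

theorem hasDerivAt_expGroup (B : H →L[ℂ] H) (x : H) (t : ℝ) :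
    HasDerivAt (fun s => expGroup B s x) (expGroup B t (B x)) t := by
  have h := hasDerivAt_exp_smul_const (𝕂 := ℝ) B t
  exact ((ContinuousLinearMap.apply ℂ H x).restrictScalars ℝ).hasFDerivAt.comp_hasDerivAt t h

theorem commute_expGroup {B C : H →L[ℂ] H} (h : Commute B C) (t : ℝ) :
    Commute (expGroup B t) C :=
  (h.smul_left t).exp_left

theorem expGroup_apply_comm {B C : H →L[ℂ] H} (h : Commute B C) (t : ℝ) (x : H) :
    expGroup B t (C x) = C (expGroup B t x) :=
  congrArg (fun T : H →L[ℂ] H => T x) (commute_expGroup h t).eq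

/-- The derivative of `‖e^{sB} x‖²` is `2 Re ⟪B e^{sB} x, e^{sB} x⟫ ≤ 0`. -/
theorem norm_expGroup_apply_le {B : H →L[ℂ] H} (hB : IsDissipativeBounded B) {t : ℝ}
    (ht : 0 ≤ t) (x : H) : ‖expGroup B t x‖ ≤ ‖x‖ := by
  let _ : InnerProductSpace ℝ H := InnerProductSpace.complexToReal
  have hd : ∀ s, HasDerivAt (fun s => ‖expGroup B s x‖ ^ 2)
      (2 * inner ℝ (expGroup B s x) (expGroup B s (B x))) s :=
    fun s => (hasDerivAt_expGroup B x s).norm_sq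
  have ha : Antitone fun s => ‖expGroup B s x‖ ^ 2 := by
    refine antitone_of_deriv_nonpos (fun s => (hd s).differentiableAt) fun s => ?_
    rw [(hd s).deriv, expGroup_apply_comm (Commute.refl B), real_inner_comm]
    have := hB (expGroup B s x)
    rw [real_inner_eq_re_inner ℂ]
    simp only [RCLike.re_to_complex]
    linarith
  have := ha ht
  simp only [expGroup_zero, one_apply_eq_self] at this
  exact (pow_le_pow_iff_left₀ (norm_nonneg _) (norm_nonneg _) two_ne_zero).1 this

/-- The curve `s ↦ e^{(t-s)C} e^{sB} x` joins `e^{tC} x` to `e^{tB} x`. Since `B` and `C` commute it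
equals `e^{tC} e^{s(B-C)} x`, whose derivative is easy to compute; its norm is then bounded in the
first form, because `B - C` need not be dissipative while `B` and `C` are. -/
theorem norm_expGroup_sub_le {B C : H →L[ℂ] H} (hB : IsDissipativeBounded B)
    (hC : IsDissipativeBounded C) (h : Commute B C) {t : ℝ} (ht : 0 ≤ t) (x : H) :
    ‖expGroup B t x - expGroup C t x‖ ≤ t * ‖B x - C x‖ := by
  have e : ∀ s, expGroup C t * expGroup (B - C) s = expGroup C (t - s) * expGroup B s := by
    intro s
    have h1 : expGroup (B - C) s = expGroup C (-s) * expGroup B s := by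
      rw [expGroup, expGroup, expGroup, ← exp_add_of_commute]
      · congr 1
        module
      · exact (h.symm.smul_left _).smul_right _
    rw [h1, sub_eq_add_neg, expGroup_add, mul_assoc]
  have e' : ∀ s y, expGroup C t (expGroup (B - C) s y) = expGroup C (t - s) (expGroup B s y) :=
    fun s y => congrArg (fun T : H →L[ℂ] H => T y) (e s)
  have hd : ∀ s, HasDerivAt (fun s => expGroup C t (expGroup (B - C) s x))
      (expGroup C t (expGroup (B - C) s ((B - C) x))) s := fun s =>
    ((expGroup C t).restrictScalars ℝ).hasFDerivAt.comp_hasDerivAt s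
      (hasDerivAt_expGroup (B - C) x s)
  have := norm_image_sub_le_of_norm_deriv_le_segment' (a := 0) (b := t)
    (C := ‖B x - C x‖) (fun s _ => (hd s).hasDerivWithinAt) (fun s hs => by
      rw [e']
      exact (norm_expGroup_apply_le hC (sub_nonneg.2 hs.2.le) _).trans
        (norm_expGroup_apply_le hB hs.1 _)) t (right_mem_Icc.2 ht)
  rw [e', e', sub_self, sub_zero, expGroup_zero, expGroup_zero] at this
  rw [mul_comm]
  exact this

theorem norm_expGroup_sub_self_le {B : H →L[ℂ] H} (hB : IsDissipativeBounded B)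
    {t : ℝ} (ht : 0 ≤ t) (x : H) : ‖expGroup B t x - x‖ ≤ t * ‖B x‖ := by
  have h0 : IsDissipativeBounded (0 : H →L[ℂ] H) := fun x => by simp
  have e0 : expGroup (0 : H →L[ℂ] H) t = 1 := by
    rw [expGroup, smul_zero, NormedSpace.exp_zero]
  have := norm_expGroup_sub_le hB h0 (Commute.zero_right B) ht x
  simpa [e0] using this

/-- A first order Taylor estimate that avoids `B²`. It is applied to approximations `B` of an
unbounded operator, with `y` the limit of `B x`. As `y` may fail to lie in the domain, a nearby `z`
on which `B` stays bounded replaces it, at the cost `2 * ‖y - z‖`. -/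
theorem norm_expGroup_sub_sub_le {B : H →L[ℂ] H} (hB : IsDissipativeBounded B)
    {t : ℝ} (ht : 0 ≤ t) (x y z : H) :
    ‖expGroup B t x - x - t • y‖ ≤ (‖B x - y‖ + 2 * ‖y - z‖ + t * ‖B z‖) * t := by
  have hd : ∀ s, HasDerivAt (fun s : ℝ => expGroup B s x - s • y) (expGroup B s (B x) - y) s :=
    fun s => by
      have := (hasDerivAt_expGroup B x s).sub ((hasDerivAt_id s).smul_const y)
      rw [one_smul] at this
      exact this
  have := norm_image_sub_le_of_norm_deriv_le_segment' (a := 0) (b := t)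
    (C := ‖B x - y‖ + 2 * ‖y - z‖ + t * ‖B z‖)
    (fun s _ => (hd s).hasDerivWithinAt) (fun s hs => by
      have d : expGroup B s (B x) - y = expGroup B s (B x - y) + expGroup B s (y - z)
          + (expGroup B s z - z) - (y - z) := by
        rw [map_sub, map_sub]
        abel
      have b1 := norm_expGroup_apply_le hB hs.1 (B x - y)
      have b2 := norm_expGroup_apply_le hB hs.1 (y - z)
      have b3 := norm_expGroup_sub_self_le hB hs.1 z
      have b4 : s * ‖B z‖ ≤ t * ‖B z‖ := mul_le_mul_of_nonneg_right hs.2.le (norm_nonneg _)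
      rw [d]
      refine (norm_sub_le _ _).trans ?_
      have := norm_add₃_le (a := expGroup B s (B x - y)) (b := expGroup B s (y - z))
        (c := expGroup B s z - z)
      linarith) t (right_mem_Icc.2 ht)
  rw [expGroup_zero, zero_smul, sub_zero, sub_zero, one_apply_eq_self] at this
  rwa [sub_right_comm]

end Complete

/-! ### Strong limits -/

theorem cauchySeq_of_dense {T : ℕ → H →L[ℂ] H} (hT : ∀ n x, ‖T n x‖ ≤ ‖x‖) {D : Set H}
    (hD : Dense D) (h : ∀ x ∈ D, CauchySeq fun n => T n x) (x : H) :
    CauchySeq fun n => T n x := by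
  rw [Metric.cauchySeq_iff]
  intro ε hε
  obtain ⟨z, hz, hxz⟩ := Metric.dense_iff.1 hD x (ε / 3) (by positivity)
  rw [Metric.mem_ball, dist_comm] at hz
  obtain ⟨N, hN⟩ := Metric.cauchySeq_iff.1 (h z hxz) (ε / 3) (by positivity)
  refine ⟨N, fun m hm n hn => ?_⟩
  have b : ∀ k, dist (T k x) (T k z) < ε / 3 := fun k => by
    rw [dist_eq_norm, ← map_sub]
    exact (hT k _).trans_lt (by rwa [← dist_eq_norm])
  have b1 := b m
  have b2 := b n
  rw [dist_comm] at b2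
  have := dist_triangle4 (T m x) (T m z) (T n z) (T n x)
  linarith [hN m hm n hn]

theorem tendsto_of_dense {ι : Type*} {l : Filter ι} {T : ι → H →L[ℂ] H}
    (hT : ∀ᶠ i in l, ∀ x, ‖T i x‖ ≤ ‖x‖) {D : Set H} (hD : Dense D)
    (h : ∀ x ∈ D, Tendsto (fun i => T i x) l (𝓝 x)) (x : H) :
    Tendsto (fun i => T i x) l (𝓝 x) := by
  rw [Metric.tendsto_nhds]
  intro ε hε
  obtain ⟨z, hz, hxz⟩ := Metric.dense_iff.1 hD x (ε / 3) (by positivity)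
  rw [Metric.mem_ball] at hz
  filter_upwards [hT, Metric.tendsto_nhds.1 (h z hxz) (ε / 3) (by positivity)] with i h1 h2
  have b : dist (T i x) (T i z) < ε / 3 := by
    rw [dist_eq_norm, ← map_sub]
    exact (h1 _).trans_lt (by rwa [← dist_eq_norm, dist_comm])
  have := dist_triangle4 (T i x) (T i z) z x
  linarith

/-- Right continuity at `0` implies strong continuity. -/
theorem continuousOn_of_tendsto_zero {S : ℝ → H →L[ℂ] H}
    (hadd : ∀ s t : ℝ, 0 ≤ s → 0 ≤ t → ∀ x, S (s + t) x = S s (S t x))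
    (hle : ∀ t, 0 ≤ t → ∀ x, ‖S t x‖ ≤ ‖x‖) {x : H}
    (h : Tendsto (fun t => S t x) (𝓝[≥] 0) (𝓝 x)) : ContinuousOn (fun t => S t x) (Ici 0) := by
  -- The contraction at the smaller time is factored out, so the modulus of continuity at `0` serves
  -- at every time and on both sides.
  have key : ∀ s t : ℝ, 0 ≤ s → s ≤ t → dist (S t x) (S s x) ≤ dist (S (t - s) x) x := by
    intro s t hs hst
    have e : S t x = S s (S (t - s) x) := by
      rw [← hadd _ _ hs (sub_nonneg.2 hst), add_sub_cancel]
    rw [e, dist_eq_norm, ← map_sub, dist_eq_norm]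
    exact hle _ hs _
  rw [Metric.continuousOn_iff]
  intro s hs ε hε
  rw [Metric.tendsto_nhdsWithin_nhds] at h
  obtain ⟨δ, hδ, hd⟩ := h ε hε
  refine ⟨δ, hδ, fun t ht htd => ?_⟩
  rw [Real.dist_eq] at htd
  rcases le_total s t with hst | hst
  · refine (key s t hs hst).trans_lt (hd (sub_nonneg.2 hst) ?_)
    rwa [Real.dist_eq, sub_zero]
  · rw [dist_comm]
    refine (key t s ht hst).trans_lt (hd (sub_nonneg.2 hst) ?_)
    rwa [Real.dist_eq, sub_zero, abs_sub_comm]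

/-- The exponentials of commuting dissipative operators that converge on a dense set converge to
a contraction semigroup. -/
theorem exists_semigroup_of_tendsto [CompleteSpace H] {B : ℕ → H →L[ℂ] H}
    (hB : ∀ n, IsDissipativeBounded (B n)) (hc : ∀ m n, Commute (B m) (B n)) {D : Set H}
    (hD : Dense D) {a : H → H} (ha : ∀ x ∈ D, Tendsto (fun n => B n x) atTop (𝓝 (a x))) :
    ∃ S : ℝ → H →L[ℂ] H, IsContractionSemigroup S ∧
      ∀ x ∈ D, Tendsto (fun h : ℝ => h⁻¹ • (S h x - x)) (𝓝[>] 0) (𝓝 (a x)) := by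
  have hcau : ∀ t, 0 ≤ t → ∀ x, CauchySeq fun n => expGroup (B n) t x := by
    intro t ht
    refine cauchySeq_of_dense (fun n x => norm_expGroup_apply_le (hB n) ht x) hD fun x hx => ?_
    have hx' := (ha x hx).cauchySeq
    rw [Metric.cauchySeq_iff] at hx' ⊢
    intro ε hε
    -- The `+ 1` covers `t = 0`.
    obtain ⟨N, hN⟩ := hx' (ε / (t + 1)) (by positivity)
    refine ⟨N, fun m hm n hn => ?_⟩
    have h1 := norm_expGroup_sub_le (hB m) (hB n) (hc m n) ht x
    have h2 := hN m hm n hn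
    rw [dist_eq_norm] at h2 ⊢
    refine h1.trans_lt ?_
    rw [lt_div_iff₀ (by positivity)] at h2
    nlinarith [norm_nonneg (B m x - B n x)]
  have hex : ∀ t : ℝ, ∃ T : H →L[ℂ] H, 0 ≤ t →
      ∀ x, Tendsto (fun n => expGroup (B n) t x) atTop (𝓝 (T x)) := by
    intro t
    by_cases ht : 0 ≤ t
    · choose f hf using fun x => cauchySeq_tendsto_of_complete (hcau t ht x)
      refine ⟨continuousLinearMapOfTendsto (fun n => expGroup (B n) t) (f := f)
        (tendsto_pi_nhds.2 hf), fun _ x => hf x⟩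
    -- For negative times the value is arbitrary; it only makes `S` total.
    · exact ⟨0, fun h => absurd h ht⟩
  choose S hS using hex
  have hle : ∀ t, 0 ≤ t → ∀ x, ‖S t x‖ ≤ ‖x‖ := fun t ht x =>
    le_of_tendsto (hS t ht x).norm
      (Eventually.of_forall fun n => norm_expGroup_apply_le (hB n) ht x)
  have hadd : ∀ s t : ℝ, 0 ≤ s → 0 ≤ t → ∀ x, S (s + t) x = S s (S t x) := by
    intro s t hs ht x
    refine tendsto_nhds_unique (hS (s + t) (add_nonneg hs ht) x) ?_
    -- Both the operator and its argument vary with `n`; the change of argument is harmless because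
    -- the operators are contractions uniformly in `n`.
    have h1 : Tendsto (fun n => expGroup (B n) s (expGroup (B n) t x - S t x)) atTop (𝓝 0) := by
      refine squeeze_zero_norm (fun n => norm_expGroup_apply_le (hB n) hs _) ?_
      exact tendsto_iff_norm_sub_tendsto_zero.1 (hS t ht x)
    have h2 := h1.add (hS s hs (S t x))
    rw [zero_add] at h2
    refine h2.congr fun n => ?_
    rw [map_sub, sub_add_cancel, expGroup_add]
    rfl
  have hlip : ∀ x ∈ D, ∀ t, 0 ≤ t → ‖S t x - x‖ ≤ t * ‖a x‖ := fun x hx t ht =>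
    le_of_tendsto_of_tendsto' ((hS t ht x).sub_const x).norm ((ha x hx).norm.const_mul t)
      fun n => norm_expGroup_sub_self_le (hB n) ht x
  refine ⟨S, ⟨?_, fun s t hs ht => ContinuousLinearMap.ext (hadd s t hs ht), fun x => ?_,
    fun t ht => ContinuousLinearMap.opNorm_le_bound _ zero_le_one fun x => by
      rw [one_mul]; exact hle t ht x⟩, fun x hx => ?_⟩
  · ext x
    refine tendsto_nhds_unique (hS 0 le_rfl x) ?_
    simp only [expGroup_zero]
    exact tendsto_const_nhds
  · refine continuousOn_of_tendsto_zero hadd hle ?_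
    refine tendsto_of_dense (eventually_mem_nhdsWithin.mono hle) hD (fun z hz => ?_) x
    rw [tendsto_iff_norm_sub_tendsto_zero]
    have hg : Tendsto (fun t : ℝ => t * ‖a z‖) (𝓝[≥] 0) (𝓝 0) := by
      have : Tendsto (fun t : ℝ => t * ‖a z‖) (𝓝 0) (𝓝 (0 * ‖a z‖)) :=
        (continuous_id.mul continuous_const).tendsto 0
      rw [zero_mul] at this
      exact this.mono_left nhdsWithin_le_nhds
    exact squeeze_zero' (Eventually.of_forall fun _ => norm_nonneg _)
      (eventually_mem_nhdsWithin.mono fun t ht => hlip z hz t ht) hg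
  · rw [Metric.tendsto_nhdsWithin_nhds]
    intro ε hε
    -- `a x` need not lie in `D`, so it is replaced by `z ∈ D` within `ε / 4`. This error counts
    -- twice, and the bound on `h` below makes `h * ‖a z‖` less than `ε / 4`, so the total stays
    -- below `ε`.
    obtain ⟨z, hz, hzD⟩ := Metric.dense_iff.1 hD (a x) (ε / 4) (by positivity)
    rw [Metric.mem_ball, dist_comm, dist_eq_norm] at hz
    refine ⟨ε / (4 * (‖a z‖ + 1)), by positivity, fun {h} hh hd => ?_⟩
    have hh0 : (0 : ℝ) < h := hh
    rw [Real.dist_eq, sub_zero, abs_of_pos hh0, lt_div_iff₀ (by positivity)] at hd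
    -- The limit `n → ∞` of the Taylor estimate; `‖a x - a x‖` is the limit of `‖B n x - a x‖`.
    have hb : ‖S h x - x - h • a x‖ ≤ (‖a x - a x‖ + 2 * ‖a x - z‖ + h * ‖a z‖) * h :=
      le_of_tendsto_of_tendsto' (((hS h hh0.le x).sub_const x).sub_const _).norm
        (((((ha x hx).sub_const _).norm.add_const _).add ((ha z hzD).norm.const_mul h)).mul_const h)
        fun n => norm_expGroup_sub_sub_le (hB n) hh0.le x (a x) z
    have e : h⁻¹ • (S h x - x) - a x = h⁻¹ • (S h x - x - h • a x) := by
      rw [smul_sub h⁻¹ _ (h • a x), smul_smul, inv_mul_cancel₀ hh0.ne', one_smul]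
    rw [dist_eq_norm, e, norm_smul, norm_inv, Real.norm_of_nonneg hh0.le, inv_mul_lt_iff₀ hh0]
    rw [sub_self, norm_zero, zero_add] at hb
    refine hb.trans_lt ?_
    rw [mul_comm]
    refine mul_lt_mul_of_pos_left ?_ hh0
    nlinarith [norm_nonneg (a z)]

end OperatorSemigroup

namespace OperatorSemigroup

open PiezoBeam

variable {H : Type*} [NormedAddCommGroup H] [InnerProductSpace ℂ H]

/-! ### Maximal dissipative operators -/

/-- `A` is dissipative and `1 - A` is surjective. -/
structure IsMaximalDissipative (A : H →ₗ.[ℂ] H) : Prop where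
  re_inner_nonpos : ∀ x : A.domain, (inner ℂ (A x) (x : H)).re ≤ 0
  surjective : ∀ y : H, ∃ x : A.domain, (x : H) - A x = y

/-- `R` is the resolvent `(lam - A)⁻¹`. -/
structure IsResolvent (A : H →ₗ.[ℂ] H) (lam : ℝ) (R : H →L[ℂ] H) : Prop where
  mem : ∀ y, R y ∈ A.domain
  right_inv : ∀ y, (lam : ℂ) • R y - A ⟨R y, mem y⟩ = y
  left_inv : ∀ x : A.domain, R ((lam : ℂ) • (x : H) - A x) = x

/-- `Re ⟪(lam - A) x, x⟫ ≥ lam ‖x‖²`, followed by Cauchy-Schwarz. For `lam > 0` this is both the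
injectivity of `lam - A` and the bound `1 / lam` for its inverse. -/
theorem mul_norm_le {A : H →ₗ.[ℂ] H} (hA : ∀ x : A.domain, (inner ℂ (A x) (x : H)).re ≤ 0)
    (lam : ℝ) (x : A.domain) : lam * ‖(x : H)‖ ≤ ‖(lam : ℂ) • (x : H) - A x‖ := by
  by_cases hx : (x : H) = 0
  · rw [hx, norm_zero, mul_zero]
    exact norm_nonneg _
  have hpos : 0 < ‖(x : H)‖ := norm_pos_iff.2 hx
  have h1 : (inner ℂ ((lam : ℂ) • (x : H) - A x) (x : H)).re
      = lam * ‖(x : H)‖ ^ 2 - (inner ℂ (A x) (x : H)).re := by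
    rw [inner_sub_left, inner_smul_left, Complex.conj_ofReal, Complex.sub_re,
      inner_self_eq_norm_sq_to_K, Complex.re_ofReal_mul]
    norm_cast
  have h2 : (inner ℂ ((lam : ℂ) • (x : H) - A x) (x : H)).re
      ≤ ‖(lam : ℂ) • (x : H) - A x‖ * ‖(x : H)‖ :=
    re_inner_le_norm (𝕜 := ℂ) _ _
  have h3 := hA x
  refine le_of_mul_le_mul_right ?_ hpos
  nlinarith

theorem exists_isResolvent {A : H →ₗ.[ℂ] H}
    (hA : ∀ x : A.domain, (inner ℂ (A x) (x : H)).re ≤ 0) {lam : ℝ} (hl : 0 < lam)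
    (hs : ∀ y : H, ∃ x : A.domain, (lam : ℂ) • (x : H) - A x = y) :
    ∃ R : H →L[ℂ] H, IsResolvent A lam R := by
  let T : A.domain →ₗ[ℂ] H := (lam : ℂ) • A.domain.subtype - A.toFun
  have hT : ∀ x, T x = (lam : ℂ) • (x : H) - A x := fun x => rfl
  have hinj : Function.Injective T := by
    rw [injective_iff_map_eq_zero]
    intro x hx
    have := mul_norm_le hA lam x
    rw [← hT, hx, norm_zero] at this
    have h0 : ‖(x : H)‖ ≤ 0 := by
      by_contra h
      nlinarith [mul_pos hl (not_le.1 h)]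
    exact Subtype.ext (norm_le_zero_iff.1 h0)
  let e := LinearEquiv.ofBijective T ⟨hinj, hs⟩
  have he : ∀ y, (lam : ℂ) • (e.symm y : H) - A (e.symm y) = y := fun y => e.apply_symm_apply y
  let R : H →L[ℂ] H := (A.domain.subtype ∘ₗ (e.symm : H →ₗ[ℂ] A.domain)).mkContinuous lam⁻¹ (by
    intro y
    have := mul_norm_le hA lam (e.symm y)
    rw [he] at this
    rw [inv_mul_eq_div, le_div_iff₀' hl]
    exact this)
  exact ⟨R, ⟨fun y => (e.symm y).2, he, fun x => congrArg Subtype.val (e.symm_apply_apply x)⟩⟩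

theorem IsResolvent.mul_norm_apply_le {A : H →ₗ.[ℂ] H} {lam : ℝ} {R : H →L[ℂ] H}
    (hR : IsResolvent A lam R) (hA : ∀ x : A.domain, (inner ℂ (A x) (x : H)).re ≤ 0) (y : H) :
    lam * ‖R y‖ ≤ ‖y‖ := by
  have := mul_norm_le hA lam ⟨R y, hR.mem y⟩
  rwa [hR.right_inv] at this

/-- `nu - A = (1 - (lam - nu) R) (lam - A)`, and the first factor is inverted by a Neumann series
because `‖R‖ ≤ 1 / lam`. -/
theorem IsResolvent.surjective_of_lt [CompleteSpace H] {A : H →ₗ.[ℂ] H} {lam : ℝ}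
    {R : H →L[ℂ] H} (hR : IsResolvent A lam R)
    (hA : ∀ x : A.domain, (inner ℂ (A x) (x : H)).re ≤ 0) (hl : 0 < lam) {nu : ℝ}
    (hnu : |lam - nu| < lam) (y : H) : ∃ x : A.domain, (nu : ℂ) • (x : H) - A x = y := by
  have hn : ‖((lam - nu : ℝ) : ℂ) • R‖ < 1 := by
    rw [norm_smul, Complex.norm_real, Real.norm_eq_abs]
    have : ‖R‖ ≤ lam⁻¹ := R.opNorm_le_bound (inv_nonneg.2 hl.le) fun y => by
      rw [inv_mul_eq_div, le_div_iff₀' hl]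
      exact hR.mul_norm_apply_le hA y
    calc |lam - nu| * ‖R‖ ≤ |lam - nu| * lam⁻¹ := by gcongr
      _ < lam * lam⁻¹ := by gcongr
      _ = 1 := mul_inv_cancel₀ hl.ne'
  obtain ⟨u, hu⟩ := isUnit_one_sub_of_norm_lt_one hn
  let z : H := (↑u⁻¹ : H →L[ℂ] H) y
  have hz : z - ((lam - nu : ℝ) : ℂ) • R z = y := by
    have := congrArg (fun T : H →L[ℂ] H => T y) u.mul_inv
    rw [hu] at this
    exact this
  refine ⟨⟨R z, hR.mem z⟩, ?_⟩
  have h1 := hR.right_inv z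
  rw [← hz]
  push_cast
  linear_combination (norm := module) h1

namespace IsMaximalDissipative

variable {A : H →ₗ.[ℂ] H}

/-- A resolvent at `lam` yields one at every point of `(0, 2 lam)`. Starting from `lam = 1`, steps
by the factor `3 / 2 < 2` reach every positive number. -/
theorem exists_resolvent [CompleteSpace H] (hA : IsMaximalDissipative A) {lam : ℝ}
    (hl : 0 < lam) : ∃ R : H →L[ℂ] H, IsResolvent A lam R := by
  have key : ∀ n : ℕ, ∀ lam : ℝ, 0 < lam → lam < 2 ^ (n + 1) → lam ≤ (3 / 2) ^ n →
      ∃ R : H →L[ℂ] H, IsResolvent A lam R := by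
    intro n
    induction n with
    | zero =>
      intro lam hl _ h
      obtain ⟨R, hR⟩ := exists_isResolvent hA.re_inner_nonpos one_pos (fun y => by
        simpa using hA.surjective y)
      refine exists_isResolvent hA.re_inner_nonpos hl
        (hR.surjective_of_lt hA.re_inner_nonpos one_pos ?_)
      rw [pow_zero] at h
      rw [abs_of_nonneg (by linarith)]
      linarith
    | succ n ih =>
      intro lam hl _ h
      have hq : (0 : ℝ) < (3 / 2) ^ n := by positivity
      have hq2 : ((3 : ℝ) / 2) ^ n < 2 ^ (n + 1) := by
        calc ((3 : ℝ) / 2) ^ n ≤ 2 ^ n := by gcongr; norm_num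
          _ < 2 ^ (n + 1) := by gcongr <;> norm_num
      obtain ⟨R, hR⟩ := ih _ hq hq2 le_rfl
      refine exists_isResolvent hA.re_inner_nonpos hl
        (hR.surjective_of_lt hA.re_inner_nonpos hq ?_)
      rw [pow_succ] at h
      rw [abs_lt]
      constructor <;> linarith
  obtain ⟨n, hn⟩ := pow_unbounded_of_one_lt lam (show (1 : ℝ) < 3 / 2 by norm_num)
  refine key n lam hl (hn.trans ?_) hn.le
  calc ((3 : ℝ) / 2) ^ n ≤ 2 ^ n := by gcongr; norm_num
    _ < 2 ^ (n + 1) := by gcongr <;> norm_num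

/-- If `y` is orthogonal to the domain and `y = x - A x`, then `0 = Re ⟪x, x - A x⟫ ≥ ‖x‖²`, so `x =
0` and `y = 0`. -/
theorem dense_domain [CompleteSpace H] (hA : IsMaximalDissipative A) :
    Dense (A.domain : Set H) := by
  rw [Submodule.dense_iff_topologicalClosure_eq_top, Submodule.topologicalClosure_eq_top_iff,
    Submodule.eq_bot_iff]
  intro y hy
  obtain ⟨x, rfl⟩ := hA.surjective y
  have h0 : inner ℂ (x : H) ((x : H) - A x) = 0 := hy x x.2
  have h1 := hA.re_inner_nonpos x
  have h2 : (inner ℂ (x : H) ((x : H) - A x)).re = ‖(x : H)‖ ^ 2 - (inner ℂ (A x) (x : H)).re := by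
    rw [inner_sub_right, Complex.sub_re, inner_self_eq_norm_sq_to_K, ← inner_conj_symm (A x),
      Complex.conj_re]
    norm_cast
  rw [h0, Complex.zero_re] at h2
  have h3 : (x : H) = 0 := by
    have : ‖(x : H)‖ ^ 2 ≤ 0 := by linarith
    exact norm_eq_zero.1 (pow_eq_zero_iff two_ne_zero |>.1 (le_antisymm this (sq_nonneg _)))
  have h4 : x = 0 := Subtype.ext h3
  rw [h4, LinearPMap.map_zero]
  simp

end IsMaximalDissipative

/-! ### Commuting resolvents and the Yosida approximation -/

theorem IsResolvent.commute {A : H →ₗ.[ℂ] H} {lam nu : ℝ} {R Q : H →L[ℂ] H}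
    (hR : IsResolvent A lam R) (hQ : IsResolvent A nu Q) : Commute R Q := by
  -- The resolvent identity. It gives `R = Q` for equal parameters; otherwise comparing it with its
  -- version for exchanged roles and dividing by `nu - lam` gives `R Q = Q R`.
  have ident : ∀ {lam nu : ℝ} {R Q : H →L[ℂ] H}, IsResolvent A lam R → IsResolvent A nu Q →
      ∀ y, R y - Q y = ((nu - lam : ℝ) : ℂ) • R (Q y) := by
    intro lam nu R Q hR hQ y
    have h1 := hR.left_inv ⟨Q y, hQ.mem y⟩
    have h2 : (lam : ℂ) • Q y - A ⟨Q y, hQ.mem y⟩ = y - ((nu - lam : ℝ) : ℂ) • Q y := by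
      have h3 := hQ.right_inv y
      push_cast
      linear_combination (norm := module) h3
    simp only [h2, map_sub, map_smul] at h1
    exact sub_eq_iff_eq_add.2 (sub_eq_iff_eq_add'.1 h1)
  by_cases h : lam = nu
  · subst h
    have : R = Q := by
      ext y
      have := ident hR hQ y
      rwa [sub_self, Complex.ofReal_zero, zero_smul, sub_eq_zero] at this
    rw [this]
  · ext y
    have h1 := ident hR hQ y
    have h2 := ident hQ hR y
    have h3 : ((nu - lam : ℝ) : ℂ) ≠ 0 := Complex.ofReal_ne_zero.2 (sub_ne_zero.2 (Ne.symm h))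
    refine smul_right_injective H h3 ?_
    change ((nu - lam : ℝ) : ℂ) • R (Q y) = ((nu - lam : ℝ) : ℂ) • Q (R y)
    rw [← h1, ← neg_sub (Q y), h2, ← neg_smul]
    congr 1
    push_cast
    ring

/-- The Yosida approximation of an operator, in terms of the resolvent. -/
noncomputable def yosida (lam : ℝ) (R : H →L[ℂ] H) : H →L[ℂ] H :=
  (lam : ℂ) • ((lam : ℂ) • R - 1)

theorem IsResolvent.yosida_apply {A : H →ₗ.[ℂ] H} {lam : ℝ} {R : H →L[ℂ] H}
    (hR : IsResolvent A lam R) (y : H) : yosida lam R y = (lam : ℂ) • A ⟨R y, hR.mem y⟩ := by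
  have : yosida lam R y = (lam : ℂ) • ((lam : ℂ) • R y - y) := rfl
  rw [this]
  nth_rewrite 2 [← hR.right_inv y]
  rw [sub_sub_cancel]

theorem IsResolvent.yosida_apply_domain {A : H →ₗ.[ℂ] H} {lam : ℝ} {R : H →L[ℂ] H}
    (hR : IsResolvent A lam R) (x : A.domain) : yosida lam R x = (lam : ℂ) • R (A x) := by
  have h1 := hR.left_inv x
  rw [map_sub, map_smul] at h1
  have : yosida lam R x = (lam : ℂ) • ((lam : ℂ) • R x - x) := rfl
  rw [this]
  nth_rewrite 2 [← h1]
  rw [sub_sub_cancel]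

/-- With `z = R y` one has `y = lam z - A z`, so the real part of `⟪lam A z, y⟫` is `lam (lam Re ⟪A
z, z⟫ - ‖A z‖²) ≤ 0`. -/
theorem IsResolvent.isDissipativeBounded_yosida {A : H →ₗ.[ℂ] H} {lam : ℝ} {R : H →L[ℂ] H}
    (hR : IsResolvent A lam R) (hA : ∀ x : A.domain, (inner ℂ (A x) (x : H)).re ≤ 0)
    (hl : 0 < lam) : IsDissipativeBounded (yosida lam R) := by
  intro y
  rw [hR.yosida_apply y]
  generalize hz : (⟨R y, hR.mem y⟩ : A.domain) = z
  have h1 : y = (lam : ℂ) • (z : H) - A z := by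
    rw [← hz, hR.right_inv y]
  have h2 := hA z
  rw [inner_smul_left, Complex.conj_ofReal, Complex.re_ofReal_mul]
  rw [h1, inner_sub_right, inner_smul_right, Complex.sub_re, Complex.re_ofReal_mul,
    inner_self_eq_norm_sq_to_K]
  have h3 : (((‖A z‖ : ℝ) : ℂ) ^ 2).re = ‖A z‖ ^ 2 := by norm_cast
  have h3' : ((RCLike.ofReal ‖A z‖ : ℂ) ^ 2).re = ‖A z‖ ^ 2 := h3
  rw [h3']
  have h4 := mul_nonpos_of_nonneg_of_nonpos hl.le h2
  have h5 := sq_nonneg ‖A z‖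
  exact mul_nonpos_of_nonneg_of_nonpos hl.le (by linarith)

theorem commute_yosida {lam nu : ℝ} {R Q : H →L[ℂ] H} (h : Commute R Q) :
    Commute (yosida lam R) (yosida nu Q) :=
  ((((h.smul_left _).sub_left (Commute.one_left _)).smul_left _).smul_right _ |>.sub_right
    (Commute.one_right _)).smul_right _

/-- On the domain the approximation is `lam R (A x)`, so it suffices that `lam R → 1` strongly.
These operators are contractions, and on the dense domain `lam R z - z = R (A z)` has norm at most
`‖A z‖ / lam`. -/
theorem tendsto_yosida [CompleteSpace H] {A : H →ₗ.[ℂ] H} (hA : IsMaximalDissipative A)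
    {R : ℕ → H →L[ℂ] H} (hR : ∀ n : ℕ, IsResolvent A (n + 1) (R n)) (x : A.domain) :
    Tendsto (fun n : ℕ => yosida (n + 1) (R n) x) atTop (𝓝 (A x)) := by
  have hpos : ∀ n : ℕ, (0 : ℝ) < n + 1 := fun n => by positivity
  have hle : ∀ (n : ℕ) (y : H), ‖((((n + 1 : ℝ)) : ℂ) • R n) y‖ ≤ ‖y‖ := by
    intro n y
    rw [smul_apply, norm_smul, Complex.norm_real,
      Real.norm_of_nonneg (hpos n).le]
    exact (hR n).mul_norm_apply_le hA.re_inner_nonpos y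
  have key : ∀ y : H, Tendsto (fun n : ℕ => (((n + 1 : ℝ) : ℂ) • R n) y) atTop (𝓝 y) := by
    refine tendsto_of_dense (Eventually.of_forall hle) hA.dense_domain fun z hz => ?_
    rw [tendsto_iff_norm_sub_tendsto_zero]
    have hg : Tendsto (fun n : ℕ => 1 / ((n : ℝ) + 1) * ‖A ⟨z, hz⟩‖) atTop (𝓝 0) := by
      simpa using tendsto_one_div_add_atTop_nhds_zero_nat.mul_const ‖A ⟨z, hz⟩‖
    refine squeeze_zero (fun _ => norm_nonneg _) (fun n => ?_) hg
    have h1 := (hR n).left_inv ⟨z, hz⟩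
    rw [map_sub, map_smul, sub_eq_iff_eq_add] at h1
    have h1' : (((n + 1 : ℝ) : ℂ) • R n) z - z = R n (A ⟨z, hz⟩) := by
      rw [smul_apply, h1, add_sub_cancel_left]
    rw [h1', one_div, inv_mul_eq_div, le_div_iff₀' (hpos n)]
    exact (hR n).mul_norm_apply_le hA.re_inner_nonpos _
  refine (key (A x)).congr fun n => ?_
  rw [(hR n).yosida_apply_domain]
  rfl

/-! ### Generators -/

section Generator

variable {S : ℝ → H →L[ℂ] H} {A : H →ₗ.[ℂ] H}

theorem norm_apply_le (hS : IsContractionSemigroup S) {t : ℝ} (ht : 0 ≤ t) (x : H) :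
    ‖S t x‖ ≤ ‖x‖ := by
  simpa using (S t).le_of_opNorm_le (hS.norm_le_one t ht) x

/-- Dissipativity of the generator: `Re ⟪S h x - x, x⟫ ≤ ‖S h x‖ ‖x‖ - ‖x‖² ≤ 0` for `h > 0`, and
the sign survives the limit. -/
theorem re_inner_nonpos_of_tendsto (hS : IsContractionSemigroup S) {x y : H}
    (h : Tendsto (fun h : ℝ => h⁻¹ • (S h x - x)) (𝓝[>] 0) (𝓝 y)) : (inner ℂ y x).re ≤ 0 := by
  have h1 : Tendsto (fun h : ℝ => (inner ℂ (h⁻¹ • (S h x - x)) x).re) (𝓝[>] 0)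
      (𝓝 (inner ℂ y x).re) :=
    (Complex.continuous_re.tendsto _).comp (h.inner tendsto_const_nhds)
  refine le_of_tendsto h1 (eventually_mem_nhdsWithin.mono fun t ht => ?_)
  have ht0 : (0 : ℝ) < t := ht
  rw [← Complex.coe_smul, inner_smul_left, Complex.conj_ofReal, Complex.re_ofReal_mul,
    inner_sub_left, Complex.sub_re, inner_self_eq_norm_sq_to_K]
  have h3 : ((RCLike.ofReal ‖x‖ : ℂ) ^ 2).re = ‖x‖ ^ 2 := by
    change (((‖x‖ : ℝ) : ℂ) ^ 2).re = ‖x‖ ^ 2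
    norm_cast
  have h4 : (inner ℂ (S t x) x).re ≤ ‖S t x‖ * ‖x‖ := re_inner_le_norm (𝕜 := ℂ) _ _
  have h5 := norm_apply_le hS ht0.le x
  rw [h3]
  refine mul_nonpos_of_nonneg_of_nonpos (inv_nonneg.2 ht0.le) ?_
  nlinarith [norm_nonneg x]

/-- A maximal dissipative operator has no proper extension that generates a contraction
semigroup. -/
theorem isGenerator_of_extends (hA : IsMaximalDissipative A) (hS : IsContractionSemigroup S)
    (h : ∀ x : A.domain, Tendsto (fun h : ℝ => h⁻¹ • (S h x - x)) (𝓝[>] 0) (𝓝 (A x))) :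
    IsGenerator A S := by
  intro x y
  refine ⟨fun ⟨hx, e⟩ => e ▸ h ⟨x, hx⟩, fun hxy => ?_⟩
  -- With `z - A z = x - y`, the difference quotient at `x - z` tends to `y - A z = x - z`.
  -- Dissipativity of such limits then gives `‖x - z‖² ≤ 0`.
  obtain ⟨z, hz⟩ := hA.surjective (x - y)
  have hd : Tendsto (fun h : ℝ => h⁻¹ • (S h (x - z) - (x - z))) (𝓝[>] 0) (𝓝 (y - A z)) := by
    refine (hxy.sub (h z)).congr fun t => ?_
    rw [map_sub]
    module
  have e : y - A z = x - z := by
    rw [sub_eq_sub_iff_add_eq_add] at hz ⊢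
    rw [add_comm y, hz]
  rw [e] at hd
  have h1 := re_inner_nonpos_of_tendsto hS hd
  have h2 : ‖x - z‖ ^ 2 ≤ 0 := by
    have := inner_self_eq_norm_sq (𝕜 := ℂ) (x - (z : H))
    rw [← this]
    exact h1
  have h3 : x = z := sub_eq_zero.1 (norm_eq_zero.1
    (pow_eq_zero_iff two_ne_zero |>.1 (le_antisymm h2 (sq_nonneg _))))
  subst h3
  refine ⟨z.2, ?_⟩
  rw [sub_self, sub_eq_zero] at e
  exact e.symm

/-- `S t` commutes with `S h`, so it carries the difference quotient at `x` to the one at `S t x`.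
-/
theorem IsGenerator.apply_mem (hG : IsGenerator A S) (hS : IsContractionSemigroup S) {t : ℝ}
    (ht : 0 ≤ t) (x : A.domain) : ∃ h : S t x ∈ A.domain, A ⟨S t x, h⟩ = S t (A x) := by
  refine (hG _ _).2 ?_
  have h1 := ((S t).continuous.tendsto _).comp ((hG x (A x)).1 ⟨x.2, rfl⟩)
  refine h1.congr' (eventually_mem_nhdsWithin.mono fun h hh => ?_)
  have hh0 : (0 : ℝ) < h := hh
  have e : S h (S t x) = S t (S h x) := by
    have e1 := congrArg (fun T : H →L[ℂ] H => T x) (hS.add h t hh0.le ht)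
    have e2 := congrArg (fun T : H →L[ℂ] H => T x) (hS.add t h ht hh0.le)
    simp only [ContinuousLinearMap.comp_apply] at e1 e2
    rw [← e1, add_comm, e2]
  simp only [Function.comp_apply]
  rw [e, ← map_sub, ← Complex.coe_smul, ← Complex.coe_smul, map_smul]

/-- The generator only supplies a right derivative at `0`; the point is the left derivative at `t >
0`. -/
theorem IsGenerator.hasDerivWithinAt (hG : IsGenerator A S) (hS : IsContractionSemigroup S)
    {t : ℝ} (ht : 0 ≤ t) (x : A.domain) :
    HasDerivWithinAt (fun s => S s x) (S t (A x)) (Ici 0) t := by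
  rw [hasDerivWithinAt_iff_isLittleO, Asymptotics.isLittleO_iff]
  intro ε hε
  have hc := (hS.continuousOn (A x)) t ht
  rw [Metric.continuousWithinAt_iff] at hc
  obtain ⟨δ₁, hδ₁, h1⟩ := hc (ε / 2) (by positivity)
  have hg := (hG x (A x)).1 ⟨x.2, rfl⟩
  rw [Metric.tendsto_nhdsWithin_nhds] at hg
  obtain ⟨δ₂, hδ₂, h2⟩ := hg (ε / 2) (by positivity)
  -- A forward estimate uniform in the base point `r`, since `S r` is a contraction.
  have key : ∀ r s : ℝ, 0 ≤ r → r ≤ s → s - r < δ₂ →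
      ‖S s x - S r x - (s - r) • S r (A x)‖ ≤ ε / 2 * (s - r) := by
    intro r s hr hrs hd
    rcases hrs.eq_or_lt with rfl | hlt
    · simp
    have hp : 0 < s - r := sub_pos.2 hlt
    have e1 := congrArg (fun T : H →L[ℂ] H => T x) (hS.add r (s - r) hr hp.le)
    simp only [ContinuousLinearMap.comp_apply, add_sub_cancel] at e1
    have e2 : S s x - S r x - (s - r) • S r (A x)
        = S r (S (s - r) x - x - (s - r) • A x) := by
      rw [map_sub, map_sub, e1, ← Complex.coe_smul, ← Complex.coe_smul, map_smul]
    have e3 : S (s - r) x - x - (s - r) • A x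
        = (s - r) • ((s - r)⁻¹ • (S (s - r) x - x) - A x) := by
      rw [smul_sub (s - r), smul_smul, mul_inv_cancel₀ hp.ne', one_smul]
    have h3 := h2 (show s - r ∈ Ioi 0 from hp) (by rwa [Real.dist_eq, sub_zero, abs_of_pos hp])
    rw [dist_eq_norm] at h3
    rw [e2]
    refine (norm_apply_le hS hr _).trans ?_
    rw [e3, norm_smul, Real.norm_of_nonneg hp.le, mul_comm]
    gcongr
  filter_upwards [self_mem_nhdsWithin,
    mem_nhdsWithin_of_mem_nhds (Metric.ball_mem_nhds t (lt_min hδ₁ hδ₂))] with s hs hsd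
  rw [Metric.mem_ball, lt_min_iff] at hsd
  have hs0 : (0 : ℝ) ≤ s := hs
  rcases le_total t s with hts | hts
  · have h3 := hsd.2
    rw [Real.dist_eq, abs_of_nonneg (sub_nonneg.2 hts)] at h3
    refine (key t s ht hts h3).trans ?_
    rw [Real.norm_of_nonneg (sub_nonneg.2 hts)]
    have := mul_nonneg hε.le (sub_nonneg.2 hts)
    linarith
  · have h3 := hsd.2
    -- To the left of `t` the forward estimate is based at `s`, and the strong continuity of `S` at
    -- `t` exchanges `S s (A x)` for `S t (A x)`. Each contributes `ε / 2`.
    rw [Real.dist_eq, abs_sub_comm, abs_of_nonneg (sub_nonneg.2 hts)] at h3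
    have h4 := key s t hs0 hts h3
    have h5 := h1 hs hsd.1
    rw [dist_eq_norm] at h5
    have e : S s x - S t x - (s - t) • S t (A x)
        = -(S t x - S s x - (t - s) • S s (A x)) + (s - t) • (S s (A x) - S t (A x)) := by
      module
    rw [e]
    refine (norm_add_le _ _).trans ?_
    rw [norm_neg, norm_smul, Real.norm_eq_abs, abs_sub_comm, abs_of_nonneg (sub_nonneg.2 hts)]
    have := mul_le_mul_of_nonneg_left h5.le (sub_nonneg.2 hts)
    linarith

theorem IsGenerator.isSolution (hG : IsGenerator A S) (hS : IsContractionSemigroup S)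
    (x : A.domain) : IsSolution A x (fun t => S t x) where
  mem_domain t ht := (IsGenerator.apply_mem hG hS ht x).1
  continuous_graph := by
    refine Continuous.prodMk (continuousOn_iff_continuous_domRestrict.1 (hS.continuousOn x)) ?_
    refine (continuousOn_iff_continuous_domRestrict.1 (hS.continuousOn (A x))).congr fun t => ?_
    exact (IsGenerator.apply_mem hG hS t.2 x).2.symm
  contDiffOn := by
    have hd := fun (t : ℝ) (ht : t ∈ Ici (0 : ℝ)) => IsGenerator.hasDerivWithinAt hG hS ht x
    rw [contDiffOn_one_iff_derivWithin (uniqueDiffOn_Ici 0)]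
    refine ⟨fun t ht => (hd t ht).differentiableWithinAt, ?_⟩
    exact (hS.continuousOn (A x)).congr fun t ht =>
      (hd t ht).derivWithin (uniqueDiffOn_Ici 0 t ht)
  equation t ht := by
    rw [(IsGenerator.apply_mem hG hS ht x).2]
    exact IsGenerator.hasDerivWithinAt hG hS ht x
  initial := by simp [hS.zero]

end Generator

/-! ### Uniqueness for the Cauchy problem and the Lumer-Phillips theorem -/

theorem IsSolution.unique {A : H →ₗ.[ℂ] H}
    (hA : ∀ x : A.domain, (inner ℂ (A x) (x : H)).re ≤ 0) {U₀ : H} {U W : ℝ → H}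
    (hU : IsSolution A U₀ U) (hW : IsSolution A U₀ W) {t : ℝ} (ht : 0 ≤ t) : U t = W t := by
  let _ : InnerProductSpace ℝ H := InnerProductSpace.complexToReal
  have hd : ∀ (s : ℝ) (hs : 0 ≤ s), HasDerivWithinAt (fun s => ‖U s - W s‖ ^ 2)
      (2 * inner ℝ (U s - W s)
        (A ⟨U s, hU.mem_domain s hs⟩ - A ⟨W s, hW.mem_domain s hs⟩)) (Ici 0) s :=
    fun s hs => ((hU.equation s hs).sub (hW.equation s hs)).norm_sq
  -- The derivative is `2 Re ⟪A (U - W), U - W⟫ ≤ 0`, and the function vanishes at `0`.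
  have ha : AntitoneOn (fun s => ‖U s - W s‖ ^ 2) (Ici 0) := by
    refine antitoneOn_of_deriv_nonpos (convex_Ici 0)
      (fun s hs => (hd s hs).continuousWithinAt) ?_ ?_
    · intro s hs
      rw [interior_Ici] at hs ⊢
      exact ((hd s hs.le).hasDerivAt (Ici_mem_nhds hs)).differentiableAt.differentiableWithinAt
    · intro s hs
      rw [interior_Ici] at hs
      have hs0 : (0 : ℝ) ≤ s := hs.le
      rw [((hd s hs0).hasDerivAt (Ici_mem_nhds hs)).deriv, real_inner_comm]
      have := hA (⟨U s, hU.mem_domain s hs0⟩ - ⟨W s, hW.mem_domain s hs0⟩)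
      rw [LinearPMap.map_sub] at this
      rw [real_inner_eq_re_inner ℂ]
      simp only [RCLike.re_to_complex]
      have h2 : ∀ r : ℝ, r ≤ 0 → 2 * r ≤ 0 := fun r hr => by linarith
      exact h2 _ this
  have h0 := ha (mem_Ici.2 le_rfl) ht ht
  simp only [hU.initial, hW.initial, sub_self, norm_zero, zero_pow two_ne_zero] at h0
  exact sub_eq_zero.1 (norm_eq_zero.1
    (pow_eq_zero_iff two_ne_zero |>.1 (le_antisymm h0 (sq_nonneg _))))

/-- The Lumer-Phillips theorem in a Hilbert space, and the solution of the Cauchy problem. -/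
theorem IsMaximalDissipative.exists_semigroup [CompleteSpace H] {A : H →ₗ.[ℂ] H}
    (hA : IsMaximalDissipative A) :
    ∃ S : ℝ → H →L[ℂ] H, IsContractionSemigroup S ∧ IsGenerator A S ∧
      ∀ U₀ : H, U₀ ∈ A.domain → IsSolution A U₀ (fun t => S t U₀) ∧
        ∀ U : ℝ → H, IsSolution A U₀ U → ∀ t : ℝ, 0 ≤ t → U t = S t U₀ := by
  classical
  have hpos : ∀ n : ℕ, (0 : ℝ) < n + 1 := fun n => by positivity
  choose R hR using fun n : ℕ => hA.exists_resolvent (hpos n)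
  -- Extension of `A` by `0`; only the values on the domain enter.
  let a : H → H := fun x => if h : x ∈ A.domain then A ⟨x, h⟩ else 0
  have ha : ∀ x (h : x ∈ A.domain), a x = A ⟨x, h⟩ := fun x h => dif_pos h
  obtain ⟨S, hS, hSA⟩ := exists_semigroup_of_tendsto (B := fun n => yosida (n + 1) (R n)) (a := a)
    (fun n => (hR n).isDissipativeBounded_yosida hA.re_inner_nonpos (hpos n))
    (fun m n => commute_yosida ((hR m).commute (hR n))) hA.dense_domain
    (fun x hx => by rw [ha x hx]; exact tendsto_yosida hA hR ⟨x, hx⟩)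
  have hG : IsGenerator A S := isGenerator_of_extends hA hS fun x => by
    have := hSA x x.2
    rwa [ha x x.2] at this
  refine ⟨S, hS, hG, fun U₀ h₀ => ?_⟩
  have hsol := IsGenerator.isSolution hG hS ⟨U₀, h₀⟩
  exact ⟨hsol, fun U hU t ht => IsSolution.unique hA.re_inner_nonpos hU hsol ht⟩

end OperatorSemigroup

namespace PiezoBeam

/-! ### The primitive as an operator on `L²(0, L)` -/

section Primitive

variable {L : ℝ}

theorem integrableOn_L2Beam (w : L2Beam L) : IntegrableOn (w : ℝ → ℂ) (Ioo 0 L) :=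
  (Lp.memLp w).integrable (by norm_num)

theorem continuousOn_primitive (hL : 0 < L) (w : L2Beam L) :
    ContinuousOn (fun x => ∫ y in (0 : ℝ)..x, w y) (Icc 0 L) := by
  rw [← uIcc_of_le hL.le]
  refine intervalIntegral.continuousOn_primitive_interval ?_
  rw [uIcc_of_le hL.le]
  exact (integrableOn_Icc_iff_integrableOn_Ioo).2 (integrableOn_L2Beam w)

/-- The constant function `1` in `L²(0, L)`. -/
noncomputable def oneL2 (L : ℝ) : L2Beam L := Lp.const 2 (volume.restrict (Ioo 0 L)) (1 : ℂ)

theorem coeFn_oneL2 (L : ℝ) : oneL2 L =ᵐ[volume.restrict (Ioo 0 L)] fun _ => (1 : ℂ) :=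
  Lp.coeFn_const (p := 2) (μ := volume.restrict (Ioo 0 L)) (1 : ℂ)

theorem inner_oneL2_left (w : L2Beam L) : inner ℂ (oneL2 L) w = ∫ x in Ioo 0 L, w x := by
  rw [L2.inner_def]
  refine integral_congr_ae ?_
  filter_upwards [coeFn_oneL2 L] with x hx
  rw [hx]
  simp

theorem setIntegral_Ioc_eq (w : L2Beam L) {x : ℝ} (hx : x ∈ Ioo 0 L) :
    ∫ y in (0 : ℝ)..x, w y = ∫ y in Ioc 0 x, w y ∂(volume.restrict (Ioo 0 L)) := by
  rw [intervalIntegral.integral_of_le hx.1.le, Measure.restrict_restrict measurableSet_Ioc,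
    inter_eq_left.2 (show Ioc 0 x ⊆ Ioo 0 L from fun y hy => ⟨hy.1, hy.2.trans_lt hx.2⟩)]

/-- Cauchy-Schwarz against the indicator of `(0, x]`. -/
theorem norm_primitive_le (w : L2Beam L) {x : ℝ} (hx : x ∈ Ioo 0 L) :
    ‖∫ y in (0 : ℝ)..x, w y‖ ≤ (volume.restrict (Ioo 0 L)).real univ ^ (1 / 2 : ℝ) * ‖w‖ := by
  have hm : volume.restrict (Ioo 0 L) (Ioc 0 x) ≠ ⊤ := measure_ne_top _ _
  rw [setIntegral_Ioc_eq w hx, ← L2.inner_indicatorConstLp_one measurableSet_Ioc hm]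
  refine (norm_inner_le_norm _ _).trans ?_
  gcongr
  refine norm_indicatorConstLp_le.trans ?_
  rw [norm_one, one_mul, ENNReal.toReal_ofNat]
  exact Real.rpow_le_rpow measureReal_nonneg (measureReal_mono (subset_univ _)) (by norm_num)

theorem memLp_primitive (hL : 0 < L) (w : L2Beam L) :
    MemLp (fun x => ∫ y in (0 : ℝ)..x, w y) 2 (volume.restrict (Ioo 0 L)) := by
  refine MemLp.of_bound (((continuousOn_primitive hL w).mono
    Ioo_subset_Icc_self).aestronglyMeasurable measurableSet_Ioo)
    ((volume.restrict (Ioo 0 L)).real univ ^ (1 / 2 : ℝ) * ‖w‖) ?_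
  filter_upwards [ae_restrict_mem measurableSet_Ioo] with x hx
  exact norm_primitive_le w hx

end Primitive

variable (p : BeamParameters)

/-- The operator `w ↦ ∫₀ˣ w`. -/
noncomputable def primitive : L2Beam p.L →L[ℂ] L2Beam p.L :=
  LinearMap.mkContinuous
    { toFun := fun w => (memLp_primitive p.L_pos w).toLp _
      map_add' := fun u w => by
        rw [← MemLp.toLp_add]
        refine MemLp.toLp_congr _ _ ?_
        filter_upwards [ae_restrict_mem measurableSet_Ioo] with x hx
        rw [Pi.add_apply, setIntegral_Ioc_eq _ hx, setIntegral_Ioc_eq _ hx,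
          setIntegral_Ioc_eq _ hx, ← integral_add]
        · refine integral_congr_ae (ae_restrict_of_ae ?_)
          filter_upwards [Lp.coeFn_add u w] with y hy
          rw [hy, Pi.add_apply]
        · exact (integrableOn_L2Beam u).integrable.restrict
        · exact (integrableOn_L2Beam w).integrable.restrict
      map_smul' := fun r w => by
        rw [← MemLp.toLp_const_smul]
        refine MemLp.toLp_congr _ _ ?_
        filter_upwards [ae_restrict_mem measurableSet_Ioo] with x hx
        rw [Pi.smul_apply, setIntegral_Ioc_eq _ hx, setIntegral_Ioc_eq _ hx, ← integral_smul]
        refine integral_congr_ae (ae_restrict_of_ae ?_)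
        filter_upwards [Lp.coeFn_smul r w] with y hy
        rw [hy, Pi.smul_apply, RingHom.id_apply] }
    ((measureUnivNNReal (volume.restrict (Ioo 0 p.L)) : ℝ) ^ (2⁻¹ : ℝ) *
      (volume.restrict (Ioo 0 p.L)).real univ ^ (1 / 2 : ℝ)) (fun w => by
      rw [mul_assoc]
      have hC : 0 ≤ (volume.restrict (Ioo 0 p.L)).real univ ^ (1 / 2 : ℝ) * ‖w‖ := by positivity
      have := Lp.norm_le_of_ae_bound (f := (memLp_primitive p.L_pos w).toLp _) hC (by
        filter_upwards [(memLp_primitive p.L_pos w).coeFn_toLp,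
          ae_restrict_mem measurableSet_Ioo] with x hx hx'
        rw [hx]
        exact norm_primitive_le w hx')
      rw [ENNReal.toReal_ofNat] at this
      exact this)

variable {p}

theorem coeFn_primitive (w : L2Beam p.L) :
    primitive p w =ᵐ[volume.restrict (Ioo 0 p.L)] fun x => ∫ y in (0 : ℝ)..x, w y :=
  (memLp_primitive p.L_pos w).coeFn_toLp

theorem isContRep_primitive (w : L2Beam p.L) :
    IsContRep p.L (primitive p w) fun x => ∫ y in (0 : ℝ)..x, w y :=
  ⟨continuousOn_primitive p.L_pos w, coeFn_primitive w⟩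

theorem hasWeakDeriv_primitive (w : L2Beam p.L) : HasWeakDeriv p.L (primitive p w) w := by
  intro φ h1 _ h3
  rw [← integral_deriv_smul_primitive w h1 h3]
  refine integral_congr_ae ?_
  filter_upwards [coeFn_primitive w] with x hx
  rw [hx]

theorem primitive_mem_H1 (w : L2Beam p.L) : primitive p w ∈ H1 p.L :=
  ⟨w, hasWeakDeriv_primitive w⟩

theorem weakDeriv_primitive (w : L2Beam p.L) : weakDeriv p.L (primitive p w) = w :=
  (hasWeakDeriv_primitive w).weakDeriv_eq

theorem pointValue_primitive_zero (w : L2Beam p.L) : pointValue p.L (primitive p w) 0 = 0 := by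
  rw [(isContRep_primitive w).pointValue_eq p.L_pos p.zero_mem, intervalIntegral.integral_same]

/-- The trace at `L` becomes a bounded functional of the derivative; in this form the boundary
feedback enters the resolvent equation. -/
theorem pointValue_primitive_right (w : L2Beam p.L) :
    pointValue p.L (primitive p w) p.L = inner ℂ (oneL2 p.L) w := by
  rw [(isContRep_primitive w).pointValue_eq p.L_pos p.L_mem, inner_oneL2_left,
    intervalIntegral.integral_of_le p.L_pos.le]
  exact congrArg (fun ν : Measure ℝ => ∫ x, w x ∂ν) restrict_Ioo_eq_restrict_Ioc.symm

theorem primitive_mem_H1star (w : L2Beam p.L) : primitive p w ∈ H1star p :=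
  ⟨primitive_mem_H1 w, pointValue_primitive_zero w⟩

theorem hasWeakDeriv_oneL2 (hL : 0 < p.L) : HasWeakDeriv p.L (oneL2 p.L) 0 := by
  intro φ h1 h2 h3
  have e1 : ∫ x in Ioo 0 p.L, φ x • (0 : L2Beam p.L) x = 0 := by
    refine integral_eq_zero_of_ae ?_
    filter_upwards [Lp.coeFn_zero ℂ 2 (volume.restrict (Ioo 0 p.L))] with x hx
    simp only [hx, Pi.zero_apply, smul_zero]
  have e2 : ∫ x in Ioo 0 p.L, deriv φ x • oneL2 p.L x
      = ∫ x in Ioo 0 p.L, deriv φ x • (1 : ℂ) := by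
    refine integral_congr_ae ?_
    filter_upwards [coeFn_oneL2 p.L] with x hx
    rw [hx]
  have hz : ∀ x, x ∉ Ioo 0 p.L → φ x = 0 := fun x hx =>
    image_eq_zero_of_notMem_tsupport fun h => hx (h3 h)
  rw [e1, e2, integral_smul_const, restrict_Ioo_eq_restrict_Ioc,
    ← intervalIntegral.integral_of_le hL.le, intervalIntegral.integral_deriv_eq_sub
      (fun x _ => (h1.differentiable (by simp)).differentiableAt)
      ((h1.continuous_deriv (by simp)).intervalIntegrable _ _),
    hz _ (by simp), hz _ (by simp)]
  simp

theorem isContRep_oneL2 : IsContRep p.L (oneL2 p.L) fun _ => 1 :=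
  ⟨continuousOn_const, coeFn_oneL2 p.L⟩

theorem oneL2_mem_H1 : oneL2 p.L ∈ H1 p.L := ⟨0, hasWeakDeriv_oneL2 p.L_pos⟩

theorem weakDeriv_oneL2 : weakDeriv p.L (oneL2 p.L) = 0 :=
  (hasWeakDeriv_oneL2 p.L_pos).weakDeriv_eq

theorem pointValue_oneL2 {x : ℝ} (hx : x ∈ Icc 0 p.L) : pointValue p.L (oneL2 p.L) x = 1 :=
  isContRep_oneL2.pointValue_eq p.L_pos hx

/-- Every element of `H¹(0, L)` is its value at `0` plus the primitive of its derivative. -/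
theorem eq_add_primitive {v : L2Beam p.L} (hv : v ∈ H1 p.L) :
    v = pointValue p.L v 0 • oneL2 p.L + primitive p (weakDeriv p.L v) := by
  obtain ⟨c, hc⟩ := (weakDeriv_spec hv).exists_ae_eq_primitive p.L_pos
  have hc0 := hc.pointValue_eq p.L_pos p.zero_mem
  rw [intervalIntegral.integral_same, add_zero] at hc0
  refine Lp.ext ?_
  filter_upwards [hc.2, Lp.coeFn_add (pointValue p.L v 0 • oneL2 p.L)
    (primitive p (weakDeriv p.L v)), Lp.coeFn_smul (pointValue p.L v 0) (oneL2 p.L),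
    coeFn_oneL2 p.L, coeFn_primitive (weakDeriv p.L v)] with x h1 h2 h3 h4 h5
  rw [h1, h2, Pi.add_apply, h3, Pi.smul_apply, h4, h5, hc0, smul_eq_mul, mul_one]

theorem eq_primitive {v : L2Beam p.L} (hv : v ∈ H1star p) :
    v = primitive p (weakDeriv p.L v) := by
  have := eq_add_primitive hv.1
  rwa [hv.2, zero_smul, zero_add] at this

theorem pointValue_right_eq {v : L2Beam p.L} (hv : v ∈ H1 p.L) :
    pointValue p.L v p.L = pointValue p.L v 0 + inner ℂ (oneL2 p.L) (weakDeriv p.L v) := by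
  nth_rewrite 1 [eq_add_primitive hv]
  rw [pointValue_add p.L_pos (Submodule.smul_mem _ _ oneL2_mem_H1) (primitive_mem_H1 _) p.L_mem,
    pointValue_smul p.L_pos _ oneL2_mem_H1 p.L_mem, pointValue_oneL2 p.L_mem, mul_one,
    pointValue_primitive_right]

/-- Integration by parts for two primitives. -/
theorem inner_primitive_add (u w : L2Beam p.L) :
    inner ℂ (primitive p u) w + inner ℂ u (primitive p w)
      = inner ℂ u (oneL2 p.L) * inner ℂ (oneL2 p.L) w := by
  set ν : Measure ℝ := volume.restrict (Ioo 0 p.L) with hν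
  have hw : Integrable (w : ℝ → ℂ) ν := integrableOn_L2Beam w
  have hu : Integrable (fun x => (starRingEnd ℂ) (u x)) ν := by
    have : Integrable (u : ℝ → ℂ) ν := integrableOn_L2Beam u
    exact (Complex.conjLIE.integrable_comp_iff (φ := (u : ℝ → ℂ))).2 this
  have hm : MeasurableSet {z : ℝ × ℝ | z.2 ≤ z.1} := measurableSet_le measurable_snd measurable_fst
  have hF : Integrable (fun z : ℝ × ℝ => (starRingEnd ℂ) (u z.1) * w z.2) (ν.prod ν) :=
    hu.mul_prod hw
  -- The square `(0, L)²` is cut along the diagonal: integrating out the second variable over `z.2 ≤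
  -- z.1` produces the primitive of `w`, and integrating out the first over the complement produces
  -- that of `u`. The whole square gives the product of the integrals.
  have hsplit := integral_add_compl hm hF
  have e0 : ∫ z, (starRingEnd ℂ) (u z.1) * w z.2 ∂(ν.prod ν)
      = inner ℂ u (oneL2 p.L) * inner ℂ (oneL2 p.L) w := by
    rw [integral_prod_mul (fun x => (starRingEnd ℂ) (u x)) (w : ℝ → ℂ), inner_oneL2_left,
      ← inner_conj_symm, inner_oneL2_left, integral_conj]
  have e1 : ∫ z in {z : ℝ × ℝ | z.2 ≤ z.1}, (starRingEnd ℂ) (u z.1) * w z.2 ∂(ν.prod ν)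
      = inner ℂ u (primitive p w) := by
    rw [← integral_indicator hm, integral_prod _ (hF.indicator hm), L2.inner_def]
    refine integral_congr_ae ?_
    filter_upwards [coeFn_primitive w, ae_restrict_mem measurableSet_Ioo] with x hx hx'
    have : (fun y => {z : ℝ × ℝ | z.2 ≤ z.1}.indicator
        (fun z => (starRingEnd ℂ) (u z.1) * w z.2) (x, y))
        = (Iic x).indicator (fun y => (starRingEnd ℂ) (u x) * w y) := by
      ext y
      simp [indicator, mem_Iic]
    rw [this, integral_indicator measurableSet_Iic, integral_const_mul, hx, RCLike.inner_apply,
      mul_comm, intervalIntegral.integral_of_le hx'.1.le, hν,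
      Measure.restrict_restrict measurableSet_Iic]
    congr 3
    ext y
    simp only [mem_inter_iff, mem_Ioo, mem_Iic, mem_Ioc]
    exact ⟨fun h => ⟨h.2.1, h.1⟩, fun h => ⟨h.2, h.1, h.2.trans_lt hx'.2⟩⟩
  have e2 : ∫ z in {z : ℝ × ℝ | z.2 ≤ z.1}ᶜ, (starRingEnd ℂ) (u z.1) * w z.2 ∂(ν.prod ν)
      = inner ℂ (primitive p u) w := by
    rw [← integral_indicator hm.compl, integral_prod_symm _ (hF.indicator hm.compl),
      L2.inner_def]
    refine integral_congr_ae ?_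
    filter_upwards [coeFn_primitive u, ae_restrict_mem measurableSet_Ioo] with y hy hy'
    have : (fun x => {z : ℝ × ℝ | z.2 ≤ z.1}ᶜ.indicator
        (fun z => (starRingEnd ℂ) (u z.1) * w z.2) (x, y))
        = (Iio y).indicator (fun x => (starRingEnd ℂ) (u x) * w y) := by
      ext x
      simp [indicator, mem_Iio]
    rw [this, integral_indicator measurableSet_Iio, integral_mul_const, hy, RCLike.inner_apply,
      mul_comm, intervalIntegral.integral_of_le hy'.1.le, hν,
      Measure.restrict_restrict measurableSet_Iio, integral_conj,
      ← restrict_Ioo_eq_restrict_Ioc]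
    congr 4
    ext x
    simp only [mem_inter_iff, mem_Ioo, mem_Iio]
    exact ⟨fun h => ⟨h.2.1, h.1⟩, fun h => ⟨h.2, h.1, h.2.trans hy'.2⟩⟩
  rw [← e0, ← hsplit, e1, e2, add_comm]

/-- Integration by parts in `H¹(0, L)`. -/
theorem inner_weakDeriv_add {v w : L2Beam p.L} (hv : v ∈ H1 p.L) (hw : w ∈ H1 p.L) :
    inner ℂ (weakDeriv p.L v) w + inner ℂ v (weakDeriv p.L w)
      = (starRingEnd ℂ) (pointValue p.L v p.L) * pointValue p.L w p.L
        - (starRingEnd ℂ) (pointValue p.L v 0) * pointValue p.L w 0 := by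
  have h := inner_primitive_add (weakDeriv p.L v) (weakDeriv p.L w)
  rw [pointValue_right_eq hv, pointValue_right_eq hw]
  have e1 : inner ℂ (weakDeriv p.L v) w
      = pointValue p.L w 0 * inner ℂ (weakDeriv p.L v) (oneL2 p.L)
        + inner ℂ (weakDeriv p.L v) (primitive p (weakDeriv p.L w)) := by
    conv_lhs => rw [eq_add_primitive hw, inner_add_right, inner_smul_right]
  have e2 : inner ℂ v (weakDeriv p.L w)
      = (starRingEnd ℂ) (pointValue p.L v 0) * inner ℂ (oneL2 p.L) (weakDeriv p.L w)
        + inner ℂ (primitive p (weakDeriv p.L v)) (weakDeriv p.L w) := by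
    conv_lhs => rw [eq_add_primitive hv, inner_add_left, inner_smul_left]
  have e3 : (starRingEnd ℂ) (inner ℂ (oneL2 p.L) (weakDeriv p.L v))
      = inner ℂ (weakDeriv p.L v) (oneL2 p.L) := inner_conj_symm _ _
  rw [e1, e2, map_add, e3]
  linear_combination h

/-! ### Completeness of the phase space -/

open PhaseSpace

theorem PhaseSpace.norm_sq_eq (U : PhaseSpace p) : ‖U‖ ^ 2 =
    p.ρ * ‖U.f‖ ^ 2 + p.μ * ‖U.g‖ ^ 2 + p.α₁ * ‖weakDeriv p.L U.V‖ ^ 2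
      + p.β * ‖(p.γ : ℂ) • weakDeriv p.L U.V - weakDeriv p.L U.P‖ ^ 2 + p.c * ‖U.θ‖ ^ 2
      + p.sineFactor * (p.l₁ * ‖U.φ₁‖ ^ 2 + p.l₂ * ‖U.φ₂‖ ^ 2) := by
  have h1 : RCLike.re (inner ℂ U U) = ‖U‖ ^ 2 := inner_self_eq_norm_sq (𝕜 := ℂ) U
  have h2 : inner ℂ U U = energyInner U U := rfl
  rw [← h1, h2, energyInner_self]
  exact Complex.ofReal_re _

theorem inner_eq_energyInner (U W : PhaseSpace p) : inner ℂ U W = energyInner W U := rfl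

theorem weakDeriv_V_add (U W : PhaseSpace p) :
    weakDeriv p.L (U + W).V = weakDeriv p.L U.V + weakDeriv p.L W.V :=
  weakDeriv_add U.V_mem W.V_mem

theorem weakDeriv_P_add (U W : PhaseSpace p) :
    weakDeriv p.L (U + W).P = weakDeriv p.L U.P + weakDeriv p.L W.P :=
  weakDeriv_add U.P_mem W.P_mem

theorem weakDeriv_V_smul (r : ℂ) (U : PhaseSpace p) :
    weakDeriv p.L (r • U).V = r • weakDeriv p.L U.V :=
  weakDeriv_smul r U.V_mem

theorem weakDeriv_P_smul (r : ℂ) (U : PhaseSpace p) :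
    weakDeriv p.L (r • U).P = r • weakDeriv p.L U.P :=
  weakDeriv_smul r U.P_mem

/-- A linear map dominated by one summand of the energy is bounded, so it sends Cauchy sequences to
convergent ones. -/
theorem tendsto_of_cauchySeq_of_bound {E : Type*} [NormedAddCommGroup E] [NormedSpace ℂ E]
    [CompleteSpace E] (T : PhaseSpace p →ₗ[ℂ] E) {k : ℝ} (hk : 0 < k)
    (hT : ∀ U, k * ‖T U‖ ^ 2 ≤ ‖U‖ ^ 2) {u : ℕ → PhaseSpace p} (hu : CauchySeq u) :
    ∃ e : E, Tendsto (fun n => T (u n)) atTop (𝓝 e) := by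
  have hb : ∀ U, ‖T U‖ ≤ √k⁻¹ * ‖U‖ := by
    intro U
    refine (pow_le_pow_iff_left₀ (norm_nonneg _) (by positivity) two_ne_zero).1 ?_
    rw [mul_pow, Real.sq_sqrt (inv_nonneg.2 hk.le), inv_mul_eq_div, le_div_iff₀' hk]
    exact hT U
  exact cauchySeq_tendsto_of_complete
    (hu.map (T.mkContinuous (√k⁻¹) hb).uniformContinuous)

/-- The energy is a sum of squared `L²` norms of `f`, `g`, `φ₁`, `φ₂`, `θ`, `V_x` and `γ V_x - P_x`,
so each of these converges along a Cauchy sequence. Integrating the limits `v` and `γ v - q` from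
`0` recovers `V` and `P` with their condition at `0`. -/
instance : CompleteSpace (PhaseSpace p) := by
  have h1 := p.ρ_pos
  have h2 := p.μ_pos
  have h3 := p.α₁_pos
  have h4 := p.β_pos
  have h5 := p.c_pos
  have h6 := mul_pos p.sineFactor_pos p.l₁_pos
  have h7 := mul_pos p.sineFactor_pos p.l₂_pos
  have hn : ∀ U : PhaseSpace p, ‖U‖ ^ 2 =
      p.ρ * ‖U.f‖ ^ 2 + p.μ * ‖U.g‖ ^ 2 + p.α₁ * ‖weakDeriv p.L U.V‖ ^ 2
      + p.β * ‖(p.γ : ℂ) • weakDeriv p.L U.V - weakDeriv p.L U.P‖ ^ 2 + p.c * ‖U.θ‖ ^ 2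
      + (p.sineFactor * p.l₁) * ‖U.φ₁‖ ^ 2 + (p.sineFactor * p.l₂) * ‖U.φ₂‖ ^ 2 := fun U => by
    rw [U.norm_sq_eq]
    ring
  have n1 : ∀ U : PhaseSpace p, 0 ≤ p.ρ * ‖U.f‖ ^ 2 := fun U => by positivity
  have n2 : ∀ U : PhaseSpace p, 0 ≤ p.μ * ‖U.g‖ ^ 2 := fun U => by positivity
  have n3 : ∀ U : PhaseSpace p, 0 ≤ p.α₁ * ‖weakDeriv p.L U.V‖ ^ 2 := fun U => by positivity
  have n4 : ∀ U : PhaseSpace p,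
      0 ≤ p.β * ‖(p.γ : ℂ) • weakDeriv p.L U.V - weakDeriv p.L U.P‖ ^ 2 := fun U => by positivity
  have n5 : ∀ U : PhaseSpace p, 0 ≤ p.c * ‖U.θ‖ ^ 2 := fun U => by positivity
  have n6 : ∀ U : PhaseSpace p, 0 ≤ (p.sineFactor * p.l₁) * ‖U.φ₁‖ ^ 2 := fun U => by positivity
  have n7 : ∀ U : PhaseSpace p, 0 ≤ (p.sineFactor * p.l₂) * ‖U.φ₂‖ ^ 2 := fun U => by positivity
  let dV : PhaseSpace p →ₗ[ℂ] L2Beam p.L :=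
    { toFun := fun U => weakDeriv p.L U.V
      map_add' := weakDeriv_V_add
      map_smul' := weakDeriv_V_smul }
  let dP : PhaseSpace p →ₗ[ℂ] L2Beam p.L :=
    { toFun := fun U => weakDeriv p.L U.P
      map_add' := weakDeriv_P_add
      map_smul' := weakDeriv_P_smul }
  refine Metric.complete_of_cauchySeq_tendsto fun u hu => ?_
  obtain ⟨f, hf⟩ := tendsto_of_cauchySeq_of_bound
    { toFun := fun U => U.f, map_add' := f_add, map_smul' := f_smul } h1 (fun U => by
      change p.ρ * ‖U.f‖ ^ 2 ≤ _
      linarith [hn U, n1 U, n2 U, n3 U, n4 U, n5 U, n6 U, n7 U]) hu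
  obtain ⟨g, hg⟩ := tendsto_of_cauchySeq_of_bound
    { toFun := fun U => U.g, map_add' := g_add, map_smul' := g_smul } h2 (fun U => by
      change p.μ * ‖U.g‖ ^ 2 ≤ _
      linarith [hn U, n1 U, n2 U, n3 U, n4 U, n5 U, n6 U, n7 U]) hu
  obtain ⟨v, hv⟩ := tendsto_of_cauchySeq_of_bound dV h3 (fun U => by
      change p.α₁ * ‖weakDeriv p.L U.V‖ ^ 2 ≤ _
      linarith [hn U, n1 U, n2 U, n3 U, n4 U, n5 U, n6 U, n7 U]) hu
  obtain ⟨q, hq⟩ := tendsto_of_cauchySeq_of_bound ((p.γ : ℂ) • dV - dP) h4 (fun U => by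
      change p.β * ‖(p.γ : ℂ) • weakDeriv p.L U.V - weakDeriv p.L U.P‖ ^ 2 ≤ _
      linarith [hn U, n1 U, n2 U, n3 U, n4 U, n5 U, n6 U, n7 U]) hu
  obtain ⟨θ, hθ⟩ := tendsto_of_cauchySeq_of_bound
    { toFun := fun U => U.θ, map_add' := θ_add, map_smul' := θ_smul } h5 (fun U => by
      change p.c * ‖U.θ‖ ^ 2 ≤ _
      linarith [hn U, n1 U, n2 U, n3 U, n4 U, n5 U, n6 U, n7 U]) hu
  obtain ⟨φ₁, hφ₁⟩ := tendsto_of_cauchySeq_of_bound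
    { toFun := fun U => U.φ₁, map_add' := φ₁_add, map_smul' := φ₁_smul } h6 (fun U => by
      change (p.sineFactor * p.l₁) * ‖U.φ₁‖ ^ 2 ≤ _
      linarith [hn U, n1 U, n2 U, n3 U, n4 U, n5 U, n6 U, n7 U]) hu
  obtain ⟨φ₂, hφ₂⟩ := tendsto_of_cauchySeq_of_bound
    { toFun := fun U => U.φ₂, map_add' := φ₂_add, map_smul' := φ₂_smul } h7 (fun U => by
      change (p.sineFactor * p.l₂) * ‖U.φ₂‖ ^ 2 ≤ _
      linarith [hn U, n1 U, n2 U, n3 U, n4 U, n5 U, n6 U, n7 U]) hu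
  let W : PhaseSpace p := ⟨primitive p v, f, φ₁, primitive p ((p.γ : ℂ) • v - q), g, φ₂, θ,
    primitive_mem_H1star _, primitive_mem_H1star _⟩
  refine ⟨W, ?_⟩
  have hWV : weakDeriv p.L W.V = v := weakDeriv_primitive _
  have hWP : weakDeriv p.L W.P = (p.γ : ℂ) • v - q := weakDeriv_primitive _
  have key : ∀ {E : Type} [NormedAddCommGroup E] [NormedSpace ℂ E] {x : ℕ → E} {e : E} (k : ℝ),
      Tendsto x atTop (𝓝 e) → Tendsto (fun n => k * ‖x n + (-1 : ℂ) • e‖ ^ 2) atTop (𝓝 0) := by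
    intro E _ _ x e k h
    have := (((h.add_const ((-1 : ℂ) • e)).norm.pow 2).const_mul k)
    simpa using this
  -- The components are known to respect sums and scalar multiples, whence this form of the
  -- difference.
  have hsub : ∀ n, u n - W = u n + (-1 : ℂ) • W := fun n => by module
  have hlim := ((((((key p.ρ hf).add (key p.μ hg)).add (key p.α₁ hv)).add (key p.β hq)).add
    (key p.c hθ)).add (key (p.sineFactor * p.l₁) hφ₁)).add (key (p.sineFactor * p.l₂) hφ₂)
  have h0 : Tendsto (fun n => ‖u n - W‖ ^ 2) atTop (𝓝 0) := by
    simp only [add_zero] at hlim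
    refine hlim.congr fun n => ?_
    rw [hsub, hn]
    have eq1 : (p.γ : ℂ) • weakDeriv p.L (u n + (-1 : ℂ) • W).V
        - weakDeriv p.L (u n + (-1 : ℂ) • W).P
        = ((p.γ : ℂ) • dV - dP) (u n) + (-1 : ℂ) • q := by
      rw [weakDeriv_V_add, weakDeriv_P_add, weakDeriv_V_smul, weakDeriv_P_smul, hWV, hWP]
      change _ = (p.γ : ℂ) • weakDeriv p.L (u n).V - weakDeriv p.L (u n).P + (-1 : ℂ) • q
      module
    rw [eq1, weakDeriv_V_add, weakDeriv_V_smul, hWV]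
    simp only [f_add, g_add, θ_add, φ₁_add, φ₂_add, f_smul, g_smul, θ_smul, φ₁_smul, φ₂_smul]
    rfl
  rw [tendsto_iff_norm_sub_tendsto_zero]
  have := h0.sqrt
  simpa using this

end PiezoBeam

namespace PiezoBeam

open PhaseSpace BeamParameters

variable {p : BeamParameters}

/-! ### Dissipativity -/

theorem weakDeriv_sub {L : ℝ} {v w : L2Beam L} (hv : v ∈ H1 L) (hw : w ∈ H1 L) :
    weakDeriv L (v - w) = weakDeriv L v - weakDeriv L w := by
  have h : v - w = v + (-1 : ℂ) • w := by module
  rw [h, weakDeriv_add hv (Submodule.smul_mem _ _ hw), weakDeriv_smul _ hw]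
  module

theorem pointValue_sub {L : ℝ} (hL : 0 < L) {v w : L2Beam L} (hv : v ∈ H1 L) (hw : w ∈ H1 L)
    {x : ℝ} (hx : x ∈ Icc 0 L) :
    pointValue L (v - w) x = pointValue L v x - pointValue L w x := by
  have h : v - w = v + (-1 : ℂ) • w := by module
  rw [h, pointValue_add hL hv (Submodule.smul_mem _ _ hw) hx, pointValue_smul hL _ hw hx]
  ring

/-- The diffusive equation dissipates energy up to the power supplied by its input. -/
theorem re_inner_diffusive_le {φ : L2Line} {z : ℂ}
    (hφ : MemLp (fun ξ => ((|ξ| : ℝ) : ℂ) * φ ξ) 2 volume)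
    (h : MemLp (p.diffusive φ z) 2 volume) :
    p.sineFactor * (inner ℂ (h.toLp _) φ).re ≤ ((starRingEnd ℂ) z * p.output φ).re := by
  have hk := p.integrable_kernel_mul φ hφ
  have h1 : (inner ℂ (h.toLp _) φ).re = ∫ ξ, ((inner ℂ (h.toLp _ ξ) (φ ξ) : ℂ)).re := by
    rw [L2.inner_def]
    exact (integral_re (L2.integrable_inner (𝕜 := ℂ) (h.toLp _) φ)).symm
  have h2 : ((starRingEnd ℂ) z * ∫ ξ, (p.kernel ξ : ℂ) * φ ξ).re
      = ∫ ξ, ((starRingEnd ℂ) z * ((p.kernel ξ : ℂ) * φ ξ)).re := by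
    rw [← integral_const_mul]
    exact (integral_re (hk.const_mul _)).symm
  have h3 : (inner ℂ (h.toLp _) φ).re
      ≤ ((starRingEnd ℂ) z * ∫ ξ, (p.kernel ξ : ℂ) * φ ξ).re := by
    rw [h1, h2]
    refine integral_mono_ae (L2.integrable_inner (𝕜 := ℂ) (h.toLp _) φ).re
      (hk.const_mul _).re ?_
    filter_upwards [h.coeFn_toLp] with ξ hξ
    rw [hξ, RCLike.inner_apply, diffusive]
    -- Pointwise, the damping contributes `-(ξ² + η) |φ|² ≤ 0` and the rest is the power of the
    -- input.
    have e : φ ξ * (starRingEnd ℂ) (-((ξ : ℂ) ^ 2 + p.η) * φ ξ + z * p.kernel ξ)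
        = ((-(ξ ^ 2 + p.η) * Complex.normSq (φ ξ) : ℝ) : ℂ)
          + (starRingEnd ℂ) z * ((p.kernel ξ : ℂ) * φ ξ) := by
      simp only [map_add, map_mul, map_neg, map_pow, Complex.conj_ofReal]
      push_cast
      rw [← Complex.mul_conj]
      ring
    rw [e, Complex.add_re, Complex.ofReal_re]
    have := mul_nonneg (add_nonneg (sq_nonneg ξ) p.η_pos.le) (Complex.normSq_nonneg (φ ξ))
    linarith
  have h4 : ((starRingEnd ℂ) z * p.output φ).re
      = p.sineFactor * ((starRingEnd ℂ) z * ∫ ξ, (p.kernel ξ : ℂ) * φ ξ).re := by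
    rw [output, mul_left_comm, Complex.re_ofReal_mul]
  rw [h4]
  exact mul_le_mul_of_nonneg_left h3 p.sineFactor_pos.le

/-- The terms are grouped by the stresses `α V_x - γβ P_x` and `β P_x - γβ V_x`, which arise from
the potential energy because `α = α₁ + γ² β`. The first three brackets are then of the form treated
by `inner_weakDeriv_add`. -/
theorem energyInner_applyA₁ {U : PhaseSpace p} (hU : InDomain U) :
    energyInner U (applyA₁ U hU)
      = (inner ℂ (weakDeriv p.L ((p.α : ℂ) • weakDeriv p.L U.V
            - ((p.γ * p.β : ℝ) : ℂ) • weakDeriv p.L U.P)) U.f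
          + inner ℂ (weakDeriv p.L U.f) ((p.α : ℂ) • weakDeriv p.L U.V
            - ((p.γ * p.β : ℝ) : ℂ) • weakDeriv p.L U.P))
        + (inner ℂ (weakDeriv p.L ((p.β : ℂ) • weakDeriv p.L U.P
            - ((p.γ * p.β : ℝ) : ℂ) • weakDeriv p.L U.V)) U.g
          + inner ℂ (weakDeriv p.L U.g) ((p.β : ℂ) • weakDeriv p.L U.P
            - ((p.γ * p.β : ℝ) : ℂ) • weakDeriv p.L U.V))
        - p.δ * (inner ℂ (weakDeriv p.L U.θ) U.f + inner ℂ (weakDeriv p.L U.f) U.θ)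
        + p.κ * inner ℂ (weakDeriv p.L (weakDeriv p.L U.θ)) U.θ
        + (p.l₁ * (p.sineFactor * inner ℂ (hU.φ₁_mem.toLp _) U.φ₁)
          + p.l₂ * (p.sineFactor * inner ℂ (hU.φ₂_mem.toLp _) U.φ₂)) := by
  have h1 : (p.ρ : ℂ) ≠ 0 := Complex.ofReal_ne_zero.2 p.ρ_pos.ne'
  have h2 : (p.μ : ℂ) ≠ 0 := Complex.ofReal_ne_zero.2 p.μ_pos.ne'
  have h3 : (p.c : ℂ) ≠ 0 := Complex.ofReal_ne_zero.2 p.c_pos.ne'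
  rw [weakDeriv_sub (Submodule.smul_mem _ _ hU.V_mem.2) (Submodule.smul_mem _ _ hU.P_mem.2),
    weakDeriv_sub (Submodule.smul_mem _ _ hU.P_mem.2) (Submodule.smul_mem _ _ hU.V_mem.2),
    weakDeriv_smul _ hU.V_mem.2, weakDeriv_smul _ hU.P_mem.2, weakDeriv_smul _ hU.V_mem.2,
    weakDeriv_smul _ hU.P_mem.2]
  simp only [energyInner, applyA₁, α, inner_add_left, inner_sub_left, inner_smul_left,
    inner_sub_right, inner_smul_right, inner_neg_left, neg_smul, Complex.conj_ofReal]
  push_cast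
  field_simp
  ring

theorem re_conj_mul_comm (z w : ℂ) : ((starRingEnd ℂ) z * w).re = ((starRingEnd ℂ) w * z).re := by
  simp only [Complex.mul_re, Complex.conj_re, Complex.conj_im]
  ring

theorem re_inner_comm {E : Type*} [NormedAddCommGroup E] [InnerProductSpace ℂ E] (x y : E) :
    (inner ℂ x y).re = (inner ℂ y x).re := by
  rw [← inner_conj_symm, Complex.conj_re]

/-- After integration by parts the terms at `0` vanish through `f`, `g` and `θ_x`, and the thermal
ones at `L` through `θ`. The stresses at `L` equal minus the gains times the outputs, so their power
cancels the bound of `re_inner_diffusive_le`, and `-κ ‖θ_x‖²` remains. -/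
theorem re_inner_applyA₁_nonpos {U : PhaseSpace p} (hU : InDomain U) :
    (inner ℂ (applyA₁ U hU) U).re ≤ 0 := by
  rw [inner_eq_energyInner, energyInner_applyA₁ hU]
  set S₁ := (p.α : ℂ) • weakDeriv p.L U.V - ((p.γ * p.β : ℝ) : ℂ) • weakDeriv p.L U.P with hS₁
  set S₂ := (p.β : ℂ) • weakDeriv p.L U.P - ((p.γ * p.β : ℝ) : ℂ) • weakDeriv p.L U.V with hS₂
  have m1 : S₁ ∈ H1 p.L :=
    sub_mem (Submodule.smul_mem _ _ hU.V_mem.2) (Submodule.smul_mem _ _ hU.P_mem.2)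
  have m2 : S₂ ∈ H1 p.L :=
    sub_mem (Submodule.smul_mem _ _ hU.P_mem.2) (Submodule.smul_mem _ _ hU.V_mem.2)
  have b1 : pointValue p.L S₁ p.L = -p.l₁ * p.output U.φ₁ := by
    rw [← hU.V_boundary, hS₁, pointValue_sub p.L_pos (Submodule.smul_mem _ _ hU.V_mem.2)
      (Submodule.smul_mem _ _ hU.P_mem.2) p.L_mem, pointValue_smul p.L_pos _ hU.V_mem.2 p.L_mem,
      pointValue_smul p.L_pos _ hU.P_mem.2 p.L_mem, Complex.ofReal_mul]
  have b2 : pointValue p.L S₂ p.L = -p.l₂ * p.output U.φ₂ := by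
    rw [← hU.P_boundary, hS₂, pointValue_sub p.L_pos (Submodule.smul_mem _ _ hU.P_mem.2)
      (Submodule.smul_mem _ _ hU.V_mem.2) p.L_mem, pointValue_smul p.L_pos _ hU.V_mem.2 p.L_mem,
      pointValue_smul p.L_pos _ hU.P_mem.2 p.L_mem, Complex.ofReal_mul]
  have i1 := congrArg Complex.re (inner_weakDeriv_add m1 hU.f_mem.1)
  have i2 := congrArg Complex.re (inner_weakDeriv_add m2 hU.g_mem.1)
  have i3 := congrArg Complex.re (inner_weakDeriv_add hU.θ_mem.1 hU.f_mem.1)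
  have i4 := congrArg Complex.re (inner_weakDeriv_add hU.θ_mem.2 hU.θ_mem.1)
  rw [hU.f_mem.2, mul_zero, sub_zero, b1] at i1
  rw [hU.g_mem.2, mul_zero, sub_zero, b2] at i2
  rw [hU.f_mem.2, hU.θ_right, mul_zero, map_zero, zero_mul, sub_zero] at i3
  rw [hU.θ_right, hU.θ_deriv_left, mul_zero, map_zero, zero_mul, sub_zero] at i4
  have d1 := mul_le_mul_of_nonneg_left (re_inner_diffusive_le hU.φ₁_weight hU.φ₁_mem) p.l₁_pos.le
  have d2 := mul_le_mul_of_nonneg_left (re_inner_diffusive_le hU.φ₂_weight hU.φ₂_mem) p.l₂_pos.le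
  have c1 : ∀ (l : ℝ) (z w : ℂ), ((starRingEnd ℂ) (-(l : ℂ) * z) * w).re
      = -(l * ((starRingEnd ℂ) w * z).re) := by
    intro l z w
    rw [re_conj_mul_comm w z, map_mul, map_neg, Complex.conj_ofReal, mul_assoc, neg_mul,
      Complex.neg_re, Complex.re_ofReal_mul]
  rw [c1] at i1 i2
  simp only [Complex.add_re, Complex.sub_re, Complex.re_ofReal_mul, Complex.zero_re]
    at i1 i2 i3 i4 ⊢
  rw [re_inner_comm (weakDeriv p.L U.f) S₁, re_inner_comm (weakDeriv p.L U.g) S₂,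
    re_inner_comm (weakDeriv p.L U.f) U.θ, i1, i2, i3]
  have i5 : 0 ≤ (inner ℂ (weakDeriv p.L U.θ) (weakDeriv p.L U.θ)).re :=
    inner_self_nonneg (𝕜 := ℂ)
  have i6 : p.κ * (inner ℂ (weakDeriv p.L (weakDeriv p.L U.θ)) U.θ).re ≤ 0 :=
    mul_nonpos_of_nonneg_of_nonpos p.κ_pos.le (by linarith)
  linarith

end PiezoBeam

namespace PiezoBeam

open PhaseSpace BeamParameters

/-! ### Coercive operators -/

/-- The Lax-Milgram lemma for operators in a complex Hilbert space. -/
theorem surjective_of_coercive {X : Type*} [NormedAddCommGroup X] [InnerProductSpace ℂ X]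
    [CompleteSpace X] (T : X →L[ℂ] X) {k : ℝ} (hk : 0 < k)
    (hT : ∀ x, k * ‖x‖ ^ 2 ≤ (inner ℂ (T x) x).re) : Function.Surjective T := by
  have hb : ∀ x, k * ‖x‖ ≤ ‖T x‖ := by
    intro x
    rcases (norm_nonneg x).eq_or_lt with h | h
    · rw [← h, mul_zero]
      exact norm_nonneg _
    · have h1 : (inner ℂ (T x) x).re ≤ ‖T x‖ * ‖x‖ := re_inner_le_norm (𝕜 := ℂ) _ _
      have h2 := hT x
      exact le_of_mul_le_mul_right (by nlinarith) h
  have ha : AntilipschitzWith (Real.toNNReal k⁻¹) T := by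
    refine T.antilipschitz_of_bound fun x => ?_
    rw [Real.coe_toNNReal _ (inv_nonneg.2 hk.le), inv_mul_eq_div, le_div_iff₀' hk]
    exact hb x
  -- The range is closed since `T` is bounded below, and a vector `x` orthogonal to it satisfies `k
  -- ‖x‖² ≤ Re ⟪T x, x⟫ = 0`.
  have hcl : IsClosed (T.range : Set X) := ha.isClosed_range T.uniformContinuous
  have := hcl.completeSpace_coe
  have htop : T.range = ⊤ := by
    rw [← T.range.orthogonal_orthogonal, Submodule.orthogonal_eq_top_iff, Submodule.eq_bot_iff]
    intro x hx
    have h0 : inner ℂ (T x) x = 0 := hx _ ⟨x, rfl⟩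
    have h1 := hT x
    rw [h0, Complex.zero_re] at h1
    have h2 : ‖x‖ ^ 2 ≤ 0 := by
      by_contra h
      nlinarith [mul_pos hk (not_le.1 h)]
    exact norm_eq_zero.1 (pow_eq_zero_iff two_ne_zero |>.1 (le_antisymm h2 (sq_nonneg _)))
  exact LinearMap.range_eq_top.1 htop

/-! ### The diffusive equation -/

variable {p : BeamParameters}

theorem one_add_sq_add_pos (p : BeamParameters) (ξ : ℝ) : 0 < 1 + ξ ^ 2 + p.η := by
  have := p.η_pos
  positivity

theorem memLp_ofReal_mul {r : ℝ → ℝ} (hr : Measurable r) {C : ℝ} (hC : ∀ ξ, |r ξ| ≤ C)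
    {F : ℝ → ℂ} (hF : MemLp F 2 volume) : MemLp (fun ξ => (r ξ : ℂ) * F ξ) 2 volume := by
  refine MemLp.of_le_mul (c := C) hF
    ((Complex.measurable_ofReal.comp hr).aestronglyMeasurable.mul hF.1) ?_
  refine Eventually.of_forall fun ξ => ?_
  rw [norm_mul, Complex.norm_real, Real.norm_eq_abs]
  exact mul_le_mul_of_nonneg_right (hC ξ) (norm_nonneg _)

/-- The quotients `(1 + |ξ|) / (1 + ξ² + η)` and `|ξ| (1 + |ξ|) / (1 + ξ² + η)` are at most `2`. The
weak hypothesis on `F` admits both square integrable data and the kernel divided by `1 + |ξ|` from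
`memLp_kernel_div`. -/
theorem memLp_div_of_memLp_div {F : ℝ → ℂ}
    (hF : MemLp (fun ξ => ((1 / (1 + |ξ|) : ℝ) : ℂ) * F ξ) 2 volume) :
    MemLp (fun ξ => ((1 / (1 + ξ ^ 2 + p.η) : ℝ) : ℂ) * F ξ) 2 volume ∧
    MemLp (fun ξ => ((|ξ| : ℝ) : ℂ) * (((1 / (1 + ξ ^ 2 + p.η) : ℝ) : ℂ) * F ξ)) 2 volume := by
  have hp := one_add_sq_add_pos p
  have hη := p.η_pos
  have hne : ∀ ξ : ℝ, (1 + |ξ| : ℝ) ≠ 0 := fun ξ => by positivity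
  constructor
  · refine (memLp_ofReal_mul (r := fun ξ => (1 + |ξ|) / (1 + ξ ^ 2 + p.η)) (C := 2)
      (by fun_prop) (fun ξ => ?_) hF).ae_eq (Eventually.of_forall fun ξ => ?_)
    · rw [abs_of_nonneg (div_nonneg (by positivity) (hp ξ).le), div_le_iff₀ (hp ξ)]
      nlinarith [sq_nonneg (|ξ| - 1), sq_abs ξ]
    · simp only
      rw [← mul_assoc, ← Complex.ofReal_mul]
      congr 2
      have := hne ξ
      field_simp
  · refine (memLp_ofReal_mul (r := fun ξ => |ξ| * (1 + |ξ|) / (1 + ξ ^ 2 + p.η)) (C := 2)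
      (by fun_prop) (fun ξ => ?_) hF).ae_eq (Eventually.of_forall fun ξ => ?_)
    · rw [abs_of_nonneg (div_nonneg (by positivity) (hp ξ).le), div_le_iff₀ (hp ξ)]
      nlinarith [sq_nonneg (|ξ| - 1), sq_abs ξ]
    · simp only
      rw [← mul_assoc, ← Complex.ofReal_mul, ← mul_assoc, ← Complex.ofReal_mul]
      congr 2
      have := hne ξ
      field_simp

/-- The resolvent equation of the diffusive variable: the solution and its output depend on the
input `z` in an affine way, with a passive gain. -/
theorem exists_diffusive_resolvent (F : L2Line) : ∃ (b : ℂ) (K : ℝ), 0 ≤ K ∧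
    ∀ z : ℂ, ∃ φ : L2Line, MemLp (fun ξ => ((|ξ| : ℝ) : ℂ) * φ ξ) 2 volume ∧
      p.output φ = b + K * z ∧
      ∃ h : MemLp (p.diffusive φ z) 2 volume, φ - h.toLp _ = F := by
  have hp := one_add_sq_add_pos p
  obtain ⟨hk1, hk2⟩ := memLp_div_of_memLp_div (p := p) (F := fun ξ => (p.kernel ξ : ℂ)) (by
    refine (p.memLp_kernel_div.ofReal (K := ℂ)).ae_eq (Eventually.of_forall fun ξ => ?_)
    simp only
    rw [← Complex.ofReal_mul]
    change ((p.kernel ξ / (1 + |ξ|) : ℝ) : ℂ) = _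
    congr 1
    ring)
  obtain ⟨hF1, hF2⟩ := memLp_div_of_memLp_div (p := p) (F := F) (by
    refine memLp_ofReal_mul (by fun_prop) (C := 1) (fun ξ => ?_) (Lp.memLp F)
    rw [abs_of_nonneg (by positivity), div_le_one (by positivity)]
    linarith [abs_nonneg ξ])
  -- The equation `(1 + ξ² + η) φ = F + z μ(ξ)` is solved by division, so `φ = φF + z φk`.
  set φk : L2Line := hk1.toLp _ with hφk
  set φF : L2Line := hF1.toLp _ with hφF
  have ek : φk =ᵐ[volume] _ := hk1.coeFn_toLp
  have eF : φF =ᵐ[volume] _ := hF1.coeFn_toLp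
  have wk : MemLp (fun ξ => ((|ξ| : ℝ) : ℂ) * φk ξ) 2 volume := by
    refine hk2.ae_eq ?_
    filter_upwards [ek] with ξ h
    rw [h]
  have wF : MemLp (fun ξ => ((|ξ| : ℝ) : ℂ) * φF ξ) 2 volume := by
    refine hF2.ae_eq ?_
    filter_upwards [eF] with ξ h
    rw [h]
  -- The gain `K` is `sin(aπ)/π` times the integral of `μ(ξ)² / (1 + ξ² + η)`, hence real and
  -- nonnegative.
  have hout : p.output φk
      = ((p.sineFactor * ∫ ξ, p.kernel ξ * (1 / (1 + ξ ^ 2 + p.η) * p.kernel ξ) : ℝ) : ℂ) := by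
    rw [output, Complex.ofReal_mul, ← integral_complex_ofReal]
    congr 1
    refine integral_congr_ae ?_
    filter_upwards [ek] with ξ h
    rw [h]
    push_cast
    rfl
  refine ⟨p.output φF, p.sineFactor * ∫ ξ, p.kernel ξ * (1 / (1 + ξ ^ 2 + p.η) * p.kernel ξ),
    mul_nonneg p.sineFactor_pos.le (integral_nonneg fun ξ => ?_), fun z => ?_⟩
  · exact mul_nonneg (Real.rpow_nonneg (abs_nonneg _) _)
      (mul_nonneg (one_div_pos.2 (hp ξ)).le (Real.rpow_nonneg (abs_nonneg _) _))
  have wzk : MemLp (fun ξ => ((|ξ| : ℝ) : ℂ) * (z • φk : L2Line) ξ) 2 volume :=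
    (wk.const_mul z).ae_eq (weight_smul _ _).symm
  have hd : p.diffusive (φF + z • φk) z =ᵐ[volume] ((φF + z • φk - F : L2Line) : ℝ → ℂ) := by
    filter_upwards [Lp.coeFn_add φF (z • φk), Lp.coeFn_smul z φk, Lp.coeFn_sub (φF + z • φk) F,
      ek, eF] with ξ h1 h2 h3 h4 h5
    rw [diffusive, h3, Pi.sub_apply, h1, Pi.add_apply, h2, Pi.smul_apply, h4, h5, smul_eq_mul]
    have hne : (1 + (ξ : ℂ) ^ 2 + p.η) ≠ 0 := by exact_mod_cast (hp ξ).ne'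
    push_cast
    field_simp
    ring
  refine ⟨φF + z • φk, (wF.add wzk).ae_eq (weight_add _ _).symm, ?_,
    (Lp.memLp (φF + z • φk - F)).ae_eq hd.symm, ?_⟩
  · rw [output_add wF wzk, output_smul, hout, mul_comm]
  · have : MemLp.toLp (p.diffusive (φF + z • φk) z)
        ((Lp.memLp (φF + z • φk - F)).ae_eq hd.symm) = φF + z • φk - F := by
      rw [MemLp.toLp_congr _ (Lp.memLp (φF + z • φk - F)) hd, Lp.toLp_coeFn]
    rw [this, sub_sub_cancel]

/-! ### The adjoint of the primitive -/

-- The adjoint is integration from `x` to `L`. It parametrizes the functions that vanish at `L`, as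
-- the primitive does for those that vanish at `0`.
open ContinuousLinearMap in
theorem adjoint_primitive_apply (w : L2Beam p.L) :
    adjoint (primitive p) w = inner ℂ (oneL2 p.L) w • oneL2 p.L - primitive p w := by
  refine ext_inner_right ℂ fun u => ?_
  rw [adjoint_inner_left, inner_sub_left, inner_smul_left, inner_conj_symm]
  linear_combination inner_primitive_add w u

open ContinuousLinearMap in
theorem adjoint_primitive_mem_H1 (w : L2Beam p.L) : adjoint (primitive p) w ∈ H1 p.L := by
  rw [adjoint_primitive_apply]
  exact sub_mem (Submodule.smul_mem _ _ oneL2_mem_H1) (primitive_mem_H1 w)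

open ContinuousLinearMap in
theorem weakDeriv_adjoint_primitive (w : L2Beam p.L) :
    weakDeriv p.L (adjoint (primitive p) w) = -w := by
  rw [adjoint_primitive_apply, weakDeriv_sub (Submodule.smul_mem _ _ oneL2_mem_H1)
    (primitive_mem_H1 w), weakDeriv_smul _ oneL2_mem_H1, weakDeriv_oneL2, weakDeriv_primitive,
    smul_zero, zero_sub]

open ContinuousLinearMap in
theorem pointValue_adjoint_primitive_right (w : L2Beam p.L) :
    pointValue p.L (adjoint (primitive p) w) p.L = 0 := by
  rw [adjoint_primitive_apply, pointValue_sub p.L_pos (Submodule.smul_mem _ _ oneL2_mem_H1)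
    (primitive_mem_H1 w) p.L_mem, pointValue_smul p.L_pos _ oneL2_mem_H1 p.L_mem,
    pointValue_oneL2 p.L_mem, pointValue_primitive_right, mul_one, sub_self]

/-! ### The resolvent equation -/

-- The mechanical part of the form is `α₁ ‖u‖² + β ‖γ u - w‖²` and the thermal part `κ ‖q‖²`. The
-- two `δ` terms are skew and cancel in the real part; the feedback terms and those with the
-- primitive are squares with nonnegative coefficients.
open ContinuousLinearMap in
theorem exists_coercive_bound (p : BeamParameters) {K₁ K₂ : ℝ} (hK₁ : 0 ≤ K₁) (hK₂ : 0 ≤ K₂) :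
    ∃ k : ℝ, 0 < k ∧ ∀ u w q : L2Beam p.L, k * (‖u‖ ^ 2 + ‖w‖ ^ 2 + ‖q‖ ^ 2) ≤
      (inner ℂ ((p.α : ℂ) • u - ((p.γ * p.β : ℝ) : ℂ) • w
          + ((p.l₁ * K₁ : ℝ) : ℂ) • inner ℂ (oneL2 p.L) u • oneL2 p.L
          + (p.ρ : ℂ) • adjoint (primitive p) (primitive p u)
          - (p.δ : ℂ) • adjoint (primitive p) q) u
        + inner ℂ ((p.β : ℂ) • w - ((p.γ * p.β : ℝ) : ℂ) • u
          + ((p.l₂ * K₂ : ℝ) : ℂ) • inner ℂ (oneL2 p.L) w • oneL2 p.L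
          + (p.μ : ℂ) • adjoint (primitive p) (primitive p w)) w
        + inner ℂ ((p.κ : ℂ) • q + (p.c : ℂ) • primitive p (adjoint (primitive p) q)
          + (p.δ : ℂ) • primitive p u) q).re := by
  have hα₁ := p.α₁_pos
  have hβ := p.β_pos
  have hκ := p.κ_pos
  have hg : 0 < 1 + 2 * p.γ ^ 2 := by positivity
  -- From `‖w‖² ≤ 2γ² ‖u‖² + 2 ‖γ u - w‖²`, the sum `k (‖u‖² + ‖w‖²)` is at most `k (1 + 2γ²) ‖u‖² +
  -- 2k ‖γ u - w‖²`; this dictates the first two entries.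
  let k := min (p.α₁ / (1 + 2 * p.γ ^ 2)) (min (p.β / 2) p.κ)
  have hk : 0 < k := lt_min (by positivity) (lt_min (by positivity) hκ)
  have k1 : k * (1 + 2 * p.γ ^ 2) ≤ p.α₁ := (le_div_iff₀ hg).1 (min_le_left _ _)
  have k2 : k ≤ p.β / 2 := (min_le_right _ _).trans (min_le_left _ _)
  have k3 : k ≤ p.κ := (min_le_right _ _).trans (min_le_right _ _)
  refine ⟨k, hk, fun u w q => ?_⟩
  have hself : ∀ v : L2Beam p.L, (inner ℂ v v).re = ‖v‖ ^ 2 := fun v =>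
    inner_self_eq_norm_sq (𝕜 := ℂ) v
  have hone : ∀ v : L2Beam p.L,
      ((starRingEnd ℂ) (inner ℂ (oneL2 p.L) v) * inner ℂ (oneL2 p.L) v).re
        = ‖inner ℂ (oneL2 p.L) v‖ ^ 2 := fun v => by
    rw [← Complex.normSq_eq_conj_mul_self, Complex.ofReal_re, Complex.normSq_eq_norm_sq]
  have s1 : (inner ℂ w u).re = (inner ℂ u w).re := re_inner_comm _ _
  have s2 : (inner ℂ q (primitive p u)).re = (inner ℂ (primitive p u) q).re := re_inner_comm _ _
  have hJ : (inner ℂ (primitive p (adjoint (primitive p) q)) q).re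
      = ‖adjoint (primitive p) q‖ ^ 2 := by
    rw [← hself, ← adjoint_inner_right (primitive p)]
  have hd : ‖(p.γ : ℂ) • u - w‖ ^ 2
      = p.γ ^ 2 * ‖u‖ ^ 2 - 2 * p.γ * (inner ℂ u w).re + ‖w‖ ^ 2 := by
    rw [← hself]
    simp only [inner_sub_left, inner_sub_right, inner_smul_left, inner_smul_right,
      Complex.conj_ofReal, Complex.sub_re, Complex.re_ofReal_mul, s1, hself]
    ring
  have hxy : ‖w‖ ^ 2 ≤ 2 * p.γ ^ 2 * ‖u‖ ^ 2 + 2 * ‖(p.γ : ℂ) • u - w‖ ^ 2 := by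
    have h1 : ‖w‖ ≤ ‖(p.γ : ℂ) • u‖ + ‖(p.γ : ℂ) • u - w‖ := norm_le_insert _ _
    have h2 : ‖(p.γ : ℂ) • u‖ ^ 2 = p.γ ^ 2 * ‖u‖ ^ 2 := by
      rw [norm_smul, Complex.norm_real, mul_pow, Real.norm_eq_abs, sq_abs]
    have h3 := pow_le_pow_left₀ (norm_nonneg _) h1 2
    nlinarith [sq_nonneg (‖(p.γ : ℂ) • u‖ - ‖(p.γ : ℂ) • u - w‖)]
  have z1 : 0 ≤ p.l₁ * K₁ * ‖inner ℂ (oneL2 p.L) u‖ ^ 2 :=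
    mul_nonneg (mul_nonneg p.l₁_pos.le hK₁) (sq_nonneg _)
  have z2 : 0 ≤ p.l₂ * K₂ * ‖inner ℂ (oneL2 p.L) w‖ ^ 2 :=
    mul_nonneg (mul_nonneg p.l₂_pos.le hK₂) (sq_nonneg _)
  have z3 : 0 ≤ p.ρ * ‖primitive p u‖ ^ 2 := mul_nonneg p.ρ_pos.le (sq_nonneg _)
  have z4 : 0 ≤ p.μ * ‖primitive p w‖ ^ 2 := mul_nonneg p.μ_pos.le (sq_nonneg _)
  have z5 : 0 ≤ p.c * ‖adjoint (primitive p) q‖ ^ 2 := mul_nonneg p.c_pos.le (sq_nonneg _)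
  have y1 := mul_le_mul_of_nonneg_right k1 (sq_nonneg ‖u‖)
  have y2 := mul_le_mul_of_nonneg_right k2 (sq_nonneg ‖(p.γ : ℂ) • u - w‖)
  have y3 := mul_le_mul_of_nonneg_right k3 (sq_nonneg ‖q‖)
  have y4 := mul_le_mul_of_nonneg_left hxy hk.le
  rw [hd] at y2 y4
  simp only [inner_add_left, inner_sub_left, inner_smul_left, Complex.conj_ofReal,
    Complex.add_re, Complex.sub_re, Complex.re_ofReal_mul, adjoint_inner_left, hself, s1, s2,
    hone, hJ, α]
  linarith

open ContinuousLinearMap in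
/-- The resolvent equation in terms of the derivatives `u`, `w`, `q` of the velocities and of
`-θ`. -/
theorem exists_derivatives (p : BeamParameters) {K₁ K₂ : ℝ} (hK₁ : 0 ≤ K₁) (hK₂ : 0 ≤ K₂)
    (b₁ b₂ b₃ : L2Beam p.L) : ∃ u w q : L2Beam p.L,
    (p.α : ℂ) • u - ((p.γ * p.β : ℝ) : ℂ) • w
      + ((p.l₁ * K₁ : ℝ) : ℂ) • inner ℂ (oneL2 p.L) u • oneL2 p.L
      + (p.ρ : ℂ) • adjoint (primitive p) (primitive p u)
      - (p.δ : ℂ) • adjoint (primitive p) q = b₁ ∧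
    (p.β : ℂ) • w - ((p.γ * p.β : ℝ) : ℂ) • u
      + ((p.l₂ * K₂ : ℝ) : ℂ) • inner ℂ (oneL2 p.L) w • oneL2 p.L
      + (p.μ : ℂ) • adjoint (primitive p) (primitive p w) = b₂ ∧
    (p.κ : ℂ) • q + (p.c : ℂ) • primitive p (adjoint (primitive p) q)
      + (p.δ : ℂ) • primitive p u = b₃ := by
  let J := primitive p
  let Q : L2Beam p.L →L[ℂ] L2Beam p.L := (innerSL ℂ (oneL2 p.L)).smulRight (oneL2 p.L)
  let E := fun _ : Fin 3 => L2Beam p.L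
  let e := PiLp.continuousLinearEquiv 2 ℂ E
  let π := fun i : Fin 3 => (proj i : (∀ i, E i) →L[ℂ] E i)
  let T₀ : (Fin 3 → L2Beam p.L) →L[ℂ] (Fin 3 → L2Beam p.L) := ContinuousLinearMap.pi
    ![(p.α : ℂ) • π 0 - ((p.γ * p.β : ℝ) : ℂ) • π 1 + ((p.l₁ * K₁ : ℝ) : ℂ) • Q.comp (π 0)
        + (p.ρ : ℂ) • (adjoint J).comp (J.comp (π 0)) - (p.δ : ℂ) • (adjoint J).comp (π 2),
      (p.β : ℂ) • π 1 - ((p.γ * p.β : ℝ) : ℂ) • π 0 + ((p.l₂ * K₂ : ℝ) : ℂ) • Q.comp (π 1)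
        + (p.μ : ℂ) • (adjoint J).comp (J.comp (π 1)),
      (p.κ : ℂ) • π 2 + (p.c : ℂ) • J.comp ((adjoint J).comp (π 2)) + (p.δ : ℂ) • J.comp (π 0)]
  -- The matrix is assembled on the plain product and transported to the `ℓ²` product, whose Hilbert
  -- structure Lax-Milgram needs.
  let T : PiLp 2 E →L[ℂ] PiLp 2 E :=
    (e.symm : _ →L[ℂ] PiLp 2 E).comp (T₀.comp (e : PiLp 2 E →L[ℂ] _))
  have t0 : ∀ x : PiLp 2 E, T x 0 = (p.α : ℂ) • x 0 - ((p.γ * p.β : ℝ) : ℂ) • x 1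
      + ((p.l₁ * K₁ : ℝ) : ℂ) • inner ℂ (oneL2 p.L) (x 0) • oneL2 p.L
      + (p.ρ : ℂ) • adjoint J (J (x 0)) - (p.δ : ℂ) • adjoint J (x 2) := fun x => rfl
  have t1 : ∀ x : PiLp 2 E, T x 1 = (p.β : ℂ) • x 1 - ((p.γ * p.β : ℝ) : ℂ) • x 0
      + ((p.l₂ * K₂ : ℝ) : ℂ) • inner ℂ (oneL2 p.L) (x 1) • oneL2 p.L
      + (p.μ : ℂ) • adjoint J (J (x 1)) := fun x => rfl
  have t2 : ∀ x : PiLp 2 E, T x 2 = (p.κ : ℂ) • x 2 + (p.c : ℂ) • J (adjoint J (x 2))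
      + (p.δ : ℂ) • J (x 0) := fun x => rfl
  obtain ⟨k, hk, hcoer⟩ := exists_coercive_bound p hK₁ hK₂
  have coer : ∀ x : PiLp 2 E, k * ‖x‖ ^ 2 ≤ (inner ℂ (T x) x).re := by
    intro x
    rw [PiLp.inner_apply, Fin.sum_univ_three, PiLp.norm_sq_eq_of_L2, Fin.sum_univ_three]
    exact hcoer (x 0) (x 1) (x 2)
  obtain ⟨x, hx⟩ := surjective_of_coercive T hk coer (e.symm ![b₁, b₂, b₃])
  refine ⟨x 0, x 1, x 2, ?_, ?_, ?_⟩
  · exact (t0 x).symm.trans (by rw [hx]; rfl)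
  · exact (t1 x).symm.trans (by rw [hx]; rfl)
  · exact (t2 x).symm.trans (by rw [hx]; rfl)

end PiezoBeam

/-! ### Surjectivity of `1 - A₁` -/

namespace PiezoBeam

open PhaseSpace BeamParameters

variable {p : BeamParameters}

-- The first and fourth equations give `V = F.V + f` and `P = F.P + g`. The momentum equations are
-- integrated from `L`, where the boundary conditions prescribe the stresses, and the heat equation
-- from `0`, where the flux vanishes. This turns them into the system of `exists_derivatives`, and
-- each step can be reversed.
open ContinuousLinearMap in
theorem exists_sub_applyA₁_eq (F : PhaseSpace p) :
    ∃ (U : PhaseSpace p) (hU : InDomain U), U - applyA₁ U hU = F := by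
  obtain ⟨b₁, K₁, hK₁, hd₁⟩ := exists_diffusive_resolvent (p := p) F.φ₁
  obtain ⟨b₂, K₂, hK₂, hd₂⟩ := exists_diffusive_resolvent (p := p) F.φ₂
  set v := weakDeriv p.L F.V with hv
  set r := weakDeriv p.L F.P with hr
  obtain ⟨u, w, q, e₁, e₂, e₃⟩ := exists_derivatives p hK₁ hK₂
    (((p.γ * p.β : ℝ) : ℂ) • r - (p.α : ℂ) • v - ((p.l₁ : ℂ) * b₁) • oneL2 p.L
      + (p.ρ : ℂ) • adjoint (primitive p) F.f)
    (((p.γ * p.β : ℝ) : ℂ) • v - (p.β : ℂ) • r - ((p.l₂ : ℂ) * b₂) • oneL2 p.L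
      + (p.μ : ℂ) • adjoint (primitive p) F.g)
    ((p.c : ℂ) • primitive p F.θ)
  -- The input is `f(L)`, because `f` will be the primitive of `u`; likewise for `g(L)` and `w`.
  obtain ⟨φ₁, wφ₁, oφ₁, dφ₁, rφ₁⟩ := hd₁ (inner ℂ (oneL2 p.L) u)
  obtain ⟨φ₂, wφ₂, oφ₂, dφ₂, rφ₂⟩ := hd₂ (inner ℂ (oneL2 p.L) w)
  have hρ : (p.ρ : ℂ) ≠ 0 := Complex.ofReal_ne_zero.2 p.ρ_pos.ne'
  have hμ : (p.μ : ℂ) ≠ 0 := Complex.ofReal_ne_zero.2 p.μ_pos.ne'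
  have hc : (p.c : ℂ) ≠ 0 := Complex.ofReal_ne_zero.2 p.c_pos.ne'
  have hκ : (p.κ : ℂ) ≠ 0 := Complex.ofReal_ne_zero.2 p.κ_pos.ne'
  have hβ : (p.β : ℂ) ≠ 0 := Complex.ofReal_ne_zero.2 p.β_pos.ne'
  have hα₁ : (p.α₁ : ℂ) ≠ 0 := Complex.ofReal_ne_zero.2 p.α₁_pos.ne'
  set θ := adjoint (primitive p) q with hθ
  let U : PhaseSpace p := ⟨F.V + primitive p u, primitive p u, φ₁, F.P + primitive p w,
    primitive p w, φ₂, θ, add_mem F.V_star (primitive_mem_H1star u),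
    add_mem F.P_star (primitive_mem_H1star w)⟩
  have UV : weakDeriv p.L U.V = v + u := by
    rw [show U.V = F.V + primitive p u from rfl, weakDeriv_add F.V_mem (primitive_mem_H1 u),
      weakDeriv_primitive]
  have UP : weakDeriv p.L U.P = r + w := by
    rw [show U.P = F.P + primitive p w from rfl, weakDeriv_add F.P_mem (primitive_mem_H1 w),
      weakDeriv_primitive]
  have Uθ : weakDeriv p.L U.θ = -q := weakDeriv_adjoint_primitive q
  -- the stresses
  set X₁ : L2Beam p.L := (p.ρ : ℂ) • primitive p u - (p.δ : ℂ) • q - (p.ρ : ℂ) • F.f with hX₁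
  set X₂ : L2Beam p.L := (p.μ : ℂ) • primitive p w - (p.μ : ℂ) • F.g with hX₂
  set S₁ : L2Beam p.L := (-(p.l₁ : ℂ) * p.output φ₁) • oneL2 p.L - adjoint (primitive p) X₁
    with hS₁
  set S₂ : L2Beam p.L := (-(p.l₂ : ℂ) * p.output φ₂) • oneL2 p.L - adjoint (primitive p) X₂
    with hS₂
  -- The first equation of the system, read as: the stress has derivative `X₁` and the value at `L`
  -- prescribed by the feedback.
  have s₁ : (p.α : ℂ) • (v + u) - ((p.γ * p.β : ℝ) : ℂ) • (r + w) = S₁ := by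
    rw [hS₁, hX₁, oφ₁]
    simp only [map_sub, map_smul]
    push_cast at e₁ ⊢
    linear_combination (norm := module) e₁
  have s₂ : (p.β : ℂ) • (r + w) - ((p.γ * p.β : ℝ) : ℂ) • (v + u) = S₂ := by
    rw [hS₂, hX₂, oφ₂]
    simp only [map_sub, map_smul]
    push_cast at e₂ ⊢
    linear_combination (norm := module) e₂
  have hmem : ∀ (z : ℂ) (X : L2Beam p.L), z • oneL2 p.L - adjoint (primitive p) X ∈ H1 p.L :=
    fun z X => sub_mem (Submodule.smul_mem _ _ oneL2_mem_H1) (adjoint_primitive_mem_H1 X)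
  have hder : ∀ (z : ℂ) (X : L2Beam p.L),
      weakDeriv p.L (z • oneL2 p.L - adjoint (primitive p) X) = X := fun z X => by
    rw [weakDeriv_sub (Submodule.smul_mem _ _ oneL2_mem_H1) (adjoint_primitive_mem_H1 X),
      weakDeriv_smul _ oneL2_mem_H1, weakDeriv_oneL2, weakDeriv_adjoint_primitive, smul_zero,
      zero_sub, neg_neg]
  have hval : ∀ (z : ℂ) (X : L2Beam p.L),
      pointValue p.L (z • oneL2 p.L - adjoint (primitive p) X) p.L = z := fun z X => by
    rw [pointValue_sub p.L_pos (Submodule.smul_mem _ _ oneL2_mem_H1)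
      (adjoint_primitive_mem_H1 X) p.L_mem, pointValue_smul p.L_pos _ oneL2_mem_H1 p.L_mem,
      pointValue_oneL2 p.L_mem, pointValue_adjoint_primitive_right, mul_one, sub_zero]
  -- The stresses lie in `H¹` by construction, and the strains are recovered by inverting the
  -- stiffness matrix: since `α - γ² β = α₁ > 0`, one gets `α₁ V_x = S₁ + γ S₂`.
  have mV : v + u ∈ H1 p.L := by
    have : v + u = (p.α₁ : ℂ)⁻¹ • (S₁ + (p.γ : ℂ) • S₂) := by
      rw [eq_inv_smul_iff₀ hα₁, ← s₁, ← s₂, α]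
      push_cast
      module
    rw [this]
    exact Submodule.smul_mem _ _ (add_mem (hmem _ _) (Submodule.smul_mem _ _ (hmem _ _)))
  have mP : r + w ∈ H1 p.L := by
    have : r + w = (p.β : ℂ)⁻¹ • (S₂ + ((p.γ * p.β : ℝ) : ℂ) • (v + u)) := by
      rw [eq_inv_smul_iff₀ hβ, ← s₂]
      module
    rw [this]
    exact Submodule.smul_mem _ _ (add_mem (hmem _ _) (Submodule.smul_mem _ _ mV))
  have d₁ : (p.α : ℂ) • weakDeriv p.L (v + u) - ((p.γ * p.β : ℝ) : ℂ) • weakDeriv p.L (r + w)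
      = X₁ := by
    rw [← weakDeriv_smul _ mV, ← weakDeriv_smul _ mP,
      ← weakDeriv_sub (Submodule.smul_mem _ _ mV) (Submodule.smul_mem _ _ mP), s₁]
    exact hder _ _
  have d₂ : (p.β : ℂ) • weakDeriv p.L (r + w) - ((p.γ * p.β : ℝ) : ℂ) • weakDeriv p.L (v + u)
      = X₂ := by
    rw [← weakDeriv_smul _ mV, ← weakDeriv_smul _ mP,
      ← weakDeriv_sub (Submodule.smul_mem _ _ mP) (Submodule.smul_mem _ _ mV), s₂]
    exact hder _ _
  have v₁ : p.α * pointValue p.L (v + u) p.L - p.γ * p.β * pointValue p.L (r + w) p.L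
      = -p.l₁ * p.output φ₁ := by
    rw [← Complex.ofReal_mul, ← pointValue_smul p.L_pos _ mV p.L_mem,
      ← pointValue_smul p.L_pos _ mP p.L_mem, ← pointValue_sub p.L_pos
      (Submodule.smul_mem _ _ mV) (Submodule.smul_mem _ _ mP) p.L_mem, s₁]
    exact hval _ _
  have v₂ : p.β * pointValue p.L (r + w) p.L - p.γ * p.β * pointValue p.L (v + u) p.L
      = -p.l₂ * p.output φ₂ := by
    rw [← Complex.ofReal_mul, ← pointValue_smul p.L_pos _ mV p.L_mem,
      ← pointValue_smul p.L_pos _ mP p.L_mem, ← pointValue_sub p.L_pos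
      (Submodule.smul_mem _ _ mP) (Submodule.smul_mem _ _ mV) p.L_mem, s₂]
    exact hval _ _
  -- the heat flux
  have hq : -q = primitive p ((p.κ : ℂ)⁻¹ • ((p.c : ℂ) • θ + (p.δ : ℂ) • u - (p.c : ℂ) • F.θ)) := by
    rw [map_smul, eq_inv_smul_iff₀ hκ]
    simp only [map_sub, map_add, map_smul]
    linear_combination (norm := module) -e₃
  have mq : -q ∈ H1 p.L := hq ▸ primitive_mem_H1 _
  have dq : weakDeriv p.L (-q)
      = (p.κ : ℂ)⁻¹ • ((p.c : ℂ) • θ + (p.δ : ℂ) • u - (p.c : ℂ) • F.θ) := by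
    rw [hq, weakDeriv_primitive]
  have pf : pointValue p.L U.f p.L = inner ℂ (oneL2 p.L) u := pointValue_primitive_right u
  have pg : pointValue p.L U.g p.L = inner ℂ (oneL2 p.L) w := pointValue_primitive_right w
  have hU : InDomain U :=
    { V_mem := ⟨U.V_mem, UV ▸ mV⟩
      P_mem := ⟨U.P_mem, UP ▸ mP⟩
      f_mem := primitive_mem_H1star u
      g_mem := primitive_mem_H1star w
      θ_mem := ⟨adjoint_primitive_mem_H1 q, Uθ ▸ mq⟩
      θ_deriv_left := by rw [Uθ, hq, pointValue_primitive_zero]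
      θ_right := pointValue_adjoint_primitive_right q
      φ₁_weight := wφ₁
      φ₂_weight := wφ₂
      φ₁_mem := pf ▸ dφ₁
      φ₂_mem := pg ▸ dφ₂
      V_boundary := by rw [UV, UP]; exact v₁
      P_boundary := by rw [UV, UP]; exact v₂ }
  refine ⟨U, hU, ?_⟩
  have key : U = F + applyA₁ U hU := by
    refine PhaseSpace.ext rfl ?_ ?_ rfl ?_ ?_ ?_
    · change primitive p u = F.f + (applyA₁ U hU).f
      refine smul_right_injective _ hρ ?_
      simp only [applyA₁, UV, UP, Uθ]
      have : (p.ρ : ℂ) • (F.f + (((p.α / p.ρ : ℝ) : ℂ) • weakDeriv p.L (v + u)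
          - ((p.γ * p.β / p.ρ : ℝ) : ℂ) • weakDeriv p.L (r + w) - ((p.δ / p.ρ : ℝ) : ℂ) • -q))
          = (p.ρ : ℂ) • F.f + ((p.α : ℂ) • weakDeriv p.L (v + u)
            - ((p.γ * p.β : ℝ) : ℂ) • weakDeriv p.L (r + w)) + (p.δ : ℂ) • q := by
        push_cast
        match_scalars <;> field_simp
      rw [this, d₁, hX₁]
      module
    · change φ₁ = F.φ₁ + hU.φ₁_mem.toLp _
      rw [← rφ₁]
      simp only [pf]
      exact (sub_add_cancel _ _).symm
    · change primitive p w = F.g + (applyA₁ U hU).g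
      refine smul_right_injective _ hμ ?_
      simp only [applyA₁, UV, UP]
      have : (p.μ : ℂ) • (F.g + (-((p.γ * p.β / p.μ : ℝ) : ℂ) • weakDeriv p.L (v + u)
          + ((p.β / p.μ : ℝ) : ℂ) • weakDeriv p.L (r + w)))
          = (p.μ : ℂ) • F.g + ((p.β : ℂ) • weakDeriv p.L (r + w)
            - ((p.γ * p.β : ℝ) : ℂ) • weakDeriv p.L (v + u)) := by
        push_cast
        match_scalars <;> field_simp
      rw [this, d₂, hX₂]
      module
    · change φ₂ = F.φ₂ + hU.φ₂_mem.toLp _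
      rw [← rφ₂]
      simp only [pg]
      exact (sub_add_cancel _ _).symm
    · change θ = F.θ + (applyA₁ U hU).θ
      have hf : weakDeriv p.L U.f = u := weakDeriv_primitive u
      simp only [applyA₁, Uθ, dq, hf]
      push_cast
      match_scalars <;> field_simp <;> ring
  nth_rewrite 1 [key]
  exact add_sub_cancel_right _ _

theorem isMaximalDissipative_A₁ (p : BeamParameters) :
    OperatorSemigroup.IsMaximalDissipative (A₁ p) where
  re_inner_nonpos U := re_inner_applyA₁_nonpos U.2
  surjective F := by
    obtain ⟨U, hU, h⟩ := exists_sub_applyA₁_eq F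
    exact ⟨⟨U, hU⟩, h⟩

end PiezoBeam

theorem mainTheorem5 (p : PiezoBeam.BeamParameters) :
    ∃ S : ℝ → PiezoBeam.PhaseSpace p →L[ℂ] PiezoBeam.PhaseSpace p,
      PiezoBeam.IsContractionSemigroup S ∧ PiezoBeam.IsGenerator (PiezoBeam.A₁ p) S ∧
      ∀ U₀ : PiezoBeam.PhaseSpace p, U₀ ∈ (PiezoBeam.A₁ p).domain →
        PiezoBeam.IsSolution (PiezoBeam.A₁ p) U₀ (fun t => S t U₀) ∧
        ∀ U : ℝ → PiezoBeam.PhaseSpace p, PiezoBeam.IsSolution (PiezoBeam.A₁ p) U₀ U →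
          ∀ t : ℝ, 0 ≤ t → U t = S t U₀ :=
  (PiezoBeam.isMaximalDissipative_A₁ p).exists_semigroup
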